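/- **Setting.** An $m$-player Markov game $\mathcal G$ has a finite non-empty state space $\mathcal S$ ($S=|\mathcal S|$), a horizon $H\ge1$, finite non-empty action sets $\mathcal A_1,\dots,\mathcal A_m$ ($A_i=|\mathcal A_i|$), transition kernels $\mathbb P_h(\cdot\mid s,\mathbf a)$, rewards $R_{i,h}(s,\mathbf a)\in[-1/H,1/H]$ for $h\in[H]$, and an initial state distribution $\mu$. Let $\beta(\mathcal G)$ be the number of binary digits after the point that suffice to write each reward, each transition probability and each initial probability ($\infty$ if there is no such number), and $|\mathcal G|=\max\{S,\max_iA_i,H,\beta(\mathcal G)\}$. A general policy $\sigma_i$ of player $i$ maps the history $(s_1,a_{i,1},r_{i,1},\dots,s_{h-1},a_{i,h-1},r_{i,h-1})$ of the states, own actions and own rewards, together with the current state $s_h$, to a distribution on $\mathcal A_i$; a product policy is $\sigma=(\sigma_1,\dots,\sigma_m)$, where the players draw their actions independently, and $V_i^\sigma$ is the expected sum of player $i$'s rewards in an episode. A policy $\sigma_i$ is $N$-computable if for each step $h$ there is a Boolean circuit with at most $N$ vertices which, given history and current state in binary, outputs the distribution of the action, its probabilities in binary; a product policy is $N$-computable if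 each of its components is. The $(T,\epsilon,N)$-GenCCE problem for $\mathcal G$ is to find (as circuits with at most $N$ vertices) $N$-computable product policies $\sigma^{(1)},\dots,\sigma^{(T)}$ whose uniform mixture is an $\epsilon$-coarse correlated equilibrium: for every player $i$ and every general policy $\sigma_i'$ of player $i$, $$\frac1T\sum_{t=1}^T V_i^{(\sigma_i',\sigma^{(t)}_{-i})}-\frac1T\sum_{t=1}^T V_i^{\sigma^{(t)}}\le\epsilon .$$ The $2$-player $(k,\epsilon)$-Nash problem is, given a $2$-player $k$-action normal-form game with payoffs in $[0,1]$ that have at most $\max\{k,2\}$ binary digits after the point, to compute a product distribution from which no player can gain more than $\epsilon$ by deviating to a fixed action. Algorithms are programs for a random access machine model on integers and ordered pairs, with logarithmic cost for arithmetic; randomized ones may also toss fair coins. **Theorem.** There are an absolute constant $C_0>0$ and a single randomized algorithm $\mathcal B$, which may call another algorithm as a subroutine (whose steps are counted), such that the following holds. Let $n,T,N,U\in\mathbb N$ and $0<\epsilon\le1$ satisfy $1<T<\exp(\epsilon^2n/16)$. Suppose that $\mathcal A$ is a deterministic algorithm which, given the description of any $3$-player Markov game $\mathcal G$ with $|\mathcal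 G|\le n$, solves the $(T,\epsilon,N)$-GenCCE problem for $\mathcal G$ in time $U$. Then for every $0<\delta\le\frac12$ the algorithm $\mathcal B$ with subroutine $\mathcal A$, given the parameters $n,T,N,\lceil1/\epsilon\rceil,\lceil\log(1/\delta)\rceil$ as additional input, solves the $2$-player $(\lfloor n/2\rfloor,50\epsilon)$-Nash problem in randomized time $\left(nTNU\log(1/\delta)/\epsilon\right)^{C_0}$ with failure probability at most $\delta$: on every input it always halts within this time, and with probability at least $1-\delta$ its output is a $50\epsilon$-Nash equilibrium. -/

import Mathlib

namespace GenCCE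

/-! ## Machine model: while-programs over integers and ordered pairs, logarithmic cost -/

/-- Data: integers and ordered pairs. -/
inductive Val where
  | int (z : ℤ)
  | pair (a b : Val)

namespace Val

/-- The integer stored in a value (`0` for a pair). -/
def toInt : Val → ℤ
  | int z => z
  | pair _ _ => 0

def fst : Val → Val
  | int _ => int 0
  | pair a _ => a

def snd : Val → Val
  | int _ => int 0
  | pair _ b => b

/-- Tests succeed on pairs and on positive integers. -/
def test : Val → Bool
  | int z => decide (0 < z)
  | pair _ _ => true

/-- Number of binary digits of the integer stored in a value. -/
def bits (v : Val) : ℕ := v.toInt.natAbs.size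

/-- Lists are right-nested pairs that end in the integer `0`. -/
def ofList : List Val → Val
  | [] => int 0
  | v :: vs => pair v (ofList vs)

def ofNat (k : ℕ) : Val := int k

/-- The list of the values `f 0, …, f (k - 1)`. -/
def table {k : ℕ} (f : Fin k → Val) : Val := ofList (List.ofFn f)

end Val

/-- Arithmetic operations; `div` is integer division, with value `0` for the divisor `0`. -/
inductive ArithOp where
  | add
  | sub
  | mul
  | div

def ArithOp.eval : ArithOp → ℤ → ℤ → ℤ
  | .add, a, b => a + b
  | .sub, a, b => a - b
  | .mul, a, b => a * b
  | .div, a, b => a / b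

/-- Programs. Registers are numbered by natural numbers; in each command `x` is the register
that is written (or tested). `coin` stores a random bit, `call x y` stores in `x` the output of
the subroutine on the content of `y`. -/
inductive Program where
  | const (x : ℕ) (z : ℤ)
  | copy (x y : ℕ)
  | pair (x y z : ℕ)
  | fst (x y : ℕ)
  | snd (x y : ℕ)
  | arith (o : ArithOp) (x y z : ℕ)
  | coin (x : ℕ)
  | call (x y : ℕ)
  | seq (c d : Program)
  | cond (x : ℕ) (c d : Program)
  | loop (x : ℕ) (c : Program)

/-- Contents of the registers. -/
abbrev Store := ℕ → Val

/-- `Run sub c s w s' w' t`: started with registers `s` and with the sequence `w` of coin tosses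
ahead, the program `c` halts after `t` steps with registers `s'`, with `w'` the tosses that
were not used. `sub v u t` says that the subroutine, called on `v`, returns `u` after `t` steps.
An arithmetic operation costs one step plus the binary lengths of its operands, the loading of a
constant one step plus its binary length, a call one step plus the steps of the subroutine. -/
inductive Run (sub : Val → Val → ℕ → Prop) :
    Program → Store → List Bool → Store → List Bool → ℕ → Prop
  | const (x : ℕ) (z : ℤ) (s : Store) (w : List Bool) :
      Run sub (.const x z) s w (Function.update s x (.int z)) w (1 + z.natAbs.size)
  | copy (x y : ℕ) (s : Store) (w : List Bool) :
      Run sub (.copy x y) s w (Function.update s x (s y)) w 1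
  | pair (x y z : ℕ) (s : Store) (w : List Bool) :
      Run sub (.pair x y z) s w (Function.update s x (.pair (s y) (s z))) w 1
  | fst (x y : ℕ) (s : Store) (w : List Bool) :
      Run sub (.fst x y) s w (Function.update s x (s y).fst) w 1
  | snd (x y : ℕ) (s : Store) (w : List Bool) :
      Run sub (.snd x y) s w (Function.update s x (s y).snd) w 1
  | arith (o : ArithOp) (x y z : ℕ) (s : Store) (w : List Bool) :
      Run sub (.arith o x y z) s w
        (Function.update s x (.int (o.eval (s y).toInt (s z).toInt))) w
        (1 + (s y).bits + (s z).bits)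
  | coin (x : ℕ) (s : Store) (b : Bool) (w : List Bool) :
      Run sub (.coin x) s (b :: w) (Function.update s x (.int (if b then 1 else 0))) w 1
  | call (x y : ℕ) (s : Store) (w : List Bool) (u : Val) (t : ℕ) (h : sub (s y) u t) :
      Run sub (.call x y) s w (Function.update s x u) w (1 + t)
  | seq (c d : Program) (s s₁ s₂ : Store) (w w₁ w₂ : List Bool) (t₁ t₂ : ℕ)
      (hc : Run sub c s w s₁ w₁ t₁) (hd : Run sub d s₁ w₁ s₂ w₂ t₂) :
      Run sub (.seq c d) s w s₂ w₂ (t₁ + t₂)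
  | condTrue (x : ℕ) (c d : Program) (s s₁ : Store) (w w₁ : List Bool) (t : ℕ)
      (hx : (s x).test = true) (hc : Run sub c s w s₁ w₁ t) :
      Run sub (.cond x c d) s w s₁ w₁ (1 + t)
  | condFalse (x : ℕ) (c d : Program) (s s₁ : Store) (w w₁ : List Bool) (t : ℕ)
      (hx : (s x).test = false) (hd : Run sub d s w s₁ w₁ t) :
      Run sub (.cond x c d) s w s₁ w₁ (1 + t)
  | loopTrue (x : ℕ) (c : Program) (s s₁ s₂ : Store) (w w₁ w₂ : List Bool) (t₁ t₂ : ℕ)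
      (hx : (s x).test = true) (hc : Run sub c s w s₁ w₁ t₁)
      (hl : Run sub (.loop x c) s₁ w₁ s₂ w₂ t₂) :
      Run sub (.loop x c) s w s₂ w₂ (1 + t₁ + t₂)
  | loopFalse (x : ℕ) (c : Program) (s : Store) (w : List Bool) (hx : (s x).test = false) :
      Run sub (.loop x c) s w s w 1

/-- On input `v` (placed in register `0`, all other registers holding `0`) and coin tosses `w`,
the program halts after `t` steps with output `u` in register `0`. -/
def Outputs (sub : Val → Val → ℕ → Prop) (c : Program) (w : List Bool) (v u : Val) (t : ℕ) :
    Prop :=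
  ∃ (s' : Store) (w' : List Bool),
    Run sub c (Function.update (fun _ => Val.int 0) 0 v) w s' w' t ∧ s' 0 = u

/-- Deterministic computation: no coin tosses and no subroutine. -/
def Computes (c : Program) (v u : Val) (t : ℕ) : Prop :=
  Outputs (fun _ _ _ => False) c [] v u t

/-- Computation of the randomized program `c` linked with the deterministic program `A` as its
subroutine. Steps of `A` are counted. -/
def RandComputes (c A : Program) (w : List Bool) (v u : Val) (t : ℕ) : Prop :=
  Outputs (Computes A) c w v u t

/-! ## Boolean circuits -/

/-- Gates; arguments are the numbers of earlier vertices. -/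
inductive Gate where
  | const (b : Bool)
  | not (i : ℕ)
  | and (i j : ℕ)
  | or (i j : ℕ)

/-- The vertices are numbered: first the inputs, then the gates in the order of the list. -/
structure Circuit where
  inputs : ℕ
  gates : List Gate
  outputs : List ℕ

def Gate.eval (vs : List Bool) : Gate → Bool
  | .const b => b
  | .not i => !(vs.getD i false)
  | .and i j => vs.getD i false && vs.getD j false
  | .or i j => vs.getD i false || vs.getD j false

/-- The arguments of the gate are among the vertices `0, …, k - 1`. -/
def Gate.ArgsLT (k : ℕ) : Gate → Prop
  | .const _ => True
  | .not i => i < k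
  | .and i j => i < k ∧ j < k
  | .or i j => i < k ∧ j < k

namespace Circuit

/-- The size is the number of vertices. -/
def size (c : Circuit) : ℕ := c.inputs + c.gates.length

/-- Every gate uses earlier vertices only; the outputs are distinct vertices. -/
def WellFormed (c : Circuit) : Prop :=
  (∀ (k : ℕ) (hk : k < c.gates.length), (c.gates[k]).ArgsLT (c.inputs + k)) ∧
    c.outputs.Nodup ∧ ∀ o ∈ c.outputs, o < c.size

/-- The output bits on the given input bits. -/
def eval (c : Circuit) (x : List Bool) : List Bool :=
  c.outputs.map fun o =>
    (c.gates.foldl (fun vs g => vs ++ [g.eval vs]) x).getD o false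

end Circuit

def Gate.encode : Gate → Val
  | .const b => .ofList [.ofNat 0, .ofNat b.toNat]
  | .not i => .ofList [.ofNat 1, .ofNat i]
  | .and i j => .ofList [.ofNat 2, .ofNat i, .ofNat j]
  | .or i j => .ofList [.ofNat 3, .ofNat i, .ofNat j]

def Circuit.encode (c : Circuit) : Val :=
  .ofList [.ofNat c.inputs, .ofList (c.gates.map Gate.encode), .ofList (c.outputs.map Val.ofNat)]

/-! ## Binary representations -/

/-- `x` can be written with `b` binary digits after the point. -/
def HasBits (b : ℕ) (x : ℝ) : Prop := ∃ z : ℤ, x = (z : ℝ) / 2 ^ b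

/-- The numerator of `x` over the denominator `2 ^ b`. -/
noncomputable def numer (b : ℕ) (x : ℝ) : ℤ := ⌊x * 2 ^ b⌋

/-- The `w` lowest binary digits of `k`, lowest first. -/
def natBits (w k : ℕ) : List Bool := List.ofFn fun j : Fin w => k.testBit j

/-- The number with the given binary digits, lowest first. -/
def ofBits : List Bool → ℕ
  | [] => 0
  | b :: bs => b.toNat + 2 * ofBits bs

/-! ## Markov games -/

/-- An `m`-player finite-horizon Markov game. -/
structure MarkovGame (m : ℕ) where
  /-- number of states -/
  S : ℕ
  /-- horizon -/
  H : ℕ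
  /-- numbers of actions -/
  A : Fin m → ℕ
  S_pos : 0 < S
  H_pos : 0 < H
  A_pos : ∀ i, 0 < A i
  /-- transition kernels -/
  P : Fin H → Fin S → (∀ i, Fin (A i)) → stdSimplex ℝ (Fin S)
  /-- rewards -/
  R : Fin m → Fin H → Fin S → (∀ i, Fin (A i)) → ℝ
  R_bound : ∀ i h s a, |R i h s a| ≤ 1 / (H : ℝ)
  /-- initial state distribution -/
  μ : stdSimplex ℝ (Fin S)

namespace MarkovGame

variable {m : ℕ} (G : MarkovGame m)

/-- Joint actions. -/
abbrev JointAction : Type := ∀ i, Fin (G.A i)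

/-- All rewards and probabilities can be written with `b` binary digits after the point. -/
def AllHaveBits (b : ℕ) : Prop :=
  (∀ i h s a, HasBits b (G.R i h s a)) ∧ (∀ h s a s', HasBits b ((G.P h s a).1 s')) ∧
    ∀ s, HasBits b (G.μ.1 s)

/-- The number of bits that describe each reward or probability of the game (`⊤` if no finite
number suffices). -/
noncomputable def beta : ℕ∞ := ⨅ (b : ℕ) (_ : G.AllHaveBits b), (b : ℕ∞)

/-- The size `|G|`. -/
noncomputable def size : ℕ∞ := max (max (G.S : ℕ∞) (⨆ i, (G.A i : ℕ∞))) (max (G.H : ℕ∞) G.beta)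

/-- The number of bits per reward or probability in a description of the game. -/
noncomputable def prec : ℕ := G.beta.toNat

/-- The description of the game: `S`, `H`, the numbers of actions, the precision, and the tables
of all rewards and probabilities. Joint actions are listed in mixed radix, the first player's
action being the lowest digit. -/
noncomputable def encode : Val :=
  .ofList
    [.ofNat G.S, .ofNat G.H, .table fun i => .ofNat (G.A i), .ofNat G.prec,
      .table fun s => .int (numer G.prec (G.μ.1 s)),
      .table fun h => .table fun s => .table fun a : Fin (∏ i, G.A i) => .table fun s' =>
        .int (numer G.prec ((G.P h s (finPiFinEquiv.symm a)).1 s')),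
      .table fun i => .table fun h => .table fun s => .table fun a : Fin (∏ i, G.A i) =>
        .int (numer G.prec (G.R i h s (finPiFinEquiv.symm a)))]

/-- The history of player `i`: the states, own actions and own rewards so far. -/
abbrev History (i : Fin m) : Type := List (Fin G.S × Fin (G.A i) × ℝ)

/-- Randomized general policies of player `i`. The history has length `h` when the action of
step `h` (counted from `0`) is chosen. -/
abbrev Policy (i : Fin m) : Type := G.History i → Fin G.S → stdSimplex ℝ (Fin (G.A i))

/-- Product general policies. -/
abbrev Profile : Type := ∀ i, G.Policy i

/-- One step of a trajectory: state, joint action, rewards. -/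
abbrev Step : Type := Fin G.S × G.JointAction × (Fin m → ℝ)

/-- What player `i` sees of a trajectory. -/
def view (i : Fin m) (τ : List G.Step) : G.History i :=
  τ.map fun x => (x.1, x.2.1 i, x.2.2 i)

/-- Expectation of `F` (complete trajectory), when the trajectory so far is `τ`, the state is
about to be drawn from `d`, and the remaining steps are the listed ones: players act
independently, each on their own history and the current state. -/
noncomputable def expectFrom (σ : G.Profile) (F : List G.Step → ℝ) :
    List (Fin G.H) → List G.Step → (Fin G.S → ℝ) → ℝ
  | [], τ, _ => F τ
  | h :: hs, τ, d =>
      ∑ s, d s * ∑ a : G.JointAction, (∏ i, (σ i (G.view i τ) s).1 (a i)) *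
        expectFrom σ F hs (τ ++ [(s, a, fun i => G.R i h s a)]) (G.P h s a).1

/-- Expectation of a function of the trajectory of an episode. -/
noncomputable def expect (σ : G.Profile) (F : List G.Step → ℝ) : ℝ :=
  G.expectFrom σ F (List.finRange G.H) [] G.μ.1

/-- The value of player `i`: the expected sum of rewards. -/
noncomputable def value (σ : G.Profile) (i : Fin m) : ℝ :=
  G.expect σ fun τ => (τ.map fun x => x.2.2 i).sum

/-- The value of player `i` when the product policy is drawn uniformly from a sequence. -/
noncomputable def mixValue {T : ℕ} (σ : Fin T → G.Profile) (i : Fin m) : ℝ :=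
  (1 / (T : ℝ)) * ∑ t, G.value (σ t) i

/-- The uniform mixture of a sequence of product policies is an `ε`-coarse correlated
equilibrium. -/
def IsMixCCE {T : ℕ} (ε : ℝ) (σ : Fin T → G.Profile) : Prop :=
  ∀ (i : Fin m) (σ' : G.Policy i),
    G.mixValue (fun t => Function.update (σ t) i σ') i - G.mixValue σ i ≤ ε

/-- The rewards that occur as input of circuits: numbers in the range of the rewards that have
the precision of the game. -/
def IsReward (r : ℝ) : Prop := |r| ≤ 1 / (G.H : ℝ) ∧ HasBits G.prec r

/-- Binary input for a history and a state. A reward is given by a sign bit and the binary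
digits of its absolute value. -/
noncomputable def inputBits (i : Fin m) (τ : G.History i) (s : Fin G.S) : List Bool :=
  (τ.flatMap fun x =>
    natBits (Nat.clog 2 G.S) x.1 ++ natBits (Nat.clog 2 (G.A i)) x.2.1 ++
      (decide (numer G.prec x.2.2 < 0) ::
        natBits (G.prec + 1) (numer G.prec x.2.2).natAbs)) ++
    natBits (Nat.clog 2 G.S) s

/-- The circuit `c` computes step `h` of the policy `σ` of player `i`: on input of a history of
length `h` and a state it outputs the distribution of the action, with `L` binary digits after
the point and one before it for each probability. -/
def CircuitComputes (c : Circuit) (i : Fin m) (h : Fin G.H) (σ : G.Policy i) : Prop :=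
  ∃ L : ℕ, c.outputs.length = G.A i * (L + 1) ∧
    ∀ (τ : G.History i) (s : Fin G.S), τ.length = h → (∀ x ∈ τ, G.IsReward x.2.2) →
      (G.inputBits i τ s).length = c.inputs ∧
      ∀ a : Fin (G.A i), (σ τ s).1 a =
        (ofBits (((c.eval (G.inputBits i τ s)).drop (a * (L + 1))).take (L + 1)) : ℝ) / 2 ^ L

/-- The family `c` of well-formed circuits of size at most `N` computes the product policy
`σ`. -/
def ComputedBy (N : ℕ) (c : ∀ _ : Fin m, Fin G.H → Circuit) (σ : G.Profile) : Prop :=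
  ∀ i h, (c i h).WellFormed ∧ (c i h).size ≤ N ∧ G.CircuitComputes (c i h) i h (σ i)

/-- `N`-computable product policies. -/
def NComputable (N : ℕ) (σ : G.Profile) : Prop := ∃ c, G.ComputedBy N c σ

/-- The sequence `σ` is a solution of the `(T, ε, N)`-GenCCE problem. -/
def IsGenCCE (T : ℕ) (ε : ℝ) (N : ℕ) (σ : Fin T → G.Profile) : Prop :=
  (∀ t, G.NComputable N (σ t)) ∧ G.IsMixCCE ε σ

/-- The value `u` describes, by circuits of size at most `N`, a solution of the
`(T, ε, N)`-GenCCE problem. -/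
def IsGenCCEOutput (T : ℕ) (ε : ℝ) (N : ℕ) (u : Val) : Prop :=
  ∃ (σ : Fin T → G.Profile) (c : Fin T → Fin m → Fin G.H → Circuit),
    G.IsGenCCE T ε N σ ∧ (∀ t, G.ComputedBy N (c t) (σ t)) ∧
      u = .table fun t => .table fun i => .table fun h => (c t i h).encode

end MarkovGame

/-- The program `A` solves `(T, ε, N)`-GenCCE in time `U` for every `m`-player Markov game of
size at most `n`. -/
def SolvesGenCCE (m n T : ℕ) (ε : ℝ) (N U : ℕ) (A : Program) : Prop :=
  ∀ G : MarkovGame m, G.size ≤ (n : ℕ∞) →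
    ∃ (u : Val) (t : ℕ), Computes A G.encode u t ∧ t ≤ U ∧ G.IsGenCCEOutput T ε N u

/-! ## Normal-form games -/

/-- An `m`-player `n`-action normal-form game with payoffs in `[0, 1]`. -/
structure NormalFormGame (m n : ℕ) where
  M : Fin m → (Fin m → Fin n) → ℝ
  M_mem : ∀ i a, M i a ∈ Set.Icc (0 : ℝ) 1

namespace NormalFormGame

variable {m n : ℕ} (G : NormalFormGame m n)

/-- Each payoff can be expressed with `max n m` bits. -/
def IsInstance : Prop := ∀ i a, HasBits (max n m) (G.M i a)

/-- Expectation under a product distribution. -/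
noncomputable def expect (p : Fin m → stdSimplex ℝ (Fin n)) (f : (Fin m → Fin n) → ℝ) : ℝ :=
  ∑ a, (∏ j, (p j).1 (a j)) * f a

/-- `ε`-Nash equilibria. -/
def IsNash (ε : ℝ) (p : Fin m → stdSimplex ℝ (Fin n)) : Prop :=
  ∀ (i : Fin m) (a' : Fin n),
    expect p (fun a => G.M i (Function.update a i a')) - expect p (G.M i) ≤ ε

/-- The description of the game: number of actions and payoff tables. Action profiles are listed
in radix `n`, the first player's action being the lowest digit. -/
noncomputable def encode : Val :=
  .pair (.ofNat n) (.table fun i => .table fun a : Fin (n ^ m) =>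
    .int (numer (max n m) (G.M i (finFunctionFinEquiv.symm a))))

/-- The value `u` describes an `ε`-Nash equilibrium: for each player a denominator and the list
of the numerators of the probabilities. -/
def IsNashOutput (ε : ℝ) (u : Val) : Prop :=
  ∃ (p : Fin m → stdSimplex ℝ (Fin n)) (D : Fin m → ℕ) (k : Fin m → Fin n → ℕ),
    G.IsNash ε p ∧ (∀ j, 0 < D j) ∧ (∀ j a, (p j).1 a = (k j a : ℝ) / (D j : ℝ)) ∧
      u = .table fun j => .pair (.ofNat (D j)) (.table fun a => .ofNat (k j a))

end NormalFormGame

/-- The randomized program `c`, with the program `A` as subroutine and with the parameters `par`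
as additional input, solves the `m`-player `(n, ε)`-Nash problem in time `B` with failure
probability `δ`: it halts within `B` steps for all coin tosses, and its output is an
`ε`-Nash equilibrium with probability at least `1 - δ`. No more than `⌊B⌋` coins can be tossed
within `B` steps, so that this many are drawn. -/
def SolvesNash (m n : ℕ) (ε δ B : ℝ) (par : Val) (c A : Program) : Prop :=
  ∀ G : NormalFormGame m n, G.IsInstance →
    (∀ w : Fin ⌊B⌋₊ → Bool, ∃ (u : Val) (t : ℕ),
      RandComputes c A (List.ofFn w) (.pair par G.encode) u t ∧ (t : ℝ) ≤ B) ∧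
    (1 - δ) * 2 ^ ⌊B⌋₊ ≤
      (Nat.card {w : Fin ⌊B⌋₊ → Bool // ∃ (u : Val) (t : ℕ),
        RandComputes c A (List.ofFn w) (.pair par G.encode) u t ∧ G.IsNashOutput ε u} : ℝ)

end GenCCE

namespace GenCCE

/-! Let k = n/2 be the number of actions of a two-player game. Add a third player who names one of
the two players and an action for that player, receives the gain that this deviation would bring,
and has it paid by the named player. This stage game is zero-sum. The best payoff of the third
player against independent mixed actions p, q is the largest expected gain from a deviation to a
fixed action, so that it is small exactly when (p, q) is an approximate Nash equilibrium. Each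
original player can secure a nonnegative payoff by best responding to the other one. The stage game
is repeated H = 2 ^ c times, with H the largest power of two up to n, and payoffs are divided by 2H.
The last binary digits of each reward hold the joint action, so that a player's own rewards reveal
all past play (`decode_rew`); this disturbs the values only by an amount exponentially small in k.

Let σ(1), …, σ(T) be the profiles returned by the subroutine. As a test of the equilibrium
condition, each player deviates to the following general policy: after every history, weight each t
by the likelihood of the opponents' past actions under σ(t), and play an action that is optimal
against the weighted mixture (`bayesAct`). When the opponents really follow σ(t), the loss relative
to best responding to σ(t) after every history is at most log T / λ + 4λH (`regret`, `dev_regret`).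
The potential behind this is the logarithm of the inverse posterior weight of t: it starts at log T,
is never negative, and falls on average whenever the player loses (`info_step`). With λ = ε/4 and
log T ≤ ε²H/8 the loss is at most 3εH/2.

Add the equilibrium conditions of the three players. The values nearly cancel, the best-response
values of the first two players are nonnegative, and what remains bounds the third player's
best-response value: averaged over t and over the histories that the third player's deviation
produces, the first two players are within 11ε of a Nash equilibrium (`sum_topUtil_le`). By Markov's
inequality a simulation of that deviation meets a pair of mixed actions with gap at most 50/⌈1/ε⌉
except with probability 11/49 < 1/e, and ⌈log(1/δ)⌉ independent simulations push the failure
probability below δ (`avg_all_fail_le`). The gap can be tested, so that the reduction recognises a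
good pair when it meets one. For large ε, where 50ε ≥ 1, any pair of pure actions will do.

The circuits give probabilities with fewer than N binary digits, hence likelihoods, utilities and
gaps are integers of polynomial length over known powers of two, and the simulation is exact. Its
running time is obtained compositionally: `Triple` is a timed Hoare triple for a stack machine, and
`Comp s f g` says that one program turns `f x` into `g x` in time polynomial in `s x`. `Comp` is
closed under pairing, arithmetic, branching and counted loops, so that each function is programmed
by following its definition. Coins stay outside `Comp`: they are all tossed in one loop and stored
beforehand. -/

theorem Run.then {sub : Val → Val → ℕ → Prop} {c d : Program} {s s₁ s₂ : Store}
    {w w₁ w₂ : List Bool} {t₁ t₂ : ℕ} (hc : Run sub c s w s₁ w₁ t₁) (hd : Run sub d s₁ w₁ s₂ w₂ t₂) :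
    Run sub (.seq c d) s w s₂ w₂ (t₁ + t₂) := Run.seq _ _ _ _ _ _ _ _ _ _ hc hd

/-! ## Programs on a stack that is kept in register `0` -/

/-- Started with `v` on top of the stack, the program consumes the coins `κ` and replaces `v` by
`u` within `t` steps; all registers other than `0` are scratch. -/
def Triple (sub : Val → Val → ℕ → Prop) (c : Program) (κ : List Bool) (v u : Val) (t : ℕ) :
    Prop :=
  ∀ (st : Store) (w : List Bool) (rest : Val), st 0 = .pair v rest →
    ∃ (st' : Store) (t' : ℕ), Run sub c st (κ ++ w) st' w t' ∧ st' 0 = .pair u rest ∧ t' ≤ t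

namespace Triple

variable {sub : Val → Val → ℕ → Prop} {c d : Program} {κ κ' : List Bool} {v u z : Val}
  {t t' : ℕ}

theorem mono (h : Triple sub c κ v u t) (ht : t ≤ t') : Triple sub c κ v u t' := by
  intro st w rest hst
  obtain ⟨st', t₁, h1, h2, h3⟩ := h st w rest hst
  exact ⟨st', t₁, h1, h2, h3.trans ht⟩

theorem seq (h : Triple sub c κ v u t) (h' : Triple sub d κ' u z t') :
    Triple sub (.seq c d) (κ ++ κ') v z (t + t') := by
  intro st w rest hst
  obtain ⟨s₁, t₁, h1, h2, h3⟩ := h st (κ' ++ w) rest hst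
  obtain ⟨s₂, t₂, k1, k2, k3⟩ := h' s₁ w rest h2
  refine ⟨s₂, t₁ + t₂, ?_, k2, by omega⟩
  rw [List.append_assoc]
  exact Run.then h1 k1

theorem seq_nil (h : Triple sub c [] v u t) (h' : Triple sub d [] u z t') :
    Triple sub (.seq c d) [] v z (t + t') := by
  simpa using h.seq h'

theorem skip : Triple sub (.copy 1 0) [] v v 1 := by
  intro st w rest hst
  exact ⟨_, _, Run.copy _ _ _ _, by simp [hst], le_rfl⟩

/-- Apply a one-register instruction to the top of the stack. -/
def onTop (c : Program) : Program :=
  .seq (.fst 1 0) (.seq (.snd 2 0) (.seq c (.pair 0 1 2)))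

theorem of_onTop
    (h : ∀ (st : Store) (w : List Bool), st 1 = v →
      ∃ (st' : Store) (t' : ℕ), Run sub c st (κ ++ w) st' w t' ∧ st' 1 = u ∧ st' 2 = st 2 ∧
        t' ≤ t) :
    Triple sub (onTop c) κ v u (t + 3) := by
  intro st w rest hst
  obtain ⟨st', t', h1, h2, h3, h4⟩ := h
    (Function.update (Function.update st 1 (st 0).fst) 2 (st 0).snd) w (by simp [hst, Val.fst])
  refine ⟨_, _, Run.then (Run.fst _ _ _ _)
    (Run.then (Run.snd _ _ _ _)
      (Run.then (s₁ := st') (w₁ := w) (t₁ := t') ?_ (Run.pair _ _ _ _ _))), ?_, ?_⟩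
  · simpa using h1
  · simp [h2, h3, hst, Val.snd]
  · omega

theorem fst : Triple sub (onTop (.fst 1 1)) [] v v.fst 4 :=
  of_onTop fun st w h => ⟨_, _, Run.fst _ _ _ _, by simp [h], by simp, le_rfl⟩

theorem snd : Triple sub (onTop (.snd 1 1)) [] v v.snd 4 :=
  of_onTop fun st w h => ⟨_, _, Run.snd _ _ _ _, by simp [h], by simp, le_rfl⟩

theorem const (z : ℤ) : Triple sub (onTop (.const 1 z)) [] v (.int z) (1 + z.natAbs.size + 3) :=
  of_onTop fun st w h => ⟨_, _, Run.const _ _ _ _, by simp, by simp, le_rfl⟩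

theorem arith (o : ArithOp) (a b : ℤ) :
    Triple sub (onTop (.seq (.fst 3 1) (.seq (.snd 4 1) (.arith o 1 3 4)))) []
      (.pair (.int a) (.int b)) (.int (o.eval a b)) (a.natAbs.size + b.natAbs.size + 6) := by
  refine (of_onTop (t := a.natAbs.size + b.natAbs.size + 3)
    fun st w h => ⟨_, _, Run.then (Run.fst _ _ _ _)
      (Run.then (Run.snd _ _ _ _) (Run.arith _ _ _ _ _ _)), ?_, ?_, ?_⟩)
  · simp [h, Val.fst, Val.snd, Val.toInt]
  · simp
  · simp [h, Val.fst, Val.snd, Val.toInt, Val.bits]; omega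

/-- Replace the first component of the top of the stack by the output of the subroutine. -/
theorem call {a b y : Val} {t : ℕ} (h : sub a y t) :
    Triple sub (onTop (.seq (.fst 3 1) (.seq (.snd 4 1) (.seq (.call 3 3) (.pair 1 3 4))))) []
      (.pair a b) (.pair y b) (t + 7) := by
  refine (of_onTop (t := t + 4)
    fun st w hs => ⟨_, _, Run.then (Run.fst _ _ _ _)
      (Run.then (Run.snd _ _ _ _)
        (Run.then (Run.call _ _ _ _ y t ?_) (Run.pair _ _ _ _ _))),
      ?_, ?_, ?_⟩)
  · simpa [hs, Val.fst] using h
  · simp [hs, Val.snd]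
  · simp
  · omega

/-- `c` works on a copy of the top. Its result is then slid below the original, on which `d` works,
so that the stack passes through v, v and v, u and z, u before the two results are joined. -/
def pairProg (c d : Program) : Program :=
  .seq (.seq (.fst 1 0) (.pair 0 1 0)) (.seq c (.seq
    (.seq (.fst 1 0) (.seq (.snd 2 0) (.seq (.fst 3 2) (.seq (.snd 4 2)
      (.seq (.pair 1 1 4) (.pair 0 3 1))))))
    (.seq d
      (.seq (.fst 1 0) (.seq (.snd 2 0) (.seq (.fst 3 2) (.seq (.snd 4 2)
        (.seq (.pair 3 3 1) (.pair 0 3 4)))))))))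

theorem pair (h : Triple sub c [] v u t) (h' : Triple sub d [] v z t') :
    Triple sub (pairProg c d) [] v (.pair u z) (t + t' + 14) := by
  intro st w rest hst
  obtain ⟨s₁, t₁, h1, h2, h3⟩ := h
    (Function.update (Function.update st 1 (st 0).fst) 0 (.pair v (.pair v rest))) w
    (.pair v rest) (by simp)
  obtain ⟨s₂, t₂, k1, k2, k3⟩ := h'
    (Function.update (Function.update (Function.update (Function.update (Function.update
      (Function.update s₁ 1 u) 2 (.pair v rest)) 3 v) 4 rest) 1 (.pair u rest)) 0
      (.pair v (.pair u rest))) w (.pair u rest) (by simp)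
  refine ⟨_, _, Run.then
    (Run.then (Run.fst _ _ _ _) (Run.pair _ _ _ _ _))
    (Run.then (s₁ := s₁) (w₁ := w) (t₁ := t₁) ?_ (Run.then
      (Run.then (Run.fst _ _ _ _)
      (Run.then (Run.snd _ _ _ _)
      (Run.then (Run.fst _ _ _ _)
      (Run.then (Run.snd _ _ _ _)
      (Run.then (Run.pair _ _ _ _ _) (Run.pair _ _ _ _ _))))))
      (Run.then (s₁ := s₂) (w₁ := w) (t₁ := t₂) ?_
      (Run.then (Run.fst _ _ _ _)
      (Run.then (Run.snd _ _ _ _)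
      (Run.then (Run.fst _ _ _ _)
      (Run.then (Run.snd _ _ _ _)
      (Run.then (Run.pair _ _ _ _ _) (Run.pair _ _ _ _ _)))))))
      )), ?_, ?_⟩
  · simpa [hst, Val.fst] using h1
  · simpa [h2, Val.fst, Val.snd] using k1
  · simp [k2, Val.fst, Val.snd]
  · omega

/-- The test consumes a copy; its result moves to register `1`, and the original is on top again
when a branch starts. -/
def condProg (b c d : Program) : Program :=
  .seq (.seq (.fst 1 0) (.pair 0 1 0)) (.seq b (.seq (.fst 1 0) (.seq (.snd 0 0) (.cond 1 c d))))

theorem cond {b : Program} {y : Val} (hb : Triple sub b [] v y t)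
    (hc : y.test = true → Triple sub c κ v u t') (hd : y.test = false → Triple sub d κ v u t') :
    Triple sub (condProg b c d) κ v u (t + t' + 5) := by
  intro st w rest hst
  obtain ⟨s₁, t₁, h1, h2, h3⟩ := hb
    (Function.update (Function.update st 1 (st 0).fst) 0 (.pair v (.pair v rest))) (κ ++ w)
    (.pair v rest) (by simp)
  set s₂ := Function.update (Function.update s₁ 1 y) 0 (.pair v rest) with hs₂
  have key : ∃ (st' : Store) (t'' : ℕ), Run sub (.cond 1 c d) s₂ (κ ++ w) st' w t'' ∧
      st' 0 = .pair u rest ∧ t'' ≤ 1 + t' := by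
    have h0 : s₂ 0 = .pair v rest := by simp [hs₂]
    have h1' : s₂ 1 = y := by simp [hs₂]
    cases hy : y.test with
    | true =>
      obtain ⟨s₃, t₃, k1, k2, k3⟩ := hc hy s₂ w rest h0
      exact ⟨s₃, _, Run.condTrue _ _ _ _ _ _ _ _ (by rw [h1', hy]) k1, k2, by omega⟩
    | false =>
      obtain ⟨s₃, t₃, k1, k2, k3⟩ := hd hy s₂ w rest h0
      exact ⟨s₃, _, Run.condFalse _ _ _ _ _ _ _ _ (by rw [h1', hy]) k1, k2, by omega⟩
  obtain ⟨st', t'', k1, k2, k3⟩ := key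
  refine ⟨st', _, Run.then
    (Run.then (Run.fst _ _ _ _) (Run.pair _ _ _ _ _))
    (Run.then (s₁ := s₁) (w₁ := κ ++ w) (t₁ := t₁) ?_
    (Run.then (Run.fst _ _ _ _)
    (Run.then (Run.snd _ _ _ _) (t₂ := t'') ?_))), k2, ?_⟩
  · simpa [hst, Val.fst] using h1
  · simpa [h2, Val.fst, Val.snd, hs₂] using k1
  · omega

/-- Register `1` is scratch for the body of a loop, so that the loop test has to be fetched from the
stack again after each pass. -/
def peek : Program := .seq (.fst 1 0) (.fst 1 1)

def whileProg (c : Program) : Program := .seq peek (.loop 1 (.seq c peek))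

/-- The invariant is that register `1` agrees with the first component of the top. Induction splits
off the first pass and shifts the states and the coins by one. -/
theorem while_aux (m : ℕ) : ∀ (S : ℕ → Val) (κ : ℕ → List Bool) (t : ℕ),
    (∀ j < m, (S j).fst.test = true) → (S m).fst.test = false →
    (∀ j < m, Triple sub c (κ j) (S j) (S (j + 1)) t) →
    ∀ (st : Store) (w : List Bool) (rest : Val), st 0 = .pair (S 0) rest → st 1 = (S 0).fst →
      ∃ (st' : Store) (t' : ℕ),
        Run sub (.loop 1 (.seq c peek)) st ((List.range m).flatMap κ ++ w) st' w t' ∧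
          st' 0 = .pair (S m) rest ∧ t' ≤ m * (t + 3) + 1 := by
  induction m with
  | zero =>
    intro S κ t _ hm _ st w rest h0 h1
    exact ⟨st, 1, by simpa using Run.loopFalse _ _ _ _ (by rw [h1, hm]), h0, by omega⟩
  | succ m ih =>
    intro S κ t hj hm hc st w rest h0 h1
    obtain ⟨s₁, t₁, k1, k2, k3⟩ := hc 0 (by omega) st
      ((List.range m).flatMap (fun j => κ (j + 1)) ++ w) rest h0
    obtain ⟨s₂, t₂, l1, l2, l3⟩ := ih (fun j => S (j + 1)) (fun j => κ (j + 1)) t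
      (fun j h => hj _ (by omega)) hm (fun j h => hc _ (by omega))
      (Function.update (Function.update s₁ 1 (.pair (.int 0) (.int 0))) 1 (S 1).fst)
      w rest (by simp [k2]) (by simp)
    refine ⟨s₂, _, Run.loopTrue _ _ _ _ _ _ _ _ _ (t₂ := t₂) (by rw [h1, hj _ (by omega)])
      (Run.then (s₁ := s₁) (t₁ := t₁)
        (w₁ := (List.range m).flatMap (fun j => κ (j + 1)) ++ w) ?_
        (Run.then (Run.fst _ _ _ _) (Run.fst _ _ _ _))) ?_, l2, ?_⟩
    · convert k1 using 1
      rw [List.range_succ_eq_map]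
      simp [List.flatMap_map]
    · convert l1 using 1
      simp [k2, Val.fst]
    · have : (m + 1) * (t + 3) = m * (t + 3) + (t + 3) := by ring
      omega

/-- A loop that runs while the first component of the top of the stack is true. -/
theorem loop {m : ℕ} {S : ℕ → Val} {κ : ℕ → List Bool} {t : ℕ}
    (hj : ∀ j < m, (S j).fst.test = true) (hm : (S m).fst.test = false)
    (hc : ∀ j < m, Triple sub c (κ j) (S j) (S (j + 1)) t) :
    Triple sub (whileProg c) ((List.range m).flatMap κ) (S 0) (S m) (m * (t + 3) + 3) := by
  intro st w rest hst
  obtain ⟨s₁, t₁, h1, h2, h3⟩ := while_aux m S κ t hj hm hc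
    (Function.update (Function.update st 1 (.pair (.int 0) (.int 0))) 1 (S 0).fst)
    w rest (by simp [hst]) (by simp)
  refine ⟨s₁, _, Run.then (Run.then
    (Run.fst _ _ _ _) (Run.fst _ _ _ _)) (t₂ := t₁) ?_, h2, by omega⟩
  convert h1 using 1
  simp [hst, Val.fst]

end Triple

/-! ## Polynomial bounds -/

/-- `b` is bounded by a polynomial in `s`. -/
def PolyBdd {X : Type} (s b : X → ℕ) : Prop := ∃ C : ℕ, ∀ x, b x ≤ (s x + 2) ^ C

namespace PolyBdd

variable {X Y : Type} {s a b : X → ℕ}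

theorem mono (h : PolyBdd s b) (hab : ∀ x, a x ≤ b x) : PolyBdd s a :=
  h.imp fun _ hC x => (hab x).trans (hC x)

/-- The base `s x + 2` is at least 2, whence k < 2 ^ k is enough; the same remark absorbs sums into
one more factor. -/
theorem const (k : ℕ) : PolyBdd s fun _ => k :=
  ⟨k, fun x => (Nat.lt_two_pow_self (n := k)).le.trans
    (Nat.pow_le_pow_left (Nat.le_add_left 2 (s x)) k)⟩

theorem self : PolyBdd s s := ⟨1, fun _ => by simp⟩

theorem mul (ha : PolyBdd s a) (hb : PolyBdd s b) : PolyBdd s fun x => a x * b x := by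
  obtain ⟨A, hA⟩ := ha
  obtain ⟨B, hB⟩ := hb
  exact ⟨A + B, fun x => by rw [pow_add]; exact Nat.mul_le_mul (hA x) (hB x)⟩

theorem add (ha : PolyBdd s a) (hb : PolyBdd s b) : PolyBdd s fun x => a x + b x := by
  obtain ⟨A, hA⟩ := ha
  obtain ⟨B, hB⟩ := hb
  refine ⟨max A B + 1, fun x => ?_⟩
  have h1 := hA x |>.trans (Nat.pow_le_pow_right (by omega) (le_max_left A B))
  have h2 := hB x |>.trans (Nat.pow_le_pow_right (by omega) (le_max_right A B))
  calc a x + b x ≤ (s x + 2) ^ max A B * 2 := by omega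
    _ ≤ (s x + 2) ^ max A B * (s x + 2) := Nat.mul_le_mul_left _ (by omega)
    _ = _ := (pow_succ _ _).symm

theorem pow (ha : PolyBdd s a) (k : ℕ) : PolyBdd s fun x => a x ^ k := by
  obtain ⟨A, hA⟩ := ha
  exact ⟨A * k, fun x => by rw [pow_mul]; exact Nat.pow_le_pow_left (hA x) k⟩

theorem reindex (h : PolyBdd s b) (π : Y → X) : PolyBdd (fun y => s (π y)) fun y => b (π y) :=
  h.imp fun _ hC y => hC (π y)

theorem size (h : PolyBdd s b) : PolyBdd s fun x => (b x).size :=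
  h.mono fun _ => Nat.size_le.2 (Nat.lt_two_pow_self)

end PolyBdd

/-! ## Polynomial-time computability on a type of instances -/

/-- There is one program that transforms `f x` into `g x` in time polynomial in `s x`. -/
def Comp {X : Type} (s : X → ℕ) (f g : X → Val) : Prop :=
  ∃ (c : Program) (b : X → ℕ), PolyBdd s b ∧ ∀ sub x, Triple sub c [] (f x) (g x) (b x)

namespace Comp

variable {X Y : Type} {s : X → ℕ} {f g h : X → Val}

theorem id : Comp s f f := ⟨_, _, .const 1, fun _ _ => Triple.skip⟩

theorem comp (hg : Comp s f g) (hh : Comp s g h) : Comp s f h := by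
  obtain ⟨c, b, hb, hc⟩ := hg
  obtain ⟨c', b', hb', hc'⟩ := hh
  exact ⟨_, _, hb.add hb', fun sub x => (hc sub x).seq_nil (hc' sub x)⟩

/-- A program sees values and not instances, hence serves any family of instances that maps to the
given one. -/
theorem reindex (hg : Comp s f g) (π : Y → X) :
    Comp (fun y => s (π y)) (fun y => f (π y)) fun y => g (π y) := by
  obtain ⟨c, b, hb, hc⟩ := hg
  exact ⟨c, _, hb.reindex π, fun sub y => hc sub (π y)⟩

theorem fst (hg : Comp s f g) : Comp s f fun x => (g x).fst :=
  hg.comp ⟨_, _, .const 4, fun _ _ => Triple.fst⟩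

theorem snd (hg : Comp s f g) : Comp s f fun x => (g x).snd :=
  hg.comp ⟨_, _, .const 4, fun _ _ => Triple.snd⟩

theorem const (z : ℤ) : Comp s f fun _ => .int z :=
  ⟨_, _, .const _, fun _ _ => Triple.const z⟩

theorem pair (hg : Comp s f g) (hh : Comp s f h) : Comp s f fun x => .pair (g x) (h x) := by
  obtain ⟨c, b, hb, hc⟩ := hg
  obtain ⟨c', b', hb', hc'⟩ := hh
  exact ⟨_, _, (hb.add hb').add (.const 14), fun sub x => (hc sub x).pair (hc' sub x)⟩

theorem arith (o : ArithOp) {u v : X → ℤ} (hu : Comp s f fun x => .int (u x))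
    (hv : Comp s f fun x => .int (v x)) (bu : PolyBdd s fun x => (u x).natAbs.size)
    (bv : PolyBdd s fun x => (v x).natAbs.size) : Comp s f fun x => .int (o.eval (u x) (v x)) :=
  (hu.pair hv).comp ⟨_, _, (bu.add bv).add (.const 6), fun _ x => Triple.arith o (u x) (v x)⟩

/-- Branching on a computed test. Each branch has to be right only where it is taken. -/
theorem cases {y : X → Val} (p : X → Prop) (hy : Comp s f y) (hp : ∀ x, (y x).test = true ↔ p x)
    (h₁ : Comp (fun x : {x // p x} => s x) (fun x => f x) fun x => g x)
    (h₂ : Comp (fun x : {x // ¬p x} => s x) (fun x => f x) fun x => g x) : Comp s f g := by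
  classical
  obtain ⟨c, b, hb, hc⟩ := hy
  obtain ⟨c₁, b₁, ⟨C₁, hb₁⟩, hc₁⟩ := h₁
  obtain ⟨c₂, b₂, ⟨C₂, hb₂⟩, hc₂⟩ := h₂
  -- The bounds of the branches live on subtypes only; the powers that dominate them make sense for
  -- every instance.
  refine ⟨Triple.condProg c c₁ c₂, fun x => b x + ((s x + 2) ^ C₁ + (s x + 2) ^ C₂) + 5,
    (hb.add (.add ⟨C₁, fun x => le_rfl⟩ ⟨C₂, fun x => le_rfl⟩)).add (.const 5),
    fun sub x => (hc sub x).cond (fun ht => ?_) fun ht => ?_⟩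
  · have hx : p x := (hp x).1 ht
    exact (hc₁ sub ⟨x, hx⟩).mono ((hb₁ ⟨x, hx⟩).trans (Nat.le_add_right _ _))
  · have hx : ¬p x := fun h => by simp [(hp x).2 h] at ht
    exact (hc₂ sub ⟨x, hx⟩).mono ((hb₂ ⟨x, hx⟩).trans (Nat.le_add_left _ _))

/-- The number of the pass is made part of the instance: a single program serves all passes, under a
bound that does not depend on the pass. -/
theorem loop {m : X → ℕ} (hm : PolyBdd s m) {S : X → ℕ → Val}
    (h1 : ∀ x, ∀ j < m x, (S x j).fst.test = true) (h2 : ∀ x, (S x (m x)).fst.test = false)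
    (hc : Comp (fun y : Σ x, Fin (m x) => s y.1) (fun y => S y.1 y.2) fun y => S y.1 (y.2 + 1)) :
    Comp s (fun x => S x 0) fun x => S x (m x) := by
  obtain ⟨c, b, ⟨C, hC⟩, hc⟩ := hc
  refine ⟨Triple.whileProg c, fun x => m x * ((s x + 2) ^ C + 3) + 3,
    (hm.mul (.add ⟨C, fun x => le_rfl⟩ (.const 3))).add (.const 3), fun sub x => ?_⟩
  have := Triple.loop (sub := sub) (c := c) (κ := fun _ => []) (t := (s x + 2) ^ C) (h1 x) (h2 x)
    fun j hj => (hc sub ⟨x, ⟨j, hj⟩⟩).mono (hC ⟨x, ⟨j, hj⟩⟩)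
  have h0 : (List.range (m x)).flatMap (fun _ => ([] : List Bool)) = [] := by simp
  rwa [h0] at this

end Comp


/-! ### Integer-valued computations and extended contexts -/

/-- An integer-valued function that is computable in polynomial time and has polynomially many
binary digits. -/
structure CompZ {X : Type} (s : X → ℕ) (f : X → Val) (u : X → ℤ) : Prop where
  comp : Comp s f fun x => .int (u x)
  bdd : PolyBdd s fun x => (u x).natAbs.size

/-- `CompZ` for functions with natural numbers as values. -/
abbrev CompN {X : Type} (s : X → ℕ) (f : X → Val) (u : X → ℕ) : Prop := CompZ s f fun x => (u x : ℤ)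

/-- The context `f'` on `Y` extends the context `f` on `X`. -/
structure Weak {X Y : Type} (s : X → ℕ) (f : X → Val) (π : Y → X) (f' : Y → Val) : Prop where
  comp : ∀ {g : X → Val}, Comp s f g → Comp (fun y => s (π y)) f' fun y => g (π y)

theorem Weak.z {X Y : Type} {s : X → ℕ} {f : X → Val} {π : Y → X} {f' : Y → Val}
    (W : Weak s f π f') {u : X → ℤ} (h : CompZ s f u) :
    CompZ (fun y => s (π y)) f' fun y => u (π y) :=
  ⟨W.comp h.comp, h.bdd.reindex π⟩

theorem Weak.of_snd {X Y : Type} {s : X → ℕ} {f : X → Val} {π : Y → X} {f' : Y → Val}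
    (h : Comp (fun y => s (π y)) f' fun y => f (π y)) : Weak s f π f' :=
  ⟨fun hg => h.comp (hg.reindex π)⟩

theorem Comp.congr {X : Type} {s : X → ℕ} {f g g' : X → Val} (h : Comp s f g)
    (he : ∀ x, g x = g' x) : Comp s f g' := by
  rwa [← funext he]

theorem natAbs_add_size_le (a b : ℤ) :
    (a + b).natAbs.size ≤ a.natAbs.size + b.natAbs.size + 1 := by
  refine Nat.size_le.2 ((Int.natAbs_add_le a b).trans_lt ?_)
  have h1 := Nat.lt_size_self a.natAbs
  have h2 := Nat.lt_size_self b.natAbs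
  have h3 : 2 ^ a.natAbs.size ≤ 2 ^ (a.natAbs.size + b.natAbs.size) :=
    Nat.pow_le_pow_right (by norm_num) (by omega)
  have h4 : 2 ^ b.natAbs.size ≤ 2 ^ (a.natAbs.size + b.natAbs.size) :=
    Nat.pow_le_pow_right (by norm_num) (by omega)
  rw [pow_succ]; omega

theorem natAbs_mul_size_le (a b : ℤ) : (a * b).natAbs.size ≤ a.natAbs.size + b.natAbs.size := by
  rw [Int.natAbs_mul]
  refine Nat.size_le.2 ?_
  rw [pow_add]
  exact Nat.mul_lt_mul'' (Nat.lt_size_self _) (Nat.lt_size_self _)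

namespace CompZ

variable {X Y : Type} {s : X → ℕ} {f : X → Val} {u v : X → ℤ}

theorem congr {u' : X → ℤ} (h : CompZ s f u) (he : ∀ x, u x = u' x) : CompZ s f u' := by
  rwa [← funext he]

theorem const (z : ℤ) : CompZ s f fun _ => z := ⟨.const z, .const _⟩

theorem add (hu : CompZ s f u) (hv : CompZ s f v) : CompZ s f fun x => u x + v x :=
  ⟨.arith .add hu.comp hv.comp hu.bdd hv.bdd,
    ((hu.bdd.add hv.bdd).add (.const 1)).mono fun _ => natAbs_add_size_le _ _⟩

theorem sub (hu : CompZ s f u) (hv : CompZ s f v) : CompZ s f fun x => u x - v x :=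
  ⟨.arith .sub hu.comp hv.comp hu.bdd hv.bdd,
    ((hu.bdd.add hv.bdd).add (.const 1)).mono fun x => by
      simpa [sub_eq_add_neg] using natAbs_add_size_le (u x) (-v x)⟩

theorem mul (hu : CompZ s f u) (hv : CompZ s f v) : CompZ s f fun x => u x * v x :=
  ⟨.arith .mul hu.comp hv.comp hu.bdd hv.bdd,
    (hu.bdd.add hv.bdd).mono fun _ => natAbs_mul_size_le _ _⟩

theorem div (hu : CompZ s f u) (hv : CompZ s f v) : CompZ s f fun x => u x / v x :=
  ⟨.arith .div hu.comp hv.comp hu.bdd hv.bdd,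
    hu.bdd.mono fun _ => Nat.size_le_size (Int.natAbs_ediv_le_natAbs _ _)⟩

end CompZ

namespace CompN

variable {X Y : Type} {s : X → ℕ} {f : X → Val} {u v : X → ℕ}

theorem of_comp (h : Comp s f fun x => .ofNat (u x)) (hb : PolyBdd s u) : CompN s f u :=
  ⟨h, hb.size⟩

theorem congr {u' : X → ℕ} (h : CompN s f u) (he : ∀ x, u x = u' x) : CompN s f u' := by
  rwa [← funext he]

theorem const (k : ℕ) : CompN s f fun _ => k := CompZ.const k

theorem add (hu : CompN s f u) (hv : CompN s f v) : CompN s f fun x => u x + v x :=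
  (CompZ.add hu hv).congr fun _ => by push_cast; rfl

theorem mul (hu : CompN s f u) (hv : CompN s f v) : CompN s f fun x => u x * v x :=
  (CompZ.mul hu hv).congr fun _ => by push_cast; rfl

theorem div (hu : CompN s f u) (hv : CompN s f v) : CompN s f fun x => u x / v x :=
  (CompZ.div hu hv).congr fun _ => by push_cast; rfl

theorem sub (hu : CompN s f u) (hv : CompN s f v) (h : ∀ x, v x ≤ u x) :
    CompN s f fun x => u x - v x :=
  (CompZ.sub hu hv).congr fun x => by rw [Nat.cast_sub (h x)]

theorem mod (hu : CompN s f u) (hv : CompN s f v) : CompN s f fun x => u x % v x :=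
  (CompZ.sub hu (hv.mul (hu.div hv))).congr fun x => by
    have := Nat.mod_add_div (u x) (v x)
    zify at this
    push_cast
    linarith

end CompN

/-! ### Counted loops, lists and tables -/

namespace Comp

variable {X Y : Type} {s : X → ℕ} {f g h : X → Val}

theorem cases_lt {u v : X → ℤ} (hu : CompZ s f u) (hv : CompZ s f v)
    (h₁ : Comp (fun x : {x // u x < v x} => s x) (fun x => f x) fun x => g x)
    (h₂ : Comp (fun x : {x // ¬u x < v x} => s x) (fun x => f x) fun x => g x) : Comp s f g :=
  cases _ (hv.sub hu).comp (fun x => by simp [Val.test]) h₁ h₂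

theorem ite_lt {u v : X → ℤ} (hu : CompZ s f u) (hv : CompZ s f v)
    (hg : Comp s f g) (hh : Comp s f h) : Comp s f fun x => if u x < v x then g x else h x :=
  cases_lt hu hv ((hg.reindex Subtype.val).congr fun x => by rw [if_pos x.2])
    ((hh.reindex Subtype.val).congr fun x => by rw [if_neg x.2])

/-- The stack holds the countdown m − j, which is the loop test, then j, the accumulator and the
original context. The body is asked for in every context from which these can be computed, so that
no caller depends on this layout. -/
theorem forLoop {m : X → ℕ} (hm : CompN s f m) (bm : PolyBdd s m) {acc : X → ℕ → Val}
    (h0 : Comp s f fun x => acc x 0)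
    (body : ∀ f' : (Σ x, Fin (m x)) → Val, CompN (fun y => s y.1) f' (fun y => y.2) →
      Comp (fun y => s y.1) f' (fun y => acc y.1 y.2) → Weak s f Sigma.fst f' →
      Comp (fun y => s y.1) f' fun y => acc y.1 (y.2 + 1)) :
    Comp s f fun x => acc x (m x) := by
  have h1 : Comp s (fun x => Val.pair (.int (m x - (0 : ℕ)))
      (.pair (.int (0 : ℕ)) (.pair (acc x 0) (f x)))) (fun x => Val.pair (.int (m x - m x))
      (.pair (.int (m x)) (.pair (acc x (m x)) (f x)))) := by
    refine loop (m := m) bm (S := fun x j => Val.pair (.int (m x - (j : ℕ)))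
      (.pair (.int (j : ℕ)) (.pair (acc x j) (f x)))) ?_ ?_ ?_
    · intro x j hj
      simpa [Val.fst, Val.test] using hj
    · intro x
      simp [Val.fst, Val.test]
    · set f' : (Σ x, Fin (m x)) → Val := fun y => Val.pair (.int (m y.1 - (y.2 : ℕ)))
        (.pair (.int (y.2 : ℕ)) (.pair (acc y.1 y.2) (f y.1))) with hf'
      have hid : Comp (fun y => s y.1) f' f' := .id
      have hf : Comp (fun y => s y.1) f' fun y => f y.1 := hid.snd.snd.snd
      have W : Weak s f Sigma.fst f' := .of_snd hf
      have hj : CompN (fun y => s y.1) f' (fun y => y.2) :=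
        ⟨hid.snd.fst, ((bm.reindex Sigma.fst).mono fun y => y.2.2.le).size⟩
      have hmj := CompZ.sub (W.z hm) (hj.add (.const 1))
      have hj1 := hj.add (.const 1)
      exact hmj.comp.pair (hj1.comp.pair ((body f' hj hid.snd.snd.fst W).pair hf))
  have h2 : Comp s f (fun x => Val.pair (.int (m x - (0 : ℕ)))
      (.pair (.int (0 : ℕ)) (.pair (acc x 0) (f x)))) :=
    (CompZ.sub hm (CompN.const 0)).comp.pair ((Comp.const _).pair (h0.pair .id))
  exact (h2.comp h1).snd.snd.fst

/-- Iterated second components. Beyond the end this is stationary, because the second component of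
an integer is `0`, the empty list. -/
theorem drop {l : X → List Val} {i : X → ℕ} (hl : Comp s f fun x => .ofList (l x))
    (hi : CompN s f i) (bi : PolyBdd s i) : Comp s f fun x => .ofList ((l x).drop (i x)) := by
  refine Comp.forLoop (acc := fun x j => .ofList ((l x).drop j)) hi bi (by simpa using hl) ?_
  intro f' _ ha _
  refine ha.snd.congr fun y => ?_
  rw [← List.drop_drop]
  cases (l y.1).drop y.2 <;> simp [Val.ofList, Val.snd]

/-- Entry of a list, `0` beyond its end. -/
theorem nth {l : X → List Val} {i : X → ℕ} (hl : Comp s f fun x => .ofList (l x))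
    (hi : CompN s f i) (bi : PolyBdd s i) : Comp s f fun x => (l x).getD (i x) (.int 0) := by
  refine (hl.drop hi bi).fst.congr fun x => ?_
  rw [List.getD_eq_getElem?_getD, ← List.head?_drop]
  cases (l x).drop (i x) <;> simp [Val.ofList, Val.fst]

theorem get {m : X → ℕ} {a : ∀ x, Fin (m x) → Val} {i : ∀ x, Fin (m x)}
    (hl : Comp s f fun x => .table (a x)) (hi : CompN s f fun x => (i x : ℕ))
    (bi : PolyBdd s fun x => (i x : ℕ)) : Comp s f fun x => a x (i x) :=
  (nth hl hi bi).congr fun x => by simp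

/-- A list grows at its head, so the entries are produced from the last to the first; `rev` turns
the running index around. -/
theorem table {m : X → ℕ} (hm : CompN s f m) (bm : PolyBdd s m) {a : ∀ x, Fin (m x) → Val}
    (body : ∀ f' : (Σ x, Fin (m x)) → Val, CompN (fun y => s y.1) f' (fun y => y.2) →
      Weak s f Sigma.fst f' → Comp (fun y => s y.1) f' fun y => a y.1 y.2) :
    Comp s f fun x => .table (a x) := by
  have key := Comp.forLoop (acc := fun x j => .ofList ((List.ofFn (a x)).drop (m x - j))) hm bm
    ?_ ?_
  · simpa [Val.table] using key
  · exact (Comp.const 0).congr fun x => by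
      rw [List.drop_eq_nil_of_le (by simp)]; rfl
  · intro f' hj ha W
    let rev : (Σ x, Fin (m x)) → (Σ x, Fin (m x)) := fun y => ⟨y.1, y.2.rev⟩
    have hrev : ∀ y, rev (rev y) = y := fun y => by simp [rev]
    have W' : Weak s f Sigma.fst fun y => f' (rev y) := ⟨fun hg => (W.comp hg).reindex rev⟩
    have hj' : CompN (fun y => s y.1) f' (fun y => (y.2.rev : ℕ)) := by
      refine (CompN.sub (W.z hm) (hj.add (.const 1)) fun y => y.2.2).congr fun y => ?_
      rw [Fin.val_rev]
    have hb := (body (fun y => f' (rev y)) ⟨hj'.comp.reindex rev |>.congr fun y => by simp [rev],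
      ((bm.reindex Sigma.fst).mono fun y => y.2.2.le).size⟩ W').reindex rev
    simp only [hrev] at hb
    refine (hb.pair ha).congr fun y => ?_
    have hlt : m y.1 - (y.2 + 1) < (List.ofFn (a y.1)).length := by
      have := y.2.2
      simp; omega
    rw [List.drop_eq_getElem_cons hlt]
    simp only [Val.ofList, List.getElem_ofFn, rev]
    congr 3
    have := y.2.2
    omega

end Comp

namespace CompZ

variable {X Y : Type} {s : X → ℕ} {f : X → Val} {u v : X → ℤ}

theorem ite_lt {a b : X → ℤ} (hu : CompZ s f u) (hv : CompZ s f v)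
    (ha : CompZ s f a) (hb : CompZ s f b) : CompZ s f fun x => if u x < v x then a x else b x :=
  ⟨(Comp.ite_lt hu hv ha.comp hb.comp).congr fun x => by split_ifs <;> rfl,
    (ha.bdd.add hb.bdd).mono fun x => by split_ifs <;> simp⟩

/-- Partial sums have to stay short as well. The body, applied in one concrete context, bounds all
terms by a common power of two, and adding at most m of them costs no more than the digits of m. -/
theorem sum {m : X → ℕ} (hm : CompN s f m) (bm : PolyBdd s m) {a : ∀ x, Fin (m x) → ℤ}
    (body : ∀ f' : (Σ x, Fin (m x)) → Val, CompN (fun y => s y.1) f' (fun y => y.2) →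
      Weak s f Sigma.fst f' → CompZ (fun y => s y.1) f' fun y => a y.1 y.2) :
    CompZ s f fun x => ∑ j, a x j := by
  have hid : Comp (fun y : Σ x, Fin (m x) => s y.1)
    (fun y => Val.pair (.ofNat y.2) (f y.1)) (fun y => Val.pair (.ofNat y.2) (f y.1)) := .id
  obtain ⟨C, hC⟩ := (body (fun y => .pair (.ofNat y.2) (f y.1)) (.of_comp hid.fst
    ((bm.reindex Sigma.fst).mono fun y => y.2.2.le)) (.of_snd hid.snd)).bdd
  have hb : ∀ x j, (a x j).natAbs ≤ 2 ^ (s x + 2) ^ C := fun x j =>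
    (Nat.lt_size_self _).le.trans (Nat.pow_le_pow_right (by norm_num) (hC ⟨x, j⟩))
  let F : X → ℕ → ℤ := fun x j => if h : j < m x then a x ⟨j, h⟩ else 0
  have hF : ∀ x, ∀ j ≤ m x, (∑ i ∈ Finset.range j, F x i).natAbs.size
      ≤ (m x).size + ((s x + 2) ^ C + 1) := by
    intro x j hj
    have h1 : (∑ i ∈ Finset.range j, F x i).natAbs ≤ j * 2 ^ (s x + 2) ^ C := by
      refine (Int.natAbs_sum_le _ _).trans ?_
      calc _ ≤ ∑ i ∈ Finset.range j, 2 ^ (s x + 2) ^ C := Finset.sum_le_sum fun i _ => by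
            by_cases h : i < m x <;> simp [F, h, hb]
        _ = _ := by simp
    refine Nat.size_le.2 (h1.trans_lt ?_)
    rw [pow_add]
    exact Nat.mul_lt_mul'' (hj.trans_lt (Nat.lt_size_self _))
      (Nat.pow_lt_pow_right (by norm_num) (by omega))
  have bF : PolyBdd s fun x => (m x).size + ((s x + 2) ^ C + 1) :=
    bm.size.add (.add ⟨C, fun x => le_rfl⟩ (.const 1))
  have hsum : ∀ x, ∑ i ∈ Finset.range (m x), F x i = ∑ j, a x j := by
    intro x
    rw [Finset.sum_range]
    exact Finset.sum_congr rfl fun i _ => by simp [F]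
  refine ⟨?_, bF.mono fun x => by rw [← hsum]; exact hF x _ le_rfl⟩
  have key := Comp.forLoop (acc := fun x j => .int (∑ i ∈ Finset.range j, F x i)) hm bm
    (by simpa using Comp.const 0) ?_
  · exact key.congr fun x => by rw [hsum]
  · intro f' hj ha W
    refine ((CompZ.mk ha ((bF.reindex Sigma.fst).mono fun y => hF y.1 y.2 y.2.2.le)).add
      (body f' hj W)).comp.congr fun y => ?_
    rw [Finset.sum_range_succ]
    simp [F]

end CompZ

namespace CompN

variable {X Y : Type} {s : X → ℕ} {f : X → Val}

theorem ite_lt {a b u v : X → ℕ} (hu : CompN s f u) (hv : CompN s f v)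
    (ha : CompN s f a) (hb : CompN s f b) : CompN s f fun x => if u x < v x then a x else b x :=
  (CompZ.ite_lt hu hv ha hb).congr fun x => by simp only [Nat.cast_lt]; split_ifs <;> rfl

theorem sum {m : X → ℕ} (hm : CompN s f m) (bm : PolyBdd s m) {a : ∀ x, Fin (m x) → ℕ}
    (body : ∀ f' : (Σ x, Fin (m x)) → Val, CompN (fun y => s y.1) f' (fun y => y.2) →
      Weak s f Sigma.fst f' → CompN (fun y => s y.1) f' fun y => a y.1 y.2) :
    CompN s f fun x => ∑ j, a x j :=
  (CompZ.sum hm bm (a := fun x j => (a x j : ℤ)) body).congr fun x => by push_cast; rfl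

theorem two_pow {i : X → ℕ} (hi : CompN s f i) (bi : PolyBdd s i) :
    CompN s f fun x => 2 ^ i x := by
  have hb : ∀ j : ℕ, (2 ^ j).size = j + 1 := fun j => Nat.size_pow
  refine ⟨Comp.forLoop (acc := fun x j => .int ((2 ^ j : ℕ) : ℤ)) hi bi (Comp.const 1) ?_,
    (bi.add (.const 1)).mono fun x => by rw [Int.natAbs_natCast, hb]⟩
  intro f' hj ha W
  have ha' : CompN (fun y => s y.1) f' (fun y => 2 ^ (y.2 : ℕ)) :=
    ⟨ha, ((bi.reindex Sigma.fst).add (.const 1)).mono fun y => by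
      rw [Int.natAbs_natCast, hb]; have := y.2.2; omega⟩
  exact (ha'.mul (.const 2)).comp.congr fun y => by rw [pow_succ]

/-- The length counts the j for which dropping j entries leaves a pair, the case in which the test
of the machine succeeds. A known bound N makes this a counted loop. -/
theorem length {l : X → List Val} {N : X → ℕ} (hl : Comp s f fun x => .ofList (l x))
    (hN : CompN s f N) (bN : PolyBdd s N) (h : ∀ x, (l x).length ≤ N x) :
    CompN s f fun x => (l x).length := by
  refine (CompN.sum hN bN (a := fun x j => if (j : ℕ) < (l x).length then 1 else 0) ?_).congr
    fun x => ?_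
  · intro f' hj W
    have hd := (W.comp hl).drop hj ((bN.reindex Sigma.fst).mono fun y => y.2.2.le)
    refine ⟨Comp.cases (fun y => (y.2 : ℕ) < (l y.1).length) hd (fun y => ?_)
      ((Comp.const 1).congr fun y => by simp [if_pos y.2])
      ((Comp.const 0).congr fun y => by simp [if_neg y.2]),
      (PolyBdd.const 1).mono fun y => by dsimp only; split_ifs <;> simp⟩
    rcases h' : (l y.1).drop y.2 with _ | ⟨v, vs⟩
    · simpa [Val.ofList, Val.test] using List.drop_eq_nil_iff.1 h'
    · have : ¬(l y.1).length ≤ y.2 := fun hh => by simp [List.drop_eq_nil_of_le hh] at h'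
      simpa [Val.ofList, Val.test] using this
  · rw [Fin.sum_univ_eq_sum_range (fun j => if j < (l x).length then 1 else 0) (N x),
      ← Finset.sum_filter, Finset.sum_const, smul_eq_mul, mul_one]
    have : (Finset.range (N x)).filter (· < (l x).length) = Finset.range (l x).length := by
      ext j; simp; have := h x; omega
    rw [this, Finset.card_range]

end CompN

theorem Comp.append {X : Type} {s : X → ℕ} {f : X → Val} {l l' : X → List Val}
    (hl : Comp s f fun x => .ofList (l x)) (hl' : Comp s f fun x => .ofList (l' x))
    (hn : CompN s f fun x => (l x).length) (bn : PolyBdd s fun x => (l x).length) :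
    Comp s f fun x => .ofList (l x ++ l' x) := by
  have key := Comp.forLoop
    (acc := fun x j => .ofList ((l x).drop ((l x).length - j) ++ l' x)) hn bn
    (by simpa using hl') ?_
  · simpa using key
  · intro f' hj ha W
    have hi : CompN (fun y : Σ x, Fin (l x).length => s y.1) f'
        (fun y => (l y.1).length - (y.2 + 1)) :=
      CompN.sub (W.z hn) (hj.add (.const 1)) fun y => y.2.2
    have hx := (W.comp hl).nth hi ((bn.reindex Sigma.fst).mono fun y => Nat.sub_le _ _)
    refine (hx.pair ha).congr fun y => ?_
    have hlt : (l y.1).length - (y.2 + 1) < (l y.1).length := by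
      have := y.2.2
      omega
    rw [List.drop_eq_getElem_cons hlt]
    simp only [Val.ofList, List.cons_append, List.getD_eq_getElem _ _ hlt]
    congr 4
    have := y.2.2
    omega

/-! ### Maximisation over a finite range -/

/-- The first index below `m` (if `m` is positive) at which `u` is maximal. -/
def amax {β : Type} [LinearOrder β] (u : ℕ → β) : ℕ → ℕ
  | 0 => 0
  | j + 1 => if u (amax u j) < u j then j else amax u j

section amax

variable {β γ : Type} [LinearOrder β] [LinearOrder γ]

theorem amax_lt (u : ℕ → β) {m : ℕ} (hm : 0 < m) : amax u m < m := by
  induction m with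
  | zero => omega
  | succ m ih =>
    unfold amax
    split_ifs with h
    · omega
    · rcases Nat.eq_zero_or_pos m with rfl | h'
      · simp [amax]
      · have := ih h'; omega

theorem le_amax (u : ℕ → β) {m i : ℕ} (hi : i < m) : u i ≤ u (amax u m) := by
  induction m with
  | zero => omega
  | succ m ih =>
    unfold amax
    rcases Nat.lt_succ_iff_lt_or_eq.1 hi with h | rfl
    · split_ifs with h'
      · exact (ih h).trans h'.le
      · exact ih h
    · split_ifs with h'
      · exact le_rfl
      · exact not_lt.1 h'

/-- Only comparisons enter, ties included. Hence the maximiser of real utilities is the maximiser of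
their integer numerators, and the program finds the very action that the analysis uses. -/
theorem amax_congr {u : ℕ → β} {v : ℕ → γ} {m : ℕ}
    (h : ∀ i < m, ∀ j < m, u i < u j ↔ v i < v j) : amax u m = amax v m := by
  induction m with
  | zero => rfl
  | succ m ih =>
    unfold amax
    rw [ih fun i hi j hj => h i (by omega) j (by omega)]
    have hlt : amax v m < m + 1 := by
      rcases Nat.eq_zero_or_pos m with rfl | h'
      · simp [amax]
      · have := amax_lt v h'; omega
    simp only [h _ hlt m (by omega)]

/-- The index of the maximum of a non-empty finite family. -/
def best [Zero β] {m : ℕ} (hm : 0 < m) (u : Fin m → β) : Fin m :=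
  ⟨amax (fun i => if h : i < m then u ⟨i, h⟩ else 0) m, amax_lt _ hm⟩

theorem le_best [Zero β] {m : ℕ} (hm : 0 < m) (u : Fin m → β) (i : Fin m) : u i ≤ u (best hm u) := by
  have := le_amax (fun i => if h : i < m then u ⟨i, h⟩ else 0) i.2
  simpa [best, amax_lt _ hm] using this

theorem best_congr [Zero β] [Zero γ] {m : ℕ} (hm : 0 < m) {u : Fin m → β} {v : Fin m → γ}
    (h : ∀ i j, u i < u j ↔ v i < v j) : best hm u = best hm v := by
  refine Fin.ext (amax_congr fun i hi j hj => ?_)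
  simp [hi, hj, h]

end amax

theorem CompN.best {X : Type} {s : X → ℕ} {f : X → Val} {m : X → ℕ} (hm : CompN s f m)
    (bm : PolyBdd s m) (h0 : ∀ x, 0 < m x) {a : ∀ x, Fin (m x) → ℤ}
    (body : ∀ f' : (Σ x, Fin (m x)) → Val, CompN (fun y => s y.1) f' (fun y => y.2) →
      Weak s f Sigma.fst f' → CompZ (fun y => s y.1) f' fun y => a y.1 y.2) :
    CompN s f fun x => (GenCCE.best (h0 x) (a x) : ℕ) := by
  have hid : Comp (fun y : Σ x, Fin (m x) => s y.1)
    (fun y => Val.pair (.ofNat y.2) (f y.1)) (fun y => Val.pair (.ofNat y.2) (f y.1)) := .id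
  have ba := (body (fun y => .pair (.ofNat y.2) (f y.1)) (.of_comp hid.fst
    ((bm.reindex Sigma.fst).mono fun y => y.2.2.le)) (.of_snd hid.snd)).bdd
  -- The entry at the best index so far is looked up in this table, as `body` gives the entry at the
  -- running index.
  have ht : Comp s f fun x => .table fun j => .int (a x j) :=
    Comp.table hm bm fun f' hj W => (body f' hj W).comp
  refine .of_comp ?_ (bm.mono fun x => (GenCCE.best (h0 x) (a x)).2.le)
  let F : X → ℕ → ℤ := fun x i => if h : i < m x then a x ⟨i, h⟩ else 0
  have hle : ∀ x, ∀ j < m x, amax (F x) j < m x := fun x j hj => by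
    rcases Nat.eq_zero_or_pos j with rfl | h'
    · simpa [amax] using h0 x
    · have := amax_lt (F x) h'; omega
  refine Comp.forLoop (acc := fun x j => .ofNat (amax (F x) j)) hm bm (Comp.const 0) ?_
  intro f' hj ha W
  have bj : PolyBdd (fun y : Σ x, Fin (m x) => s y.1) fun y => m y.1 := bm.reindex Sigma.fst
  have bi : PolyBdd (fun y : Σ x, Fin (m x) => s y.1) fun y => amax (F y.1) y.2 :=
    bj.mono fun y => (hle y.1 _ y.2.2).le
  have hi : CompN (fun y : Σ x, Fin (m x) => s y.1) f' fun y => amax (F y.1) y.2 := .of_comp ha bi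
  have hvj : CompZ (fun y : Σ x, Fin (m x) => s y.1) f' fun y => a y.1 y.2 :=
    ⟨Comp.get (a := fun (y : Σ x, Fin (m x)) j => .int (a y.1 j)) (i := fun y => y.2)
      (W.comp ht) hj (bj.mono fun y => y.2.2.le), ba⟩
  have hvi : CompZ (fun y : Σ x, Fin (m x) => s y.1) f'
      fun y => a y.1 ⟨amax (F y.1) y.2, hle y.1 _ y.2.2⟩ :=
    ⟨Comp.get (a := fun (y : Σ x, Fin (m x)) j => .int (a y.1 j))
      (i := fun y => ⟨amax (F y.1) y.2, hle y.1 _ y.2.2⟩) (W.comp ht) hi bi,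
      ba.reindex fun y : Σ x, Fin (m x) => (⟨y.1, ⟨amax (F y.1) y.2, hle y.1 _ y.2.2⟩⟩ :
        Σ x, Fin (m x))⟩
  refine (CompZ.ite_lt hvi hvj hj hi).comp.congr fun y => ?_
  simp only [amax, Val.ofNat]
  have e1 : F y.1 (amax (F y.1) y.2) = a y.1 ⟨amax (F y.1) y.2, hle y.1 _ y.2.2⟩ := by
    simp only [F]; rw [dif_pos (hle y.1 _ y.2.2)]
  have e2 : F y.1 y.2 = a y.1 y.2 := by simp [F]
  rw [e1, e2]
  split_ifs <;> rfl


/-! ### Evaluation of circuits -/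

/-- Outputs are distinct vertices. This is the source of the bound on the number of digits of the
probabilities. -/
theorem Circuit.WellFormed.outputs_length_le {c : Circuit} (h : c.WellFormed) :
    c.outputs.length ≤ c.size := by
  have hsub : c.outputs.toFinset ⊆ Finset.range c.size := fun o ho => by
    simpa using h.2.2 o (by simpa using ho)
  have := Finset.card_le_card hsub
  rwa [Finset.card_range, List.toFinset_card_of_nodup h.2.1] at this

def bitVal (b : Bool) : Val := .ofNat b.toNat

def bitsVal (l : List Bool) : Val := .ofList (l.map bitVal)

def Gate.tag : Gate → ℕ
  | .const _ => 0
  | .not _ => 1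
  | .and _ _ => 2
  | .or _ _ => 3

def Gate.arg₁ : Gate → ℕ
  | .const b => b.toNat
  | .not i => i
  | .and i _ => i
  | .or i _ => i

def Gate.arg₂ : Gate → ℕ
  | .const _ => 0
  | .not _ => 0
  | .and _ j => j
  | .or _ j => j

/-- Missing arguments are read as `0`, so that gates of all kinds can be treated as triples. -/
theorem Gate.encode_fields (g : Gate) : ∃ l : List Val, g.encode = .ofList l ∧
    l.getD 0 (.int 0) = .ofNat g.tag ∧ l.getD 1 (.int 0) = .ofNat g.arg₁ ∧
    l.getD 2 (.int 0) = .ofNat g.arg₂ := by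
  cases g <;> exact ⟨_, rfl, rfl, rfl, rfl⟩

theorem Gate.ArgsLT.le {g : Gate} {k : ℕ} (h : g.ArgsLT k) : g.arg₁ ≤ k + 1 ∧ g.arg₂ ≤ k + 1 := by
  cases g with
  | const b => cases b <;> simp [Gate.arg₁, Gate.arg₂]
  | not i => simp only [ArgsLT] at h; simp [Gate.arg₁, Gate.arg₂]; omega
  | and i j => simp only [ArgsLT] at h; simp [Gate.arg₁, Gate.arg₂]; omega
  | or i j => simp only [ArgsLT] at h; simp [Gate.arg₁, Gate.arg₂]; omega

/-- Boolean operations become arithmetic on bits, and the kind of the gate is selected by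
comparisons, as both are available to `CompZ`. -/
theorem Gate.eval_toNat (g : Gate) (vs : List Bool) :
    ((g.eval vs).toNat : ℤ) = if g.tag < 1 then (g.arg₁ : ℤ) else
      if g.tag < 2 then 1 - ((vs.getD g.arg₁ false).toNat : ℤ) else
        if g.tag < 3 then (vs.getD g.arg₁ false).toNat * (vs.getD g.arg₂ false).toNat else
          (vs.getD g.arg₁ false).toNat + (vs.getD g.arg₂ false).toNat -
            (vs.getD g.arg₁ false).toNat * (vs.getD g.arg₂ false).toNat := by
  cases g with
  | const b => simp [eval, tag, arg₁]
  | not i => cases h : vs.getD i false <;> simp [eval, tag, arg₁, -List.getD_eq_getElem?_getD, h]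
  | and i j =>
    cases h : vs.getD i false <;> cases h' : vs.getD j false <;>
      simp [eval, tag, arg₁, arg₂, -List.getD_eq_getElem?_getD, h, h']
  | or i j =>
    cases h : vs.getD i false <;> cases h' : vs.getD j false <;>
      simp [eval, tag, arg₁, arg₂, -List.getD_eq_getElem?_getD, h, h']

section

variable {X : Type} {s : X → ℕ} {f : X → Val}

theorem PolyBdd.bool (b : X → Bool) : PolyBdd s fun x => ((b x).toNat : ℤ).natAbs.size :=
  (PolyBdd.const 1).mono fun x => by cases b x <;> simp

theorem CompN.bit {l : X → List Bool} {i : X → ℕ} (hl : Comp s f fun x => bitsVal (l x))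
    (hi : CompN s f i) (bi : PolyBdd s i) : CompN s f fun x => ((l x).getD (i x) false).toNat :=
  ⟨(hl.nth hi bi).congr fun x => by
    rw [show Val.int 0 = bitVal false from rfl, List.getD_map]; rfl, PolyBdd.bool _⟩

theorem Comp.gates {c : X → Circuit} (hc : Comp s f fun x => (c x).encode) :
    Comp s f fun x => .ofList ((c x).gates.map Gate.encode) :=
  (hc.snd.fst).congr fun x => by simp [Circuit.encode, Val.ofList, Val.fst, Val.snd]

/-- The list `vs x j` of the values of the inputs and of the first j gates grows by one entry per
pass. Gate arguments are bounded by the number of vertices, hence are cheap indices into it. -/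
theorem Comp.circuitEval {c : X → Circuit} {l : X → List Bool}
    (hc : Comp s f fun x => (c x).encode) (hl : Comp s f fun x => bitsVal (l x))
    {N : X → ℕ} (hN : CompN s f N) (bN : PolyBdd s N) (hsize : ∀ x, (c x).size ≤ N x)
    (hwf : ∀ x, (c x).WellFormed) (hlen : ∀ x, (l x).length = (c x).inputs) :
    Comp s f fun x => bitsVal ((c x).eval (l x)) := by
  have hgl : ∀ x, (c x).gates.length ≤ N x := fun x => (Nat.le_add_left _ _).trans (hsize x)
  have hin : ∀ x, (c x).inputs ≤ N x := fun x => (Nat.le_add_right _ _).trans (hsize x)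
  have hol : ∀ x, (c x).outputs.length ≤ N x := fun x =>
    (hwf x).outputs_length_le.trans (hsize x)
  have hG := hc.gates
  have hO : Comp s f fun x => .ofList ((c x).outputs.map Val.ofNat) :=
    (hc.snd.snd.fst).congr fun x => by simp [Circuit.encode, Val.ofList, Val.fst, Val.snd]
  have hI : CompN s f fun x => (c x).inputs := .of_comp (hc.fst.congr fun x => by
    simp [Circuit.encode, Val.ofList, Val.fst]) (bN.mono hin)
  have hng : CompN s f fun x => (c x).gates.length :=
    (CompN.length hG hN bN (by simpa using hgl)).congr fun x => by simp
  have hno : CompN s f fun x => (c x).outputs.length :=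
    (CompN.length hO hN bN (by simpa using hol)).congr fun x => by simp
  have bng := bN.mono hgl
  have bno := bN.mono hol
  let vs : X → ℕ → List Bool := fun x j =>
    ((c x).gates.take j).foldl (fun vs g => vs ++ [g.eval vs]) (l x)
  have hvs : ∀ x, ∀ j, (hj : j < (c x).gates.length) →
      vs x (j + 1) = vs x j ++ [((c x).gates[j]).eval (vs x j)] := fun x j hj => by
    simp only [vs]
    rw [← List.take_concat_get' _ _ hj, List.foldl_append]
    rfl
  have hvl : ∀ x, ∀ j ≤ (c x).gates.length, (vs x j).length = (c x).inputs + j := by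
    intro x j
    induction j with
    | zero => intro _; simp [vs, hlen]
    | succ j ih => intro hj; rw [hvs x j hj]; simp [ih (by omega)]; omega
  have hV : Comp s f fun x => bitsVal (vs x (c x).gates.length) := by
    refine Comp.forLoop (acc := fun x j => bitsVal (vs x j)) hng bng (by simpa [vs] using hl) ?_
    intro f' hj ha W
    have bj : PolyBdd (fun y : Σ x, Fin (c x).gates.length => s y.1) fun y => (y.2 : ℕ) :=
      (bng.reindex Sigma.fst).mono fun y => y.2.2.le
    have bN' := bN.reindex (Sigma.fst : (Σ x, Fin (c x).gates.length) → X)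
    let g : (Σ x, Fin (c x).gates.length) → Gate := fun y => (c y.1).gates[y.2]
    have hg : Comp (fun y : Σ x, Fin (c x).gates.length => s y.1) f' fun y => (g y).encode :=
      ((W.comp hG).nth hj bj).congr fun y => by
        rw [List.getD_eq_getElem _ _ (by simp)]; simp [g]
    choose gl hgl0 hgl1 hgl2 hgl3 using fun y => (g y).encode_fields
    have hg' : Comp (fun y : Σ x, Fin (c x).gates.length => s y.1) f' fun y => .ofList (gl y) :=
      hg.congr hgl0
    have hargs : ∀ y, (g y).arg₁ ≤ N y.1 + 1 ∧ (g y).arg₂ ≤ N y.1 + 1 := fun y => by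
      have h1 := ((hwf y.1).1 y.2 y.2.2).le
      have h2 := hsize y.1
      have h3 := y.2.2
      have h4 : (c y.1).size = (c y.1).inputs + (c y.1).gates.length := rfl
      have h5 : (c y.1).gates[(y.2 : ℕ)] = g y := rfl
      rw [h5] at h1
      omega
    have ht : CompN _ f' fun y => (g y).tag := .of_comp
      ((hg'.nth (.const 0) (.const 0)).congr hgl1)
      ((PolyBdd.const 3).mono fun y => by cases g y <;> simp [Gate.tag])
    have b1 := ((bN'.add (.const 1)).mono fun y => (hargs y).1)
    have b2 := ((bN'.add (.const 1)).mono fun y => (hargs y).2)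
    have h1 : CompN _ f' fun y => (g y).arg₁ := .of_comp
      ((hg'.nth (.const 1) (.const 1)).congr hgl2) b1
    have h2 : CompN _ f' fun y => (g y).arg₂ := .of_comp
      ((hg'.nth (.const 2) (.const 2)).congr hgl3) b2
    have x1 := CompN.bit ha h1 b1
    have x2 := CompN.bit ha h2 b2
    have he := (CompZ.ite_lt ht (CompN.const 1) h1 (CompZ.ite_lt ht (CompN.const 2)
      (CompZ.sub (CompZ.const 1) x1) (CompZ.ite_lt ht (CompN.const 3) (CompZ.mul x1 x2)
        (CompZ.sub (CompZ.add x1 x2) (CompZ.mul x1 x2)))))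
    have he' : Comp _ f' fun y => .ofList [bitVal ((g y).eval (vs y.1 y.2))] :=
      (he.comp.pair (.const 0)).congr fun y => by
        simp only [Val.ofList, bitVal, Val.ofNat, Gate.eval_toNat]
        norm_cast
    refine (Comp.append ha he' ?_ ?_).congr fun y => ?_
    · refine ((W.z hI).add hj).congr fun y => ?_
      simp [hvl y.1 y.2 y.2.2.le]
    · refine bN'.mono fun y => ?_
      have := hsize y.1
      have := y.2.2
      simp only [List.length_map, hvl y.1 y.2 y.2.2.le]
      simp only [Circuit.size] at *
      omega
    · rw [bitsVal, hvs y.1 y.2 y.2.2]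
      simp [g]
  have hT : Comp s f fun x => .table fun j : Fin (c x).outputs.length =>
      bitVal ((vs x (c x).gates.length).getD (c x).outputs[j] false) := by
    refine Comp.table hno bno fun f' hj W => ?_
    have bj : PolyBdd (fun y : Σ x, Fin (c x).outputs.length => s y.1) fun y => (y.2 : ℕ) :=
      (bno.reindex Sigma.fst).mono fun y => y.2.2.le
    have bo : PolyBdd (fun y : Σ x, Fin (c x).outputs.length => s y.1)
        fun y => (c y.1).outputs[y.2] := (bN.reindex Sigma.fst).mono fun y =>
      (((hwf y.1).2.2 _ (List.getElem_mem y.2.2)).le.trans (hsize y.1))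
    have ho : CompN (fun y : Σ x, Fin (c x).outputs.length => s y.1) f'
        fun y => (c y.1).outputs[y.2] := .of_comp
      (((W.comp hO).nth hj bj).congr fun y => by
        rw [List.getD_eq_getElem _ _ (by simp)]; simp) bo
    exact (CompN.bit (W.comp hV) ho bo).comp
  refine hT.congr fun x => ?_
  simp only [Val.table, bitsVal, Circuit.eval, vs, List.take_length]
  congr 1
  apply List.ext_getElem <;> simp

end


/-! ## Expected sums along random histories, and learning from a finite class -/

/-- The likelihood of a history. -/
noncomputable def like {A : Type} (o : List A → A → ℝ) : List A → ℝ
  | [] => 1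
  | a :: α => like o α * o α a

theorem like_nonneg {A : Type} {o : List A → A → ℝ} (ho : ∀ α a, 0 ≤ o α a) (α : List A) : 0 ≤ like o α := by
  induction α with
  | nil => simp [like]
  | cons a α ih => exact mul_nonneg ih (ho _ _)

section ES

variable {A : Type} [Fintype A]

/-- Expected sum of `g` over the next `n` histories, when the next element of the history `α`
(most recent element first) has distribution `p α`. -/
noncomputable def ES (p : List A → A → ℝ) (g : List A → ℝ) : ℕ → List A → ℝ
  | 0, _ => 0
  | n + 1, α => g α + ∑ a, p α a * ES p g n (a :: α)

variable {p : List A → A → ℝ}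

theorem ES_add (g g' : List A → ℝ) (n : ℕ) (α : List A) :
    ES p (fun β => g β + g' β) n α = ES p g n α + ES p g' n α := by
  induction n generalizing α with
  | zero => simp [ES]
  | succ n ih => simp only [ES, ih, mul_add, Finset.sum_add_distrib]; ring

theorem ES_smul (r : ℝ) (g : List A → ℝ) (n : ℕ) (α : List A) :
    ES p (fun β => r * g β) n α = r * ES p g n α := by
  induction n generalizing α with
  | zero => simp [ES]
  | succ n ih =>
    simp only [ES, ih, mul_add, Finset.mul_sum]
    congr 1
    exact Finset.sum_congr rfl fun a _ => by ring

theorem ES_mono (hp : ∀ α a, 0 ≤ p α a) {g g' : List A → ℝ} (h : ∀ α, g α ≤ g' α) (n : ℕ)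
    (α : List A) : ES p g n α ≤ ES p g' n α := by
  induction n generalizing α with
  | zero => simp [ES]
  | succ n ih =>
    exact add_le_add (h α) (Finset.sum_le_sum fun a _ => mul_le_mul_of_nonneg_left (ih _) (hp α a))

theorem ES_const (hp : ∀ α, ∑ a, p α a = 1) (r : ℝ) (n : ℕ) (α : List A) :
    ES p (fun _ => r) n α = n * r := by
  induction n generalizing α with
  | zero => simp [ES]
  | succ n ih =>
    simp only [ES, ih, ← Finset.sum_mul, hp]
    push_cast; ring

theorem exp_le_quad {x : ℝ} (hx : |x| ≤ 1) : Real.exp x ≤ 1 + x + x ^ 2 := by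
  have := Real.abs_exp_sub_one_sub_id_le hx
  have := (abs_le.1 this).2
  linarith

/-- One step of the regret bound: an information inequality. -/
theorem info_step {T : ℕ} (r : A → ℝ) (o : Fin T → A → ℝ) (v : Fin T → ℝ) (f : A → ℝ)
    {B lam : ℝ} (hr : ∀ a, 0 ≤ r a) (ho : ∀ t a, 0 ≤ o t a) (hv : ∀ t, 0 ≤ v t)
    (hsum : ∀ t, ∑ a, r a * o t a = 1) (hB : ∀ a, |f a| ≤ B) (hl : 0 < lam) (hlB : lam * B ≤ 1)
    (hf : ∑ t, v t * ∑ a, r a * o t a * f a ≤ 0) (t₀ : Fin T) (ht₀ : 0 < v t₀) :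
    ∑ a, r a * o t₀ a * (lam * f a + Real.log ((∑ t, v t * o t a) / (v t₀ * o t₀ a))) ≤
      Real.log ((∑ t, v t) / v t₀) + lam ^ 2 * B ^ 2 := by
  set V := ∑ t, v t with hV
  have hVpos : 0 < V := Finset.sum_pos' (fun t _ => hv t) ⟨t₀, Finset.mem_univ _, ht₀⟩
  set Q : A → ℝ := fun a => ∑ t, v t * o t a with hQ
  have hQnn : ∀ a, 0 ≤ Q a := fun a => Finset.sum_nonneg fun t _ => mul_nonneg (hv t) (ho t a)
  set M := Real.exp (lam ^ 2 * B ^ 2) with hM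
  have hMpos : 0 < M := Real.exp_pos _
  have hrQ : ∑ a, r a * Q a = V := by
    simp only [hQ, Finset.mul_sum]
    rw [Finset.sum_comm, hV]
    refine Finset.sum_congr rfl fun t _ => ?_
    calc ∑ a, r a * (v t * o t a) = v t * ∑ a, r a * o t a := by
          rw [Finset.mul_sum]; exact Finset.sum_congr rfl fun a _ => by ring
      _ = v t := by rw [hsum t, mul_one]
  have hrQf : ∑ a, r a * Q a * f a ≤ 0 := by
    refine le_of_eq_of_le ?_ hf
    simp only [hQ, Finset.mul_sum, Finset.sum_mul]
    rw [Finset.sum_comm]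
    exact Finset.sum_congr rfl fun t _ => Finset.sum_congr rfl fun a _ => by ring
  -- By exp x ≤ 1 + x + x², with the linear term dropped thanks to `hf`. Optimality against the
  -- mixture enters only here.
  have hexp : ∑ a, r a * Q a * Real.exp (lam * f a) ≤ V * M := by
    have h1 : ∀ a, Real.exp (lam * f a) ≤ 1 + lam * f a + lam ^ 2 * B ^ 2 := fun a => by
      have habs : |lam * f a| ≤ lam * B := by
        rw [abs_mul, abs_of_pos hl]; exact mul_le_mul_of_nonneg_left (hB a) hl.le
      have h2 := exp_le_quad (habs.trans hlB)
      have h3 : (lam * f a) ^ 2 ≤ (lam * B) ^ 2 := sq_le_sq' (by linarith [neg_abs_le (lam * f a)])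
        ((le_abs_self _).trans habs)
      nlinarith
    calc ∑ a, r a * Q a * Real.exp (lam * f a)
        ≤ ∑ a, r a * Q a * (1 + lam * f a + lam ^ 2 * B ^ 2) := Finset.sum_le_sum fun a _ =>
          mul_le_mul_of_nonneg_left (h1 a) (mul_nonneg (hr a) (hQnn a))
      _ = (1 + lam ^ 2 * B ^ 2) * ∑ a, r a * Q a + lam * ∑ a, r a * Q a * f a := by
          rw [Finset.mul_sum, Finset.mul_sum, ← Finset.sum_add_distrib]
          exact Finset.sum_congr rfl fun a _ => by ring
      _ ≤ (1 + lam ^ 2 * B ^ 2) * V := by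
          rw [hrQ]
          have := mul_nonpos_of_nonneg_of_nonpos hl.le hrQf
          linarith
      _ ≤ V * M := by
          rw [mul_comm]
          refine mul_le_mul_of_nonneg_left ?_ hVpos.le
          have := Real.add_one_le_exp (lam ^ 2 * B ^ 2)
          linarith
  -- This is log y ≤ y − 1 for y = Q exp(λf) / (o V M), weighted by r o. In the sum over `a` the
  -- last bracket is at most 0 by `hexp`.
  have hterm : ∀ a, r a * o t₀ a * (lam * f a + Real.log (Q a / (v t₀ * o t₀ a))) ≤
      r a * o t₀ a * (Real.log (V / v t₀) + lam ^ 2 * B ^ 2) +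
        (r a * Q a * Real.exp (lam * f a) / (V * M) - r a * o t₀ a) := by
    intro a
    -- Elements that are impossible under `t₀` have weight zero, so that the default value of the
    -- quotient inside the logarithm does not matter.
    rcases (ho t₀ a).eq_or_lt with h0 | h0
    · rw [← h0]
      have : 0 ≤ r a * Q a * Real.exp (lam * f a) / (V * M) := by
        have := hr a; have := hQnn a; positivity
      simpa using this
    · have hQpos : 0 < Q a := by
        refine lt_of_lt_of_le (mul_pos ht₀ h0) ?_
        exact Finset.single_le_sum (f := fun t => v t * o t a)
          (fun t _ => mul_nonneg (hv t) (ho t a)) (Finset.mem_univ t₀)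
      have hy : 0 < Q a * Real.exp (lam * f a) / (o t₀ a * (V * M)) := by positivity
      have hlog := Real.log_le_sub_one_of_pos hy
      have e : Real.log (Q a * Real.exp (lam * f a) / (o t₀ a * (V * M))) =
          lam * f a + Real.log (Q a / (v t₀ * o t₀ a)) -
            (Real.log (V / v t₀) + lam ^ 2 * B ^ 2) := by
        rw [Real.log_div (by positivity) (by positivity), Real.log_mul (by positivity)
          (by positivity), Real.log_mul (by positivity) (by positivity), Real.log_mul
          (by positivity) (by positivity), Real.log_exp, Real.log_div (by positivity)
          (by positivity), Real.log_mul (by positivity) (by positivity), Real.log_div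
          (by positivity) (by positivity), hM, Real.log_exp]
        ring
      rw [e] at hlog
      have h2 := mul_le_mul_of_nonneg_left hlog (mul_nonneg (hr a) (ho t₀ a))
      have e2 : r a * o t₀ a * (Q a * Real.exp (lam * f a) / (o t₀ a * (V * M)) - 1) =
          r a * Q a * Real.exp (lam * f a) / (V * M) - r a * o t₀ a := by
        field_simp
      rw [e2] at h2
      linarith
  refine (Finset.sum_le_sum fun a _ => hterm a).trans ?_
  rw [Finset.sum_add_distrib, ← Finset.sum_mul, hsum, Finset.sum_sub_distrib, hsum,
    ← Finset.sum_div, one_mul]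
  have : (∑ a, r a * Q a * Real.exp (lam * f a)) / (V * M) ≤ 1 :=
    (div_le_one (by positivity)).2 hexp
  linarith

/-- A potential argument: the logarithm of the inverse posterior weight of `t₀` is nonnegative, and
`info_step` says how much it must fall on average. The factor `r` is the player's own choice; it is
common to all `t` and so does not enter the posterior. -/
theorem regret_aux {T : ℕ} (r : List A → A → ℝ) (o : Fin T → List A → A → ℝ)
    (f : List A → A → ℝ) {B lam : ℝ} (hr : ∀ α a, 0 ≤ r α a) (ho : ∀ t α a, 0 ≤ o t α a)
    (hsum : ∀ t α, ∑ a, r α a * o t α a = 1) (hB : ∀ α a, |f α a| ≤ B) (hl : 0 < lam)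
    (hlB : lam * B ≤ 1) (hf : ∀ α, ∑ t, like (o t) α * ∑ a, r α a * o t α a * f α a ≤ 0)
    (t₀ : Fin T) (n : ℕ) (α : List A) (ht₀ : 0 < like (o t₀) α) :
    ES (fun β a => r β a * o t₀ β a)
      (fun β => lam * (∑ a, r β a * o t₀ β a * f β a) - lam ^ 2 * B ^ 2) n α ≤
      Real.log ((∑ t, like (o t) α) / like (o t₀) α) := by
  induction n generalizing α with
  | zero =>
    simp only [ES]
    refine Real.log_nonneg ((one_le_div ht₀).2 ?_)
    exact Finset.single_le_sum (f := fun t => like (o t) α)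
      (fun t _ => like_nonneg (ho t) α) (Finset.mem_univ t₀)
  | succ n ih =>
    simp only [ES]
    have h1 : ∑ a, r α a * o t₀ α a * ES (fun β a => r β a * o t₀ β a)
        (fun β => lam * (∑ a, r β a * o t₀ β a * f β a) - lam ^ 2 * B ^ 2) n (a :: α) ≤
        ∑ a, r α a * o t₀ α a * Real.log ((∑ t, like (o t) α * o t α a) /
          (like (o t₀) α * o t₀ α a)) := by
      refine Finset.sum_le_sum fun a _ => ?_
      rcases (ho t₀ α a).eq_or_lt with h0 | h0
      · simp [← h0]
      · exact mul_le_mul_of_nonneg_left (ih (a :: α) (mul_pos ht₀ h0))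
          (mul_nonneg (hr α a) (ho t₀ α a))
    have h2 := info_step (r α) (fun t => o t α) (fun t => like (o t) α) (f α) (hr α)
      (fun t => ho t α) (fun t => like_nonneg (ho t) α) (fun t => hsum t α) (hB α) hl hlB (hf α)
      t₀ ht₀
    have h3 : ∑ a, r α a * o t₀ α a * (lam * f α a + Real.log ((∑ t, like (o t) α * o t α a) /
          (like (o t₀) α * o t₀ α a))) = lam * (∑ a, r α a * o t₀ α a * f α a) +
        ∑ a, r α a * o t₀ α a * Real.log ((∑ t, like (o t) α * o t α a) /
          (like (o t₀) α * o t₀ α a)) := by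
      rw [Finset.mul_sum, ← Finset.sum_add_distrib]
      exact Finset.sum_congr rfl fun a _ => by ring
    rw [h3] at h2
    linarith

/-- If `f` is not positive on average under the Bayesian mixture of the `o t`, then its expected
sum under each single `o t` is small. -/
theorem regret {T : ℕ} (r : List A → A → ℝ) (o : Fin T → List A → A → ℝ)
    (f : List A → A → ℝ) {B lam : ℝ} (hr : ∀ α a, 0 ≤ r α a) (ho : ∀ t α a, 0 ≤ o t α a)
    (hsum : ∀ t α, ∑ a, r α a * o t α a = 1) (hB : ∀ α a, |f α a| ≤ B) (hl : 0 < lam)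
    (hlB : lam * B ≤ 1) (hf : ∀ α, ∑ t, like (o t) α * ∑ a, r α a * o t α a * f α a ≤ 0)
    (t₀ : Fin T) (n : ℕ) :
    lam * ES (fun β a => r β a * o t₀ β a) (fun β => ∑ a, r β a * o t₀ β a * f β a) n [] ≤
      Real.log T + n * (lam ^ 2 * B ^ 2) := by
  have h := regret_aux r o f hr ho hsum hB hl hlB hf t₀ n [] (by simp [like])
  simp only [sub_eq_add_neg] at h
  rw [ES_add, ES_smul, ES_const (hsum t₀)] at h
  simp only [like, Finset.sum_const, Finset.card_univ, Fintype.card_fin, nsmul_eq_mul,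
    mul_one, div_one] at h
  linarith

end ES


/-! ## The repeated game with a third player who proposes deviations -/

/-- Numbers of actions. The third player chooses a player and an action of that player. -/
def acts (k : ℕ) : Fin 3 → ℕ
  | 0 => k
  | 1 => k
  | 2 => 2 * k

abbrev Joint (k : ℕ) : Type := ∀ i, Fin (acts k i)

def joint {k : ℕ} (x y : Fin k) (z : Fin (2 * k)) : Joint k
  | 0 => x
  | 1 => y
  | 2 => z

/-- The actions of the two original players. -/
def Joint.pr {k : ℕ} (a : Joint k) : Fin 2 → Fin k := ![a 0, a 1]

def Joint.third {k : ℕ} (a : Joint k) : Fin (2 * k) := a 2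

@[simp] theorem joint_pr {k : ℕ} (x y : Fin k) (z : Fin (2 * k)) : (joint x y z).pr = ![x, y] := rfl

@[simp] theorem joint_third {k : ℕ} (x y : Fin k) (z : Fin (2 * k)) : (joint x y z).third = z := rfl

theorem joint_eta {k : ℕ} (a : Joint k) : joint (a 0) (a 1) a.third = a := by
  funext i
  fin_cases i <;> rfl

def jointEquiv (k : ℕ) : Fin k × Fin k × Fin (2 * k) ≃ Joint k where
  toFun p := joint p.1 p.2.1 p.2.2
  invFun a := (a 0, a 1, a.third)
  left_inv _ := rfl
  right_inv := joint_eta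

theorem sum_joint {k : ℕ} {β : Type*} [AddCommMonoid β] (F : Joint k → β) :
    ∑ a, F a = ∑ x, ∑ y, ∑ z, F (joint x y z) := by
  rw [← (jointEquiv k).sum_comp, Fintype.sum_prod_type]
  exact Finset.sum_congr rfl fun x _ => Fintype.sum_prod_type _

theorem prod_acts (k : ℕ) : ∏ i, acts k i = k * k * (2 * k) := by
  rw [Fin.prod_univ_three]; rfl

/-- The index of a joint action in the tables that describe a game. -/
def Joint.code {k : ℕ} (a : Joint k) : ℕ := (finPiFinEquiv a : ℕ)

theorem Joint.code_lt {k : ℕ} (a : Joint k) : a.code < k * k * (2 * k) :=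
  (finPiFinEquiv a).2.trans_eq (prod_acts k)

theorem code_joint {k : ℕ} (x y : Fin k) (z : Fin (2 * k)) :
    (joint x y z).code = x + y * k + z * (k * k) := by
  rw [Joint.code, finPiFinEquiv_apply, Fin.sum_univ_three]
  have h1 : (∏ j : Fin ((1 : Fin 3) : ℕ), acts k (Fin.castLE (1 : Fin 3).is_lt.le j)) = k := by
    exact (Fin.prod_univ_one _).trans rfl
  have h2 : (∏ j : Fin ((2 : Fin 3) : ℕ), acts k (Fin.castLE (2 : Fin 3).is_lt.le j)) = k * k := by
    exact (Fin.prod_univ_two _).trans rfl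
  have h0 : (∏ j : Fin ((0 : Fin 3) : ℕ), acts k (Fin.castLE (0 : Fin 3).is_lt.le j)) = 1 := rfl
  rw [h1, h2, h0, mul_one]
  rfl

/-- The gain of the deviation `b` from the action profile `x`. -/
noncomputable def dev {k : ℕ} (M : NormalFormGame 2 k) (x : Fin 2 → Fin k) (b : Fin (2 * k)) : ℝ :=
  M.M b.divNat (Function.update x b.divNat b.modNat) - M.M b.divNat x

theorem abs_dev_le {k : ℕ} (M : NormalFormGame 2 k) (x : Fin 2 → Fin k) (b : Fin (2 * k)) :
    |dev M x b| ≤ 1 := by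
  have h1 := M.M_mem b.divNat (Function.update x b.divNat b.modNat)
  have h2 := M.M_mem b.divNat x
  rw [dev, abs_le]
  constructor <;> linarith [h1.1, h1.2, h2.1, h2.2]

/-- Payoffs of the stage game. -/
noncomputable def stage {k : ℕ} (M : NormalFormGame 2 k) (i : Fin 3) (a : Joint k) : ℝ :=
  if i = 2 then dev M a.pr a.third else
    if (a.third.divNat : ℕ) = i then -dev M a.pr a.third else 0

theorem abs_stage_le {k : ℕ} (M : NormalFormGame 2 k) (i : Fin 3) (a : Joint k) :
    |stage M i a| ≤ 1 := by
  unfold stage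
  split_ifs
  · exact abs_dev_le _ _ _
  · rw [abs_neg]; exact abs_dev_le _ _ _
  · simp

theorem sum_stage {k : ℕ} (M : NormalFormGame 2 k) (a : Joint k) : ∑ i, stage M i a = 0 := by
  rw [Fin.sum_univ_three]
  have h : (a.third.divNat : ℕ) = 0 ∨ (a.third.divNat : ℕ) = 1 := by
    have := a.third.divNat.2
    omega
  rcases h with h | h <;> simp [stage, h, -Fin.coe_divNat]

/-- Rewards of the repeated game: scaled payoffs, with the joint action in the last bits. -/
noncomputable def rew {k : ℕ} (M : NormalFormGame 2 k) (c : ℕ) (i : Fin 3) (a : Joint k) : ℝ :=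
  stage M i a / (2 * 2 ^ c) + (a.code : ℝ) / 2 ^ (k + 4 * c + 2)

/-- A scaled stage payoff is a multiple of 2^-(k + c + 1), and the rewards have k + 4c + 2 = (k + c
+ 1) + (3c + 1) digits: the code fits into the last 3c + 1 of them. -/
theorem Joint.code_lt_pow {k c : ℕ} (hkc : k < 2 ^ c) (a : Joint k) : a.code < 2 ^ (3 * c + 1) := by
  refine a.code_lt.trans_le ?_
  calc k * k * (2 * k) ≤ 2 ^ c * 2 ^ c * (2 * 2 ^ c) := by gcongr
    _ = _ := by ring

/-- Over the whole horizon the codes are worth at most 2^-(k + 1) to a player. -/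
theorem code_div_le {k c : ℕ} (hkc : k < 2 ^ c) (a : Joint k) :
    (a.code : ℝ) / 2 ^ (k + 4 * c + 2) ≤ 1 / (2 ^ c * 2 ^ (k + 1)) := by
  have h : (a.code : ℝ) ≤ 2 ^ (3 * c + 1) := by exact_mod_cast (a.code_lt_pow hkc).le
  calc (a.code : ℝ) / 2 ^ (k + 4 * c + 2) ≤ 2 ^ (3 * c + 1) / 2 ^ (k + 4 * c + 2) := by gcongr
    _ = _ := by
      rw [div_eq_div_iff (by positivity) (by positivity)]
      ring

theorem abs_rew_le {k c : ℕ} (hkc : k < 2 ^ c) (M : NormalFormGame 2 k) (i : Fin 3) (a : Joint k) :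
    |rew M c i a| ≤ 1 / 2 ^ c := by
  have h1 : |stage M i a / (2 * 2 ^ c)| ≤ 1 / (2 * 2 ^ c) := by
    rw [abs_div, abs_of_pos (a := (2 * 2 ^ c : ℝ)) (by positivity)]
    have := abs_stage_le M i a
    gcongr
  have h2 : |(a.code : ℝ) / 2 ^ (k + 4 * c + 2)| ≤ 1 / (2 * 2 ^ c) := by
    rw [abs_of_nonneg (by positivity)]
    refine (code_div_le hkc a).trans ?_
    rw [div_le_div_iff₀ (by positivity) (by positivity), one_mul, one_mul, mul_comm]
    have : (2 : ℝ) ≤ 2 ^ (k + 1) := by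
      rw [pow_succ]; nlinarith [one_le_pow₀ (M₀ := ℝ) one_le_two (n := k)]
    gcongr
  refine (abs_add_le _ _).trans ((add_le_add h1 h2).trans (le_of_eq ?_))
  field_simp; norm_num

theorem acts_pos {k : ℕ} (hk : 0 < k) (i : Fin 3) : 0 < acts k i := by
  fin_cases i
  · exact hk
  · exact hk
  · exact Nat.mul_pos two_pos hk

/-- There is only one state, so all information is in the history. The horizon is a power of two to
keep the scaled rewards dyadic. -/
noncomputable def game {k c : ℕ} (M : NormalFormGame 2 k) (hk : 0 < k) (hkc : k < 2 ^ c) :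
    MarkovGame 3 where
  S := 1
  H := 2 ^ c
  A := acts k
  S_pos := one_pos
  H_pos := by positivity
  A_pos := acts_pos hk
  P _ _ _ := ⟨fun _ => 1, by simp [stdSimplex]⟩
  R i _ _ a := rew M c i a
  R_bound i _ _ a := by simpa using abs_rew_le hkc M i a
  μ := ⟨fun _ => 1, by simp [stdSimplex]⟩

section

variable {k c : ℕ} {M : NormalFormGame 2 k} {hk : 0 < k} {hkc : k < 2 ^ c}

/-- The step of a trajectory with a given joint action. -/
noncomputable def gstep (M : NormalFormGame 2 k) (hk : 0 < k) (hkc : k < 2 ^ c) (a : Joint k) :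
    (game M hk hkc).Step :=
  ((0 : Fin 1), a, fun i => rew M c i a)

/-- The trajectory that belongs to a list of joint actions (most recent first). -/
noncomputable def traj (M : NormalFormGame 2 k) (hk : 0 < k) (hkc : k < 2 ^ c)
    (α : List (Joint k)) : List (game M hk hkc).Step :=
  α.reverse.map (gstep M hk hkc)

theorem traj_cons (α : List (Joint k)) (a : Joint k) :
    traj M hk hkc (a :: α) = traj M hk hkc α ++ [gstep M hk hkc a] := by
  simp [traj]

/-- The history of player `i`. -/
noncomputable def hist (M : NormalFormGame 2 k) (hk : 0 < k) (hkc : k < 2 ^ c) (i : Fin 3)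
    (α : List (Joint k)) : (game M hk hkc).History i :=
  (game M hk hkc).view i (traj M hk hkc α)

/-- The mixed action of player `i` after the history `α`. -/
noncomputable def mixed (σ : (game M hk hkc).Profile) (i : Fin 3) (α : List (Joint k)) :
    stdSimplex ℝ (Fin (acts k i)) :=
  σ i (hist M hk hkc i α) (0 : Fin 1)

noncomputable def stepDist (σ : (game M hk hkc).Profile) (α : List (Joint k)) (a : Joint k) : ℝ :=
  ∏ i, (mixed σ i α).1 (a i)

theorem stepDist_nonneg (σ : (game M hk hkc).Profile) (α : List (Joint k)) (a : Joint k) :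
    0 ≤ stepDist σ α a :=
  Finset.prod_nonneg fun i _ => (mixed σ i α).2.1 _

theorem sum_stepDist (σ : (game M hk hkc).Profile) (α : List (Joint k)) :
    ∑ a, stepDist σ α a = 1 := by
  have h := Finset.prod_univ_sum (fun i : Fin 3 => (Finset.univ : Finset (Fin (acts k i))))
    (fun i b => (mixed σ i α).1 b)
  rw [Fintype.piFinset_univ] at h
  unfold stepDist
  rw [← h]
  exact Finset.prod_eq_one fun i _ => (mixed σ i α).2.2

/-- The joint actions determine a trajectory, as the state is constant and rewards are
deterministic. The rewards already collected split off, and future ones may be replaced by their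
conditional means. -/
theorem expectFrom_eq (σ : (game M hk hkc).Profile) (i : Fin 3)
    (hs : List (Fin (game M hk hkc).H)) (α : List (Joint k))
    (d : Fin (game M hk hkc).S → ℝ) (hd : d (0 : Fin 1) = 1) :
    (game M hk hkc).expectFrom σ (fun τ => (τ.map fun x => x.2.2 i).sum) hs (traj M hk hkc α) d =
      (α.map fun a => rew M c i a).sum +
        ES (stepDist σ) (fun β => ∑ a, stepDist σ β a * rew M c i a) hs.length α := by
  induction hs generalizing α d with
  | nil =>
    simp only [MarkovGame.expectFrom, ES, List.length_nil, add_zero, traj, List.map_map]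
    rw [List.map_reverse, List.sum_reverse]
    rfl
  | cons h hs ih =>
    simp only [MarkovGame.expectFrom, List.length_cons, ES]
    refine (Fin.sum_univ_one (fun s => d s * _)).trans ?_
    rw [hd, one_mul]
    have key : ∀ a : Joint k, (game M hk hkc).expectFrom σ (fun τ => (τ.map fun x => x.2.2 i).sum)
        hs (traj M hk hkc α ++ [gstep M hk hkc a])
        ((game M hk hkc).P h (0 : Fin 1) a).1 = ((a :: α).map fun a => rew M c i a).sum +
          ES (stepDist σ) (fun β => ∑ a, stepDist σ β a * rew M c i a) hs.length (a :: α) := by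
      intro a
      rw [← ih (a :: α) ((game M hk hkc).P h (0 : Fin 1) a).1 rfl, traj_cons]
    calc _ = ∑ a, stepDist σ α a * (((a :: α).map fun a => rew M c i a).sum +
          ES (stepDist σ) (fun β => ∑ a, stepDist σ β a * rew M c i a) hs.length (a :: α)) :=
          Finset.sum_congr rfl fun a _ => congrArg₂ (· * ·) rfl (key a)
      _ = _ := by
          simp only [List.map_cons, List.sum_cons, mul_add, Finset.sum_add_distrib]
          rw [← Finset.sum_mul, sum_stepDist]
          ring

theorem value_eq (σ : (game M hk hkc).Profile) (i : Fin 3) :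
    (game M hk hkc).value σ i =
      ES (stepDist σ) (fun β => ∑ a, stepDist σ β a * rew M c i a) (2 ^ c) [] := by
  have h := expectFrom_eq σ i (List.finRange (game M hk hkc).H) [] (game M hk hkc).μ.1 rfl
  simp only [List.map_nil, List.sum_nil, zero_add, List.length_finRange] at h
  exact h

end


section

variable {k c : ℕ} {M : NormalFormGame 2 k} {hk : 0 < k} {hkc : k < 2 ^ c}

/-! ### Recovering the joint actions from the rewards -/

theorem eq_numer_div {b : ℕ} {x : ℝ} (h : HasBits b x) : x = (numer b x : ℝ) / 2 ^ b := by
  obtain ⟨z, rfl⟩ := h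
  rw [numer, div_mul_cancel₀ _ (by positivity), Int.floor_intCast]

theorem numer_div (b : ℕ) (z : ℤ) : numer b ((z : ℝ) / 2 ^ b) = z := by
  rw [numer, div_mul_cancel₀ _ (by positivity), Int.floor_intCast]

theorem HasBits.sub {b : ℕ} {x y : ℝ} (hx : HasBits b x) (hy : HasBits b y) : HasBits b (x - y) := by
  obtain ⟨z, rfl⟩ := hx
  obtain ⟨w, rfl⟩ := hy
  exact ⟨z - w, by push_cast; ring⟩

theorem HasBits.neg {b : ℕ} {x : ℝ} (hx : HasBits b x) : HasBits b (-x) := by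
  obtain ⟨z, rfl⟩ := hx
  exact ⟨-z, by push_cast; ring⟩

theorem HasBits.stage (hM : ∀ i a, HasBits k (M.M i a)) (i : Fin 3) (a : Joint k) :
    HasBits k (stage M i a) := by
  unfold GenCCE.stage
  split_ifs
  · exact (hM _ _).sub (hM _ _)
  · exact ((hM _ _).sub (hM _ _)).neg
  · exact ⟨0, by simp⟩

/-- The numerator of a reward. -/
noncomputable def rewZ (M : NormalFormGame 2 k) (c : ℕ) (i : Fin 3) (a : Joint k) : ℤ :=
  numer k (stage M i a) * 2 ^ (3 * c + 1) + a.code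

theorem rew_eq (hM : ∀ i a, HasBits k (M.M i a)) (c : ℕ) (i : Fin 3) (a : Joint k) :
    rew M c i a = (rewZ M c i a : ℝ) / 2 ^ (k + 4 * c + 2) := by
  have h := eq_numer_div (HasBits.stage hM i a)
  rw [rew, rewZ]
  push_cast
  rw [add_div]
  congr 1
  rw [h, numer_div, div_div, div_eq_div_iff (by positivity) (by positivity)]
  ring

theorem numer_rew (hM : ∀ i a, HasBits k (M.M i a)) (c : ℕ) (i : Fin 3) (a : Joint k) :
    numer (k + 4 * c + 2) (rew M c i a) = rewZ M c i a := by
  rw [rew_eq hM, numer_div]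

/-- The remainder of an integer is nonnegative also for negative payoffs, so that it is the code
itself. The second reduction only makes the function total. -/
noncomputable def decode (k c : ℕ) (hk : 0 < k) (r : ℝ) : Joint k :=
  finPiFinEquiv.symm ⟨(numer (k + 4 * c + 2) r % 2 ^ (3 * c + 1)).toNat % ∏ i, acts k i,
    Nat.mod_lt _ (Finset.prod_pos fun i _ => acts_pos hk i)⟩

theorem decode_rew (hM : ∀ i a, HasBits k (M.M i a)) (hk : 0 < k) (hkc : k < 2 ^ c) (i : Fin 3)
    (a : Joint k) : decode k c hk (rew M c i a) = a := by
  rw [decode, Equiv.symm_apply_eq]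
  apply Fin.ext
  dsimp only
  rw [numer_rew hM, rewZ]
  have h1 : (numer k (stage M i a) * 2 ^ (3 * c + 1) + (a.code : ℤ)) % 2 ^ (3 * c + 1) =
      (a.code : ℤ) := by
    rw [Int.add_comm, Int.add_mul_emod_self_right]
    exact Int.emod_eq_of_lt (by positivity) (by exact_mod_cast a.code_lt_pow hkc)
  rw [h1, Int.toNat_natCast]
  exact Nat.mod_eq_of_lt (finPiFinEquiv a).2

/-! ### Deviations -/

def pureDist {m : ℕ} (b : Fin m) : stdSimplex ℝ (Fin m) := ⟨Pi.single b 1, single_mem_stdSimplex ℝ b⟩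

/-- The general policy that plays `π`, a function of the joint actions so far. -/
noncomputable def detPolicy (M : NormalFormGame 2 k) (hk : 0 < k) (hkc : k < 2 ^ c) (i : Fin 3)
    (π : List (Joint k) → Fin (acts k i)) : (game M hk hkc).Policy i :=
  fun h _ => pureDist (π (h.map fun x => decode k c hk x.2.2).reverse)

theorem hist_decode (hM : ∀ i a, HasBits k (M.M i a)) (i : Fin 3) (α : List (Joint k)) :
    ((hist M hk hkc i α).map fun x => decode k c hk x.2.2).reverse = α := by
  rw [hist, MarkovGame.view, traj, List.map_map, List.map_map, ← List.map_reverse,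
    List.reverse_reverse]
  conv_rhs => rw [← List.map_id α]
  exact List.map_congr_left fun a _ => decode_rew hM hk hkc i a

/-- The probability that the opponents of `i` play their parts of `a`. -/
noncomputable def opp (σ : (game M hk hkc).Profile) (i : Fin 3) (α : List (Joint k))
    (a : Joint k) : ℝ :=
  ∏ j ∈ Finset.univ.erase i, (mixed σ j α).1 (a j)

theorem opp_nonneg (σ : (game M hk hkc).Profile) (i : Fin 3) (α : List (Joint k)) (a : Joint k) :
    0 ≤ opp σ i α a :=
  Finset.prod_nonneg fun j _ => (mixed σ j α).2.1 _

theorem opp_update (σ : (game M hk hkc).Profile) (i : Fin 3) (α : List (Joint k)) (a : Joint k)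
    (b : Fin (acts k i)) : opp σ i α (Function.update a i b) = opp σ i α a :=
  Finset.prod_congr rfl fun j hj => by rw [Function.update_of_ne (Finset.ne_of_mem_erase hj)]

theorem stepDist_dev (hM : ∀ i a, HasBits k (M.M i a)) (σ : (game M hk hkc).Profile) (i : Fin 3)
    (π : List (Joint k) → Fin (acts k i)) (α : List (Joint k)) (a : Joint k) :
    stepDist (Function.update σ i (detPolicy M hk hkc i π)) α a =
      (if a i = π α then 1 else 0) * opp σ i α a := by
  rw [stepDist, ← Finset.mul_prod_erase _ _ (Finset.mem_univ i)]
  congr 1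
  · simp only [mixed, Function.update_self, detPolicy, pureDist]
    rw [hist_decode hM]
    exact Pi.single_apply _ _ _
  · exact Finset.prod_congr rfl fun j hj => by
      rw [mixed, Function.update_of_ne (Finset.ne_of_mem_erase hj)]; rfl

/-- Expected stage payoff of player `i` for the action `b`. -/
noncomputable def util (σ : (game M hk hkc).Profile) (i : Fin 3) (α : List (Joint k))
    (b : Fin (acts k i)) : ℝ :=
  ∑ a, (if a i = b then 1 else 0) * opp σ i α a * stage M i a

/-- Changing coordinate `i` is a bijection between the two slices. -/
theorem sum_slice (i : Fin 3) (F : Joint k → ℝ) (b b' : Fin (acts k i)) :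
    ∑ a, (if a i = b then 1 else 0) * F (Function.update a i b') =
      ∑ a, (if a i = b' then 1 else 0) * F a := by
  simp only [ite_mul, one_mul, zero_mul, ← Finset.sum_filter]
  refine Finset.sum_bij' (fun a _ => Function.update a i b') (fun a _ => Function.update a i b)
    ?_ ?_ ?_ ?_ ?_
  · simp
  · simp
  · intro a ha
    simp only [Finset.mem_filter, Finset.mem_univ, true_and] at ha
    simp [← ha]
  · intro a ha
    simp only [Finset.mem_filter, Finset.mem_univ, true_and] at ha
    simp [← ha]
  · simp

/-- What the opponents do is independent of the action of `i`. The utility of any alternative is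
therefore the mean of a function of the joint action that is actually played, which is the form
`regret` needs. -/
theorem util_shift (σ : (game M hk hkc).Profile) (i : Fin 3) (α : List (Joint k))
    (b b' : Fin (acts k i)) :
    ∑ a, (if a i = b then 1 else 0) * opp σ i α a * stage M i (Function.update a i b') =
      util σ i α b' := by
  rw [util]
  simp only [mul_assoc]
  rw [← sum_slice i (fun a => opp σ i α a * stage M i a) b b']
  simp only [opp_update]

/-- The action that is best for player `i` against the Bayesian mixture of the profiles. -/
noncomputable def bayesAct {T : ℕ} (σ : Fin T → (game M hk hkc).Profile) (i : Fin 3)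
    (α : List (Joint k)) : Fin (acts k i) :=
  best (acts_pos hk i) fun b => ∑ t, like (opp (σ t) i) α * util (σ t) i α b

/-- The value of the best action of player `i` against one of the profiles. -/
noncomputable def topUtil (σ : (game M hk hkc).Profile) (i : Fin 3) (α : List (Joint k)) : ℝ :=
  util σ i α (best (acts_pos hk i) (util σ i α))

theorem util_le_topUtil (σ : (game M hk hkc).Profile) (i : Fin 3) (α : List (Joint k))
    (b : Fin (acts k i)) : util σ i α b ≤ topUtil σ i α :=
  le_best (acts_pos hk i) (util σ i α) b

/-- The distribution of the next joint action when player `i` deviates to `bayesAct`. -/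
noncomputable def devDist {T : ℕ} (σ : Fin T → (game M hk hkc).Profile) (i : Fin 3) (t : Fin T)
    (α : List (Joint k)) (a : Joint k) : ℝ :=
  (if a i = bayesAct σ i α then 1 else 0) * opp (σ t) i α a

theorem sum_devDist (hM : ∀ i a, HasBits k (M.M i a)) {T : ℕ}
    (σ : Fin T → (game M hk hkc).Profile) (i : Fin 3) (t : Fin T) (α : List (Joint k)) :
    ∑ a, devDist σ i t α a = 1 := by
  rw [← sum_stepDist (Function.update (σ t) i (detPolicy M hk hkc i (bayesAct σ i))) α]
  exact Finset.sum_congr rfl fun a _ => (stepDist_dev hM _ _ _ _ _).symm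

theorem devDist_nonneg {T : ℕ} (σ : Fin T → (game M hk hkc).Profile) (i : Fin 3) (t : Fin T)
    (α : List (Joint k)) (a : Joint k) : 0 ≤ devDist σ i t α a :=
  mul_nonneg (by split_ifs <;> simp) (opp_nonneg _ _ _ _)

/-- `regret` is applied to the payoff of the best response to σ t minus the payoff of `bayesAct`,
each evaluated at the opponents' realised actions. Its mean under the posterior mixture is not
positive by the choice of `bayesAct`, and it is at most 2 in absolute value. -/
theorem dev_regret (hM : ∀ i a, HasBits k (M.M i a)) {T : ℕ}
    (σ : Fin T → (game M hk hkc).Profile) (i : Fin 3) (t : Fin T) {lam : ℝ} (hl : 0 < lam)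
    (hl2 : lam * 2 ≤ 1) (n : ℕ) :
    lam * (ES (devDist σ i t) (topUtil (σ t) i) n [] -
      ES (devDist σ i t) (fun α => util (σ t) i α (bayesAct σ i α)) n []) ≤
      Real.log T + n * (lam ^ 2 * 2 ^ 2) := by
  let bt : List (Joint k) → Fin (acts k i) := fun α => best (acts_pos hk i) (util (σ t) i α)
  let F : List (Joint k) → Joint k → ℝ := fun α a =>
    stage M i (Function.update a i (bt α)) - stage M i (Function.update a i (bayesAct σ i α))
  have hF : ∀ t' α, ∑ a, (if a i = bayesAct σ i α then 1 else 0) * opp (σ t') i α a * F α a =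
      util (σ t') i α (bt α) - util (σ t') i α (bayesAct σ i α) := fun t' α => by
    simp only [F, mul_sub, Finset.sum_sub_distrib, util_shift]
  have h := regret (fun α a => if a i = bayesAct σ i α then 1 else 0)
    (fun t' => opp (σ t') i) F (B := 2) (lam := lam) (fun α a => by split_ifs <;> simp)
    (fun t' => opp_nonneg _ _) (fun t' α => sum_devDist hM σ i t' α)
    (fun α a => by
      have h1 := abs_stage_le M i (Function.update a i (bt α))
      have h2 := abs_stage_le M i (Function.update a i (bayesAct σ i α))
      exact (abs_sub _ _).trans (by linarith)) hl hl2
    (fun α => by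
      simp only [hF, mul_sub, Finset.sum_sub_distrib]
      have := le_best (acts_pos hk i)
        (fun b => ∑ t', like (opp (σ t') i) α * util (σ t') i α b) (bt α)
      exact sub_nonpos.2 this) t n
  have e : ES (devDist σ i t) (fun α => util (σ t) i α (bt α) +
      (-1) * util (σ t) i α (bayesAct σ i α)) n [] = ES (devDist σ i t) (topUtil (σ t) i) n [] -
      ES (devDist σ i t) (fun α => util (σ t) i α (bayesAct σ i α)) n [] := by
    rw [ES_add, ES_smul, neg_one_mul, ← sub_eq_add_neg]
    rfl
  rw [← e]
  simp only [hF] at h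
  simp only [neg_mul, one_mul, ← sub_eq_add_neg]
  exact h

/-- The codes in the rewards are nonnegative and may be dropped from a lower bound; the remaining
payoffs are scaled by 1/(2H). -/
theorem dev_value (hM : ∀ i a, HasBits k (M.M i a)) {T : ℕ}
    (σ : Fin T → (game M hk hkc).Profile) (i : Fin 3) (t : Fin T) {lam : ℝ} (hl : 0 < lam)
    (hl2 : lam * 2 ≤ 1) :
    (ES (devDist σ i t) (topUtil (σ t) i) (2 ^ c) [] -
      (Real.log T / lam + 2 ^ c * (4 * lam))) / (2 * 2 ^ c) ≤
      (game M hk hkc).value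
        (Function.update (σ t) i (detPolicy M hk hkc i (bayesAct σ i))) i := by
  have hstep : stepDist (Function.update (σ t) i (detPolicy M hk hkc i (bayesAct σ i))) =
      devDist σ i t := by
    funext α a; exact stepDist_dev hM _ _ _ _ _
  have h := dev_regret hM σ i t hl hl2 (2 ^ c)
  have h1 : ES (devDist σ i t) (topUtil (σ t) i) (2 ^ c) [] -
      (Real.log T / lam + 2 ^ c * (4 * lam)) ≤
      ES (devDist σ i t) (fun α => util (σ t) i α (bayesAct σ i α)) (2 ^ c) [] := by
    have e : Real.log T / lam + 2 ^ c * (4 * lam) =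
        (Real.log T + ((2 ^ c : ℕ) : ℝ) * (lam ^ 2 * 2 ^ 2)) / lam := by
      push_cast; field_simp; ring
    rw [e, sub_le_comm, le_div_iff₀ hl]
    linarith
  rw [value_eq, hstep]
  calc _ ≤ ES (devDist σ i t) (fun α => util (σ t) i α (bayesAct σ i α)) (2 ^ c) [] /
        (2 * 2 ^ c) := by gcongr
    _ = ES (devDist σ i t) (fun α => 1 / (2 * 2 ^ c) * util (σ t) i α (bayesAct σ i α))
        (2 ^ c) [] := by rw [ES_smul]; ring
    _ ≤ _ := by
      refine ES_mono (devDist_nonneg σ i t) (fun α => ?_) _ _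
      rw [util, Finset.mul_sum]
      refine Finset.sum_le_sum fun a _ => ?_
      have h2 : stage M i a / (2 * 2 ^ c) ≤ rew M c i a := by
        rw [rew]; exact le_add_of_nonneg_right (by positivity)
      calc _ = devDist σ i t α a * (stage M i a / (2 * 2 ^ c)) := by rw [devDist]; ring
        _ ≤ _ := mul_le_mul_of_nonneg_left h2 (devDist_nonneg _ _ _ _ _)

/-- The stage payoffs cancel and only the three codes of each step survive. -/
theorem sum_value_le (σ : (game M hk hkc).Profile) :
    ∑ i, (game M hk hkc).value σ i ≤ 3 / 2 ^ (k + 1) := by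
  simp only [value_eq]
  rw [Fin.sum_univ_three, ← ES_add, ← ES_add]
  have h : ∀ β : List (Joint k), ∑ a, stepDist σ β a * rew M c 0 a +
      ∑ a, stepDist σ β a * rew M c 1 a + ∑ a, stepDist σ β a * rew M c 2 a ≤
      3 / (2 ^ c * 2 ^ (k + 1)) := by
    intro β
    rw [← Finset.sum_add_distrib, ← Finset.sum_add_distrib]
    calc _ ≤ ∑ a, stepDist σ β a * (3 / (2 ^ c * 2 ^ (k + 1))) := by
          refine Finset.sum_le_sum fun a _ => ?_
          rw [← mul_add, ← mul_add]
          refine mul_le_mul_of_nonneg_left ?_ (stepDist_nonneg _ _ _)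
          have h0 := sum_stage M a
          rw [Fin.sum_univ_three] at h0
          have e : rew M c 0 a + rew M c 1 a + rew M c 2 a =
              (stage M 0 a + stage M 1 a + stage M 2 a) / (2 * 2 ^ c) +
                3 * ((a.code : ℝ) / 2 ^ (k + 4 * c + 2)) := by
            simp only [rew]; ring
          have := code_div_le hkc a
          rw [e, h0, zero_div, zero_add]
          calc _ ≤ 3 * (1 / (2 ^ c * 2 ^ (k + 1)) : ℝ) := by gcongr
            _ = _ := by ring
      _ = _ := by rw [← Finset.sum_mul, sum_stepDist, one_mul]
  refine (ES_mono (stepDist_nonneg σ) h _ _).trans_eq ?_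
  rw [ES_const (sum_stepDist σ)]
  push_cast
  field_simp

end


/-! ### Utilities of the three players and the sum of their equilibrium conditions -/

section

variable {k c : ℕ} {M : NormalFormGame 2 k} {hk : 0 < k} {hkc : k < 2 ^ c}

/-- Like `mixed`, with `acts k i` already evaluated in the type so that sums range over plain index
sets. -/
noncomputable def mixA (σ : (game M hk hkc).Profile) (α : List (Joint k)) :
    stdSimplex ℝ (Fin k) :=
  mixed σ 0 α

noncomputable def mixB (σ : (game M hk hkc).Profile) (α : List (Joint k)) :
    stdSimplex ℝ (Fin k) :=
  mixed σ 1 α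

noncomputable def mixC (σ : (game M hk hkc).Profile) (α : List (Joint k)) :
    stdSimplex ℝ (Fin (2 * k)) :=
  mixed σ 2 α

theorem opp_zero (σ : (game M hk hkc).Profile) (α : List (Joint k)) (x y : Fin k)
    (z : Fin (2 * k)) :
    opp σ 0 α (joint x y z) = (mixB σ α).1 y * (mixC σ α).1 z := by
  rw [opp, show Finset.univ.erase (0 : Fin 3) = {1, 2} by decide, Finset.prod_pair (by decide)]
  rfl

theorem opp_one (σ : (game M hk hkc).Profile) (α : List (Joint k)) (x y : Fin k)
    (z : Fin (2 * k)) :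
    opp σ 1 α (joint x y z) = (mixA σ α).1 x * (mixC σ α).1 z := by
  rw [opp, show Finset.univ.erase (1 : Fin 3) = {0, 2} by decide, Finset.prod_pair (by decide)]
  rfl

theorem opp_two (σ : (game M hk hkc).Profile) (α : List (Joint k)) (x y : Fin k)
    (z : Fin (2 * k)) :
    opp σ 2 α (joint x y z) = (mixA σ α).1 x * (mixB σ α).1 y := by
  rw [opp, show Finset.univ.erase (2 : Fin 3) = {0, 1} by decide, Finset.prod_pair (by decide)]
  rfl

theorem util_zero (σ : (game M hk hkc).Profile) (α : List (Joint k)) (b : Fin (acts k 0)) :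
    util σ 0 α b = ∑ z, ∑ y, (mixB σ α).1 y * (mixC σ α).1 z * stage M 0 (joint b y z) := by
  have h0 : util σ 0 α b = ∑ x : Fin k, ∑ y : Fin k, ∑ z : Fin (2 * k),
      (if joint x y z 0 = b then 1 else 0) * opp σ 0 α (joint x y z) * stage M 0 (joint x y z) :=
    sum_joint fun a => (if a 0 = b then 1 else 0) * opp σ 0 α a * stage M 0 a
  rw [h0]
  calc _ = ∑ x, if x = b then ∑ y, ∑ z, (mixB σ α).1 y * (mixC σ α).1 z *
        stage M 0 (joint x y z) else 0 := by
        refine Finset.sum_congr rfl fun x _ => ?_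
        split_ifs with h
        · refine Finset.sum_congr rfl fun y _ => Finset.sum_congr rfl fun z _ => ?_
          rw [opp_zero, if_pos (show joint x y z 0 = b from h), one_mul]
        · refine Finset.sum_eq_zero fun y _ => Finset.sum_eq_zero fun z _ => ?_
          rw [if_neg (show ¬joint x y z 0 = b from h), zero_mul, zero_mul]
    _ = _ := by rw [Finset.sum_ite_eq' Finset.univ b, if_pos (Finset.mem_univ _), Finset.sum_comm]

theorem util_one (σ : (game M hk hkc).Profile) (α : List (Joint k)) (b : Fin (acts k 1)) :
    util σ 1 α b = ∑ z, ∑ x, (mixA σ α).1 x * (mixC σ α).1 z * stage M 1 (joint x b z) := by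
  have h0 : util σ 1 α b = ∑ x : Fin k, ∑ y : Fin k, ∑ z : Fin (2 * k),
      (if joint x y z 1 = b then 1 else 0) * opp σ 1 α (joint x y z) * stage M 1 (joint x y z) :=
    sum_joint fun a => (if a 1 = b then 1 else 0) * opp σ 1 α a * stage M 1 a
  rw [h0, Finset.sum_comm]
  calc _ = ∑ y, if y = b then ∑ x, ∑ z, (mixA σ α).1 x * (mixC σ α).1 z *
        stage M 1 (joint x y z) else 0 := by
        refine Finset.sum_congr rfl fun y _ => ?_
        split_ifs with h
        · refine Finset.sum_congr rfl fun x _ => Finset.sum_congr rfl fun z _ => ?_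
          rw [opp_one, if_pos (show joint x y z 1 = b from h), one_mul]
        · refine Finset.sum_eq_zero fun x _ => Finset.sum_eq_zero fun z _ => ?_
          rw [if_neg (show ¬joint x y z 1 = b from h), zero_mul, zero_mul]
    _ = _ := by rw [Finset.sum_ite_eq' Finset.univ b, if_pos (Finset.mem_univ _), Finset.sum_comm]

theorem util_two (σ : (game M hk hkc).Profile) (α : List (Joint k)) (b : Fin (acts k 2)) :
    util σ 2 α b = ∑ x, ∑ y, (mixA σ α).1 x * (mixB σ α).1 y * dev M ![x, y] b := by
  have h0 : util σ 2 α b = ∑ x : Fin k, ∑ y : Fin k, ∑ z : Fin (2 * k),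
      (if joint x y z 2 = b then 1 else 0) * opp σ 2 α (joint x y z) * stage M 2 (joint x y z) :=
    sum_joint fun a => (if a 2 = b then 1 else 0) * opp σ 2 α a * stage M 2 a
  rw [h0]
  refine Finset.sum_congr rfl fun x _ => Finset.sum_congr rfl fun y _ => ?_
  calc _ = ∑ z : Fin (2 * k), if joint x y z 2 = b then
        (mixA σ α).1 x * (mixB σ α).1 y * dev M ![x, y] z else 0 := by
        refine Finset.sum_congr rfl fun z _ => ?_
        split_ifs with h
        · rw [opp_two, one_mul]
          simp [stage]
        · rw [zero_mul, zero_mul]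
    _ = _ := (Finset.sum_ite_eq' Finset.univ b (fun z : Fin (2 * k) =>
        (mixA σ α).1 x * (mixB σ α).1 y * dev M ![x, y] z)).trans (if_pos (Finset.mem_univ _))

theorem stage_zero (x y : Fin k) (z : Fin (2 * k)) : stage M 0 (joint x y z) =
    if z.divNat = 0 then M.M 0 ![x, y] - M.M 0 ![z.modNat, y] else 0 := by
  have h : ((z.divNat : ℕ) = ((0 : Fin 3) : ℕ)) ↔ z.divNat = 0 := by
    rw [Fin.ext_iff]; rfl
  rw [stage, if_neg (by decide), joint_pr, joint_third]
  simp only [h]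
  split_ifs with h'
  · rw [dev, h', neg_sub]
    congr 2
    funext j; fin_cases j <;> simp
  · rfl

theorem stage_one (x y : Fin k) (z : Fin (2 * k)) : stage M 1 (joint x y z) =
    if z.divNat = 1 then M.M 1 ![x, y] - M.M 1 ![x, z.modNat] else 0 := by
  have h : ((z.divNat : ℕ) = ((1 : Fin 3) : ℕ)) ↔ z.divNat = 1 := by
    rw [Fin.ext_iff]; rfl
  rw [stage, if_neg (by decide), joint_pr, joint_third]
  simp only [h]
  split_ifs with h'
  · rw [dev, h', neg_sub]
    congr 2
    funext j; fin_cases j <;> simp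
  · rfl

/-- Against a best response to the second player's mixed action, no deviation proposed to the first
player has a positive gain, and proposals to the second player cost the first nothing. Independence
of the opponents makes this hold for each proposal separately. -/
theorem topUtil_zero_nonneg (σ : (game M hk hkc).Profile) (α : List (Joint k)) :
    0 ≤ topUtil σ 0 α := by
  let Y : Fin k → ℝ := fun b => ∑ y, (mixB σ α).1 y * M.M 0 ![b, y]
  refine le_trans ?_ (util_le_topUtil σ 0 α (best hk Y))
  suffices h : 0 ≤ ∑ z : Fin (2 * k), ∑ y : Fin k, (mixB σ α).1 y * (mixC σ α).1 z *
      stage M 0 (joint (best hk Y) y z) from h.trans_eq (util_zero σ α _).symm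
  refine Finset.sum_nonneg fun z _ => ?_
  have hz := (mixC σ α).2.1 z
  simp only [stage_zero]
  split_ifs with h
  · have := le_best hk Y z.modNat
    have e : ∑ y, (mixB σ α).1 y * (mixC σ α).1 z *
        (M.M 0 ![best hk Y, y] - M.M 0 ![z.modNat, y]) =
        (mixC σ α).1 z * (Y (best hk Y) - Y z.modNat) := by
      simp only [Y, ← Finset.sum_sub_distrib, Finset.mul_sum]
      exact Finset.sum_congr rfl fun y _ => by ring
    exact le_of_le_of_eq (mul_nonneg hz (sub_nonneg.2 this)) e.symm
  · simp

theorem topUtil_one_nonneg (σ : (game M hk hkc).Profile) (α : List (Joint k)) :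
    0 ≤ topUtil σ 1 α := by
  let Y : Fin k → ℝ := fun b => ∑ x, (mixA σ α).1 x * M.M 1 ![x, b]
  refine le_trans ?_ (util_le_topUtil σ 1 α (best hk Y))
  suffices h : 0 ≤ ∑ z : Fin (2 * k), ∑ x : Fin k, (mixA σ α).1 x * (mixC σ α).1 z *
      stage M 1 (joint x (best hk Y) z) from h.trans_eq (util_one σ α _).symm
  refine Finset.sum_nonneg fun z _ => ?_
  have hz := (mixC σ α).2.1 z
  simp only [stage_one]
  split_ifs with h
  · have := le_best hk Y z.modNat
    have e : ∑ x, (mixA σ α).1 x * (mixC σ α).1 z *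
        (M.M 1 ![x, best hk Y] - M.M 1 ![x, z.modNat]) =
        (mixC σ α).1 z * (Y (best hk Y) - Y z.modNat) := by
      simp only [Y, ← Finset.sum_sub_distrib, Finset.mul_sum]
      exact Finset.sum_congr rfl fun y _ => by ring
    exact le_of_le_of_eq (mul_nonneg hz (sub_nonneg.2 this)) e.symm
  · simp

/-- Proposing to the first player a best response to the second player's mixed action gains at least
0 whatever the first player does. -/
theorem topUtil_two_nonneg (σ : (game M hk hkc).Profile) (α : List (Joint k)) :
    0 ≤ topUtil σ 2 α := by
  let Y : Fin k → ℝ := fun b => ∑ y, (mixB σ α).1 y * M.M 0 ![b, y]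
  refine le_trans ?_ (util_le_topUtil σ 2 α (Fin.mkDivMod 0 (best hk Y)))
  refine le_of_le_of_eq ?_ (util_two σ α _).symm
  refine Finset.sum_nonneg fun x _ => ?_
  have hx := (mixA σ α).2.1 x
  have e : ∑ y, (mixA σ α).1 x * (mixB σ α).1 y *
      dev M ![x, y] (Fin.mkDivMod 0 (best hk Y)) =
      (mixA σ α).1 x * (Y (best hk Y) - Y x) := by
    simp only [Y, ← Finset.sum_sub_distrib, Finset.mul_sum]
    refine Finset.sum_congr rfl fun y _ => ?_
    have : Function.update ![x, y] 0 (best hk Y) = ![best hk Y, y] := by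
      funext j; fin_cases j <;> rfl
    rw [dev, Fin.divNat_mkDivMod, Fin.modNat_mkDivMod, this]
    ring
  exact le_of_le_of_eq (mul_nonneg hx (sub_nonneg.2 (le_best hk Y x))) e.symm

/-- In an approximate equilibrium the first two players are, on average over the histories that
the third player's deviation produces, close to a Nash equilibrium of the stage game. -/
theorem sum_topUtil_le (hM : ∀ i a, HasBits k (M.M i a)) {T : ℕ} (hT : 0 < T)
    (σ : Fin T → (game M hk hkc).Profile) {ε : ℝ} (hε : 0 < ε) (hε1 : ε ≤ 1)
    (hcce : (game M hk hkc).IsMixCCE ε σ) (hlog : Real.log T ≤ ε ^ 2 / 8 * 2 ^ c)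
    (hsmall : 3 / 2 ^ (k + 1) ≤ ε / 4) :
    ∑ t, ES (devDist σ 2 t) (topUtil (σ t) 2) (2 ^ c) [] ≤ T * 2 ^ c * (11 * ε) := by
  have hT' : (0 : ℝ) < T := by exact_mod_cast hT
  have hH : (0 : ℝ) < 2 ^ c := by positivity
  -- The choice λ = ε/4: the first term is at most εH/2 by `hlog`, the second one is εH.
  have herr : Real.log T / (ε / 4) + 2 ^ c * (4 * (ε / 4)) ≤ 2 ^ c * (3 / 2 * ε) := by
    have : Real.log T / (ε / 4) ≤ 2 ^ c * (ε / 2) := by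
      rw [div_le_iff₀ (by positivity)]
      linarith
    linarith
  -- Division by 2H turns the loss 3εH/2 into 3ε/4; the equilibrium condition adds another ε.
  have hdev : ∀ i, ∑ t, ES (devDist σ i t) (topUtil (σ t) i) (2 ^ c) [] / (2 * 2 ^ c) -
      T * (3 / 4 * ε) ≤ ∑ t, (game M hk hkc).value (σ t) i + T * ε := by
    intro i
    have h1 := hcce i (detPolicy M hk hkc i (bayesAct σ i))
    unfold MarkovGame.mixValue at h1
    rw [← mul_sub, one_div, inv_mul_le_iff₀ hT'] at h1
    have h2 : ∑ t, (ES (devDist σ i t) (topUtil (σ t) i) (2 ^ c) [] / (2 * 2 ^ c) - 3 / 4 * ε) ≤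
        ∑ t, (game M hk hkc).value
          (Function.update (σ t) i (detPolicy M hk hkc i (bayesAct σ i))) i := by
      refine Finset.sum_le_sum fun t _ => ?_
      refine le_trans ?_ (dev_value hM σ i t (lam := ε / 4) (by positivity) (by linarith))
      rw [sub_div]
      have : (Real.log T / (ε / 4) + 2 ^ c * (4 * (ε / 4))) / (2 * 2 ^ c) ≤ 3 / 4 * ε := by
        rw [div_le_iff₀ (by positivity)]
        linarith
      linarith
    rw [Finset.sum_sub_distrib] at h2
    simp only [Finset.sum_const, Finset.card_univ, Fintype.card_fin, nsmul_eq_mul] at h2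
    linarith
  have hES0 : ∀ i, (∀ t α, 0 ≤ topUtil (σ t) i α) →
      0 ≤ ∑ t, ES (devDist σ i t) (topUtil (σ t) i) (2 ^ c) [] / (2 * 2 ^ c) := by
    intro i hi
    refine Finset.sum_nonneg fun t _ => div_nonneg ?_ (by positivity)
    have := ES_mono (devDist_nonneg σ i t) (hi t) (2 ^ c) []
    rwa [ES_const (sum_devDist hM σ i t), mul_zero] at this
  have h0 := hdev 0
  have h1 := hdev 1
  have h2 := hdev 2
  have n0 := hES0 0 fun t α => topUtil_zero_nonneg _ _
  have n1 := hES0 1 fun t α => topUtil_one_nonneg _ _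
  have hs : ∑ t, (game M hk hkc).value (σ t) 0 + ∑ t, (game M hk hkc).value (σ t) 1 +
      ∑ t, (game M hk hkc).value (σ t) 2 ≤ T * (ε / 4) := by
    rw [← Finset.sum_add_distrib, ← Finset.sum_add_distrib]
    calc _ ≤ ∑ t : Fin T, ε / 4 := Finset.sum_le_sum fun t _ => by
          have := sum_value_le (σ t)
          rw [Fin.sum_univ_three] at this
          exact this.trans hsmall
      _ = _ := by simp
  rw [← Finset.sum_div] at h2
  -- Three times 7ε/4, plus ε/4 from the codes, is 11ε/2.
  have h3 : (∑ t, ES (devDist σ 2 t) (topUtil (σ t) 2) (2 ^ c) []) / (2 * 2 ^ c) ≤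
      T * (11 / 2 * ε) := by linarith
  rw [div_le_iff₀ (by positivity)] at h3
  linarith

/-! ### Nash equilibria and deviation gains -/

def twoProfile (p q : stdSimplex ℝ (Fin k)) : Fin 2 → stdSimplex ℝ (Fin k) := ![p, q]

theorem expect_two (p q : stdSimplex ℝ (Fin k)) (F : (Fin 2 → Fin k) → ℝ) :
    NormalFormGame.expect (twoProfile p q) F = ∑ x, ∑ y, p.1 x * q.1 y * F ![x, y] := by
  rw [NormalFormGame.expect, ← (finTwoArrowEquiv (Fin k)).symm.sum_comp, Fintype.sum_prod_type]
  refine Finset.sum_congr rfl fun x _ => Finset.sum_congr rfl fun y _ => ?_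
  rw [Fin.prod_univ_two]
  rfl

theorem expect_sub (p : Fin 2 → stdSimplex ℝ (Fin k)) (F F' : (Fin 2 → Fin k) → ℝ) :
    NormalFormGame.expect p F - NormalFormGame.expect p F' =
      NormalFormGame.expect p fun a => F a - F' a := by
  simp only [NormalFormGame.expect, ← Finset.sum_sub_distrib, mul_sub]

theorem isNash_of_dev {ε : ℝ} {p : Fin 2 → stdSimplex ℝ (Fin k)}
    (h : ∀ b, NormalFormGame.expect p (fun x => dev M x b) ≤ ε) : M.IsNash ε p := by
  intro i a'
  rw [expect_sub]
  have := h (Fin.mkDivMod i a')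
  simpa only [dev, Fin.divNat_mkDivMod, Fin.modNat_mkDivMod] using this

theorem isNash_of_one_le {ε : ℝ} (hε : 1 ≤ ε) (p : Fin 2 → stdSimplex ℝ (Fin k)) :
    M.IsNash ε p := by
  refine isNash_of_dev fun b => ?_
  have hsum : ∑ a : Fin 2 → Fin k, ∏ j, (p j).1 (a j) = 1 := by
    have h := Finset.prod_univ_sum (fun _ : Fin 2 => (Finset.univ : Finset (Fin k)))
      (fun i b => (p i).1 b)
    rw [Fintype.piFinset_univ] at h
    rw [← h]
    exact Finset.prod_eq_one fun i _ => (p i).2.2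
  calc NormalFormGame.expect p (fun x => dev M x b) ≤ ∑ a : Fin 2 → Fin k, ∏ j, (p j).1 (a j) := by
        refine Finset.sum_le_sum fun a _ => ?_
        exact mul_le_of_le_one_right (Finset.prod_nonneg fun j _ => (p j).2.1 _)
          ((le_abs_self _).trans (abs_dev_le M a b))
    _ ≤ ε := by rw [hsum]; exact hε

theorem isNash_of_topUtil {ε : ℝ} {σ : (game M hk hkc).Profile} {α : List (Joint k)}
    (h : topUtil σ 2 α ≤ ε) : M.IsNash ε (twoProfile (mixA σ α) (mixB σ α)) := by
  refine isNash_of_dev fun b => ?_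
  rw [expect_two]
  refine le_trans (le_of_eq ?_) ((util_le_topUtil σ 2 α b).trans h)
  exact (util_two σ α b).symm

end


section

variable {k c : ℕ} {M : NormalFormGame 2 k} {hk : 0 < k} {hkc : k < 2 ^ c}

/-! ### Size and description of the repeated game -/

theorem hasBits_one (b : ℕ) : HasBits b 1 := ⟨2 ^ b, by push_cast; field_simp⟩

theorem game_allHaveBits (hM : ∀ i a, HasBits k (M.M i a)) :
    (game M hk hkc).AllHaveBits (k + 4 * c + 2) :=
  ⟨fun i _ _ a => ⟨_, rew_eq hM c i a⟩, fun _ _ _ _ => hasBits_one _, fun _ => hasBits_one _⟩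

/-- The joint action with code 1 has an odd numerator, so no digit can be spared; it exists because
there are two actions. The exact value is needed since the description of the game and the inputs of
circuits use the least precision. -/
theorem game_beta (hM : ∀ i a, HasBits k (M.M i a)) (hk2 : 2 ≤ k) :
    (game M hk hkc).beta = (k + 4 * c + 2 : ℕ) := by
  refine le_antisymm (iInf₂_le _ (game_allHaveBits hM)) (le_iInf₂ fun b hb => ?_)
  by_contra hlt
  rw [not_le, Nat.cast_lt] at hlt
  let a : Joint k := joint ⟨1, hk2⟩ ⟨0, hk⟩ ⟨0, Nat.mul_pos two_pos hk⟩
  obtain ⟨z, hz⟩ := hb.1 0 ⟨0, (game M hk hkc).H_pos⟩ (0 : Fin 1) a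
  have hz' : rew M c 0 a = (z : ℝ) / 2 ^ b := hz
  rw [rew_eq hM, div_eq_div_iff (by positivity) (by positivity)] at hz'
  obtain ⟨d, hd⟩ := Nat.exists_eq_add_of_lt hlt
  rw [hd] at hz'
  have h1 : (rewZ M c 0 a : ℝ) = z * 2 ^ (d + 1) := by
    have : (z : ℝ) * 2 ^ (b + d + 1) = (z * 2 ^ (d + 1)) * 2 ^ b := by ring
    rw [this] at hz'
    exact mul_right_cancel₀ (by positivity) hz'
  have h2 : rewZ M c 0 a = z * 2 ^ (d + 1) := by exact_mod_cast h1
  have hcode : a.code = 1 := by simp [a, code_joint]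
  rw [rewZ, hcode, pow_succ, pow_succ, ← mul_assoc, ← mul_assoc] at h2
  push_cast at h2
  omega

theorem game_prec (hM : ∀ i a, HasBits k (M.M i a)) (hk2 : 2 ≤ k) :
    (game M hk hkc).prec = k + 4 * c + 2 := by
  rw [MarkovGame.prec, game_beta hM hk2, ENat.toNat_natCast]

theorem game_size (hM : ∀ i a, HasBits k (M.M i a)) (hk2 : 2 ≤ k) {n : ℕ} (hkn : 2 * k ≤ n)
    (hcn : 2 ^ c ≤ n) (hbn : k + 4 * c + 2 ≤ n) : (game M hk hkc).size ≤ (n : ℕ∞) := by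
  rw [MarkovGame.size, game_beta hM hk2]
  refine max_le (max_le ?_ (iSup_le fun i => ?_)) (max_le ?_ ?_)
  · show ((1 : ℕ) : ℕ∞) ≤ n
    exact_mod_cast (by omega : 1 ≤ n)
  · show ((acts k i : ℕ) : ℕ∞) ≤ n
    have : acts k i ≤ n := by
      fin_cases i
      · show k ≤ n; omega
      · show k ≤ n; omega
      · exact hkn
    exact_mod_cast this
  · show ((2 ^ c : ℕ) : ℕ∞) ≤ n
    exact_mod_cast hcn
  · exact_mod_cast hbn

/-- The joint action with a given index. -/
def ofCode {k : ℕ} (j : Fin (k * k * (2 * k))) : Joint k :=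
  have hk : 0 < k := Nat.pos_of_ne_zero fun h => by
    have := j.2
    simp [h] at this
  joint ⟨j % k, Nat.mod_lt _ hk⟩ ⟨j / k % k, Nat.mod_lt _ hk⟩
    ⟨j / (k * k), Nat.div_lt_of_lt_mul j.2⟩

theorem code_ofCode (j : Fin (k * k * (2 * k))) : (ofCode j).code = j := by
  rw [ofCode, code_joint]
  dsimp only
  have h1 := Nat.mod_add_div (j : ℕ) k
  have h2 := Nat.mod_add_div ((j : ℕ) / k) k
  have h3 := Nat.div_div_eq_div_mul (j : ℕ) k k
  rw [← h3]
  calc (j : ℕ) % k + (j : ℕ) / k % k * k + (j : ℕ) / k / k * (k * k)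
      = (j : ℕ) % k + k * ((j : ℕ) / k % k + k * ((j : ℕ) / k / k)) := by ring
    _ = _ := by rw [h2, h1]

/-- Replaces the inverse of the enumeration of joint actions by quotients and remainders, which a
program can compute. -/
theorem finPi_symm_eq (j : Fin (∏ i, acts k i)) :
    finPiFinEquiv.symm j = ofCode (Fin.cast (prod_acts k) j) := by
  rw [Equiv.symm_apply_eq]
  apply Fin.ext
  exact (code_ofCode (Fin.cast (prod_acts k) j)).symm

theorem Val.table_cast {m m' : ℕ} (h : m = m') (f : Fin m → Val) :
    Val.table f = Val.table fun j => f (Fin.cast h.symm j) := by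
  subst h; rfl

theorem Val.table_one (f : Fin 1 → Val) : Val.table f = .ofList [f 0] := by
  simp [Val.table]

theorem numer_one (b : ℕ) : numer b 1 = 2 ^ b := by
  rw [numer, one_mul]
  exact_mod_cast Int.floor_intCast (R := ℝ) (2 ^ b)

/-- Brings the description into a form in which every entry is an explicit integer. -/
theorem game_encode (hM : ∀ i a, HasBits k (M.M i a)) (hk2 : 2 ≤ k) :
    (game M hk hkc).encode = .ofList
      [.ofNat 1, .ofNat (2 ^ c), .ofList [.ofNat k, .ofNat k, .ofNat (2 * k)],
        .ofNat (k + 4 * c + 2), .ofList [.int (2 ^ (k + 4 * c + 2))],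
        .table fun _ : Fin (2 ^ c) => .ofList [.table fun _ : Fin (k * k * (2 * k)) =>
          .ofList [.int (2 ^ (k + 4 * c + 2))]],
        .table fun i : Fin 3 => .table fun _ : Fin (2 ^ c) => .ofList [
          .table fun j : Fin (k * k * (2 * k)) => .int (rewZ M c i (ofCode j))]] := by
  have hT : ∀ F : Joint k → Val, (Val.table fun j : Fin (∏ i, acts k i) => F (finPiFinEquiv.symm j))
      = .table fun j : Fin (k * k * (2 * k)) => F (ofCode j) := fun F => by
    rw [Val.table_cast (prod_acts k)]
    simp only [finPi_symm_eq]
    rfl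
  rw [MarkovGame.encode, game_prec hM hk2]
  have e3 : (Val.table fun i : Fin 3 => .ofNat (acts k i)) =
      .ofList [.ofNat k, .ofNat k, .ofNat (2 * k)] := by
    simp [Val.table, acts]
  have e7 : ∀ i, (Val.table fun a : Fin (∏ i, acts k i) =>
      .int (numer (k + 4 * c + 2) (rew M c i (finPiFinEquiv.symm a)))) =
      .table fun j : Fin (k * k * (2 * k)) => .int (rewZ M c i (ofCode j)) := fun i => by
    rw [hT (fun a => .int (numer (k + 4 * c + 2) (rew M c i a)))]
    simp only [numer_rew hM]
  refine Eq.trans (b := Val.ofList [.ofNat 1, .ofNat (2 ^ c), .table fun i : Fin 3 => .ofNat (acts k i),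
      .ofNat (k + 4 * c + 2), .table fun _ : Fin 1 => .int (numer (k + 4 * c + 2) 1),
      .table fun _ : Fin (2 ^ c) => .table fun _ : Fin 1 => .table fun _ : Fin (∏ i, acts k i) =>
        .table fun _ : Fin 1 => .int (numer (k + 4 * c + 2) 1),
      .table fun i : Fin 3 => .table fun _ : Fin (2 ^ c) => .table fun _ : Fin 1 =>
        .table fun a : Fin (∏ i, acts k i) =>
          .int (numer (k + 4 * c + 2) (rew M c i (finPiFinEquiv.symm a)))]) rfl ?_
  · simp only [Val.table_one, e7, numer_one, e3]
    rw [hT (fun _ => Val.ofList [.int (2 ^ (k + 4 * c + 2))])]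

/-- Numerators of the payoffs of a normal-form game. -/
noncomputable def payZ (M : NormalFormGame 2 k) (i : Fin 2) (x y : Fin k) : ℤ :=
  numer k (M.M i ![x, y])

theorem payZ_div (hM : ∀ i a, HasBits k (M.M i a)) (i : Fin 2) (x y : Fin k) :
    M.M i ![x, y] = (payZ M i x y : ℝ) / 2 ^ k :=
  eq_numer_div (hM _ _)

noncomputable def devZ (M : NormalFormGame 2 k) (x y : Fin k) (z : Fin (2 * k)) : ℤ :=
  if (z : ℕ) < k then payZ M 0 z.modNat y - payZ M 0 x y else
    payZ M 1 x z.modNat - payZ M 1 x y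

theorem dev_eq (hM : ∀ i a, HasBits k (M.M i a)) (x y : Fin k) (z : Fin (2 * k)) :
    dev M ![x, y] z = (devZ M x y z : ℝ) / 2 ^ k := by
  have hk : 0 < k := x.pos
  have h0 : z.divNat = 0 ∨ z.divNat = 1 := by
    generalize z.divNat = w; revert w; decide
  have h1 : (z : ℕ) < k ↔ z.divNat = 0 := by
    rw [Fin.ext_iff, Fin.coe_divNat, Fin.val_zero, Nat.div_eq_zero_iff]
    omega
  have u0 : Function.update ![x, y] 0 z.modNat = ![z.modNat, y] := by
    funext j; fin_cases j <;> rfl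
  have u1 : Function.update ![x, y] 1 z.modNat = ![x, z.modNat] := by
    funext j; fin_cases j <;> rfl
  rw [devZ]
  rcases h0 with h | h
  · rw [if_pos (h1.2 h), dev, h, u0, payZ_div hM, payZ_div hM]; push_cast; ring
  · rw [if_neg (by rw [h1, h]; decide), dev, h, u1, payZ_div hM, payZ_div hM]; push_cast; ring

/-- Numerators of the payoffs of the stage game. -/
noncomputable def stageZ (M : NormalFormGame 2 k) (i : Fin 3) (x y : Fin k) (z : Fin (2 * k)) : ℤ :=
  if (i : ℕ) < 2 then (if (z : ℕ) / k < i then 0 else if (i : ℕ) < z / k then 0 else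
    0 - devZ M x y z) else devZ M x y z

theorem numer_stage (hM : ∀ i a, HasBits k (M.M i a)) (i : Fin 3) (x y : Fin k)
    (z : Fin (2 * k)) : numer k (stage M i (joint x y z)) = stageZ M i x y z := by
  have h : stage M i (joint x y z) = (stageZ M i x y z : ℝ) / 2 ^ k := by
    rw [stage, stageZ, joint_pr, joint_third, dev_eq hM, Fin.coe_divNat]
    by_cases h2 : i = 2
    · subst h2; simp
    · have h3 : (i : ℕ) < 2 := by omega
      rw [if_neg h2, if_pos h3]
      rcases lt_trichotomy ((z : ℕ) / k) (i : ℕ) with h4 | h4 | h4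
      · rw [if_neg h4.ne, if_pos h4]; simp
      · rw [if_pos h4, if_neg h4.not_lt, if_neg h4.not_gt]; push_cast; ring
      · rw [if_neg h4.ne', if_neg h4.not_gt, if_pos h4]; simp
  rw [h, numer_div]

theorem rewZ_joint (hM : ∀ i a, HasBits k (M.M i a)) (i : Fin 3) (x y : Fin k)
    (z : Fin (2 * k)) : rewZ M c i (joint x y z) =
      stageZ M i x y z * 2 ^ (3 * c + 1) + (x + y * k + z * (k * k) : ℕ) := by
  rw [rewZ, numer_stage hM, code_joint]

theorem encode_eq (hk2 : 2 ≤ k) : M.encode = .pair (.ofNat k) (.table fun i : Fin 2 =>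
    .table fun j : Fin (k ^ 2) => .int (payZ M i ⟨j % k, Nat.mod_lt _ (by omega)⟩
      ⟨j / k, Nat.div_lt_of_lt_mul (by rw [← sq]; exact j.2)⟩)) := by
  rw [NormalFormGame.encode, max_eq_left hk2]
  congr 2
  funext i
  congr 2
  funext j
  have : finFunctionFinEquiv.symm j = ![⟨j % k, Nat.mod_lt _ (by omega)⟩,
      ⟨j / k, Nat.div_lt_of_lt_mul (by rw [← sq]; exact j.2)⟩] := by
    rw [Equiv.symm_apply_eq]
    apply Fin.ext
    rw [finFunctionFinEquiv_apply, Fin.sum_univ_two]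
    have := Nat.mod_add_div (j : ℕ) k
    simp
    linarith
  rw [this, payZ]

end


/-! ## Averages over coin tosses -/

/-- Average of `F` over all sequences of `K` coin tosses. -/
noncomputable def avg : ℕ → (List Bool → ℝ) → ℝ
  | 0, F => F []
  | K + 1, F => (avg K (fun u => F (true :: u)) + avg K fun u => F (false :: u)) / 2

theorem avg_congr {K : ℕ} {F G : List Bool → ℝ} (h : ∀ u, u.length = K → F u = G u) :
    avg K F = avg K G := by
  induction K generalizing F G with
  | zero => exact h [] rfl
  | succ K ih =>
    simp only [avg]
    rw [ih fun u hu => h (true :: u) (by simp [hu]), ih fun u hu => h (false :: u) (by simp [hu])]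

theorem avg_mono {K : ℕ} {F G : List Bool → ℝ} (h : ∀ u, u.length = K → F u ≤ G u) :
    avg K F ≤ avg K G := by
  induction K generalizing F G with
  | zero => exact h [] rfl
  | succ K ih =>
    simp only [avg]
    have h1 := ih fun u hu => h (true :: u) (by simp [hu])
    have h2 := ih fun u hu => h (false :: u) (by simp [hu])
    linarith

theorem avg_const (K : ℕ) (r : ℝ) : avg K (fun _ => r) = r := by
  induction K with
  | zero => rfl
  | succ K ih => simp only [avg, ih]; ring

theorem avg_mul_left (K : ℕ) (r : ℝ) (F : List Bool → ℝ) :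
    avg K (fun u => r * F u) = r * avg K F := by
  induction K generalizing F with
  | zero => rfl
  | succ K ih => simp only [avg, ih]; ring

theorem avg_add_fun (K : ℕ) (F G : List Bool → ℝ) :
    avg K (fun u => F u + G u) = avg K F + avg K G := by
  induction K generalizing F G with
  | zero => rfl
  | succ K ih => simp only [avg, ih]; ring

theorem avg_sum {ι : Type*} (s : Finset ι) (K : ℕ) (F : ι → List Bool → ℝ) :
    avg K (fun u => ∑ i ∈ s, F i u) = ∑ i ∈ s, avg K (F i) := by
  classical
  induction s using Finset.induction_on with
  | empty => simpa using avg_const K 0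
  | insert i s hi ih =>
    simp only [Finset.sum_insert hi]
    rw [avg_add_fun, ih]

theorem avg_add (K L : ℕ) (F : List Bool → ℝ) :
    avg (K + L) F = avg K fun u => avg L fun v => F (u ++ v) := by
  induction K generalizing F with
  | zero => simp [avg]
  | succ K ih =>
    rw [Nat.succ_add]
    simp only [avg, ih, List.cons_append]

/-- Tossed coins are pushed onto a list, and the simulation reads them in the opposite order. -/
theorem avg_reverse (K : ℕ) (F : List Bool → ℝ) : avg K (fun u => F u.reverse) = avg K F := by
  induction K generalizing F with
  | zero => rfl
  | succ K ih =>
    rw [avg_add K 1 F]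
    simp only [avg, List.reverse_cons]
    rw [ih fun u => F (u ++ [true]), ih fun u => F (u ++ [false]), ← avg_add_fun]
    simp only [div_eq_inv_mul]
    rw [avg_mul_left]

theorem avg_eq_sum (K : ℕ) (F : List Bool → ℝ) :
    avg K F = (∑ w : Fin K → Bool, F (List.ofFn w)) / 2 ^ K := by
  induction K generalizing F with
  | zero => simp [avg]
  | succ K ih =>
    rw [← (Fin.consEquiv fun _ => Bool).sum_comp, Fintype.sum_prod_type, Fintype.sum_bool]
    have h : ∀ b (y : Fin K → Bool), List.ofFn ((Fin.consEquiv fun _ => Bool) (b, y)) =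
        b :: List.ofFn y := fun b y => List.ofFn_cons b y
    simp only [avg, ih, h]
    rw [pow_succ]
    field_simp

theorem sum_range_two_mul (n : ℕ) (G : ℕ → ℝ) :
    ∑ r ∈ Finset.range (2 * n), G r = ∑ r ∈ Finset.range n, (G (1 + 2 * r) + G (0 + 2 * r)) := by
  induction n with
  | zero => simp
  | succ n ih =>
    rw [Nat.mul_succ, Finset.sum_range_succ, Finset.sum_range_succ, ih, Finset.sum_range_succ,
      add_comm 1, zero_add]
    ring

theorem avg_ofBits (N : ℕ) (G : ℕ → ℝ) :
    avg N (fun u => G (ofBits u)) = (∑ r ∈ Finset.range (2 ^ N), G r) / 2 ^ N := by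
  induction N generalizing G with
  | zero => simp [avg, ofBits]
  | succ N ih =>
    simp only [avg, ofBits]
    rw [ih fun r => G (true.toNat + 2 * r), ih fun r => G (false.toNat + 2 * r), pow_succ' 2 N,
      sum_range_two_mul, Finset.sum_add_distrib]
    simp only [Bool.toNat_true, Bool.toNat_false]
    rw [pow_succ]
    field_simp

/-- Independent repetitions. -/
theorem avg_prod (K l : ℕ) (F : List Bool → ℝ) :
    avg (l * K) (fun w => ∏ i ∈ Finset.range l, F ((w.drop (i * K)).take K)) = avg K F ^ l := by
  induction l with
  | zero => simp [avg]
  | succ l ih =>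
    rw [show (l + 1) * K = K + l * K by ring, avg_add, pow_succ, ← ih, ← avg_mul_left]
    refine avg_congr fun u hu => ?_
    rw [mul_comm _ (F u), ← avg_mul_left]
    refine avg_congr fun v _ => ?_
    rw [Finset.prod_range_succ', mul_comm]
    congr 1
    · simp [← hu]
    · refine Finset.prod_congr rfl fun i _ => ?_
      rw [show (i + 1) * K = u.length + i * K by rw [hu]; ring, List.drop_append,
        List.drop_eq_nil_of_le (by omega), Nat.add_sub_cancel_left, List.nil_append]

/-! ## Sampling from dyadic distributions -/

/-- The index below or equal to `m` in whose interval the number `r` lies, when the intervals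
have the lengths `P 0`, `P 1`, … -/
def pick (P : ℕ → ℕ) : ℕ → ℕ → ℕ
  | 0, _ => 0
  | m + 1, r => if r < ∑ i ∈ Finset.range (m + 1), P i then pick P m r else m + 1

theorem pick_le (P : ℕ → ℕ) (m r : ℕ) : pick P m r ≤ m := by
  induction m with
  | zero => simp [pick]
  | succ m ih => unfold pick; split_ifs <;> omega

/-- The numbers r that lead to the index i form an interval of P i integers. -/
theorem sum_pick (P : ℕ → ℕ) (m : ℕ) (F : ℕ → ℝ) :
    ∑ r ∈ Finset.range (∑ i ∈ Finset.range (m + 1), P i), F (pick P m r) =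
      ∑ i ∈ Finset.range (m + 1), P i * F i := by
  induction m with
  | zero => simp [pick]
  | succ m ih =>
    rw [Finset.sum_range_succ (fun i => (P i : ℝ) * F i), ← ih, Finset.sum_range_succ P (m + 1),
      Finset.sum_range_add]
    congr 1
    · refine Finset.sum_congr rfl fun r hr => ?_
      rw [pick, if_pos (Finset.mem_range.1 hr)]
    · have : ∀ r, pick P (m + 1) (∑ i ∈ Finset.range (m + 1), P i + r) = m + 1 := fun r => by
        rw [pick, if_neg (by omega)]
      simp [this]

def extend {k : ℕ} (P : Fin k → ℕ) (i : ℕ) : ℕ := if h : i < k then P ⟨i, h⟩ else 0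

def pickFin {k : ℕ} (hk : 0 < k) (P : Fin k → ℕ) (r : ℕ) : Fin k :=
  ⟨pick (extend P) (k - 1) r, by have := pick_le (extend P) (k - 1) r; omega⟩

theorem sum_pickFin {k : ℕ} (hk : 0 < k) (P : Fin k → ℕ) (F : Fin k → ℝ) :
    ∑ r ∈ Finset.range (∑ a, P a), F (pickFin hk P r) = ∑ a, P a * F a := by
  have h := sum_pick (extend P) (k - 1) fun i => if h : i < k then F ⟨i, h⟩ else 0
  rw [Nat.sub_add_cancel hk] at h
  have e1 : ∑ i ∈ Finset.range k, extend P i = ∑ a, P a := by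
    rw [Finset.sum_range]
    exact Finset.sum_congr rfl fun i _ => by simp [extend]
  rw [e1, Finset.sum_range (fun i => (extend P i : ℝ) * _)] at h
  refine (Finset.sum_congr rfl fun r _ => ?_).trans
    (h.trans (Finset.sum_congr rfl fun i _ => by simp [extend]))
  rw [dif_pos (show pick (extend P) (k - 1) r < k from (pickFin hk P r).2)]
  rfl

/-! ## Simulation of the deviation of the third player -/

section

variable {k c : ℕ} {M : NormalFormGame 2 k} {hk : 0 < k} {hkc : k < 2 ^ c}

noncomputable def numA (N : ℕ) (σ : (game M hk hkc).Profile) (α : List (Joint k)) (a : Fin k) : ℕ :=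
  ⌊(mixA σ α).1 a * 2 ^ N⌋₊

noncomputable def numB (N : ℕ) (σ : (game M hk hkc).Profile) (α : List (Joint k)) (a : Fin k) : ℕ :=
  ⌊(mixB σ α).1 a * 2 ^ N⌋₊

/-- The mixed actions of the first two players have probabilities with `N` binary digits. -/
structure Dyadic (N : ℕ) (σ : (game M hk hkc).Profile) : Prop where
  A : ∀ α : List (Joint k), α.length < 2 ^ c → ∀ a, (mixA σ α).1 a = numA N σ α a / 2 ^ N
  B : ∀ α : List (Joint k), α.length < 2 ^ c → ∀ a, (mixB σ α).1 a = numB N σ α a / 2 ^ N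

/-- The weights fill the range of N random bits, so that sampling is exact and needs no rejection.
-/
theorem sum_num {N : ℕ} {p : stdSimplex ℝ (Fin k)} {P : Fin k → ℕ}
    (h : ∀ a, p.1 a = P a / 2 ^ N) : ∑ a, P a = 2 ^ N := by
  have h1 := p.2.2
  have h2 : ∑ a, p.1 a = (∑ a, (P a : ℝ)) / 2 ^ N := by
    rw [Finset.sum_div]; exact Finset.sum_congr rfl fun a _ => h a
  have h3 : ∑ a, p.1 a = 1 := h1
  rw [h3, eq_div_iff (by positivity), one_mul] at h2
  exact_mod_cast h2.symm

variable {T : ℕ}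

/-- The next joint action, drawn with the coins `u`. -/
noncomputable def nextJoint (N : ℕ) (σ : Fin T → (game M hk hkc).Profile) (t : Fin T)
    (α : List (Joint k)) (u : List Bool) : Joint k :=
  joint (pickFin hk (numA N (σ t) α) (ofBits (u.take N)))
    (pickFin hk (numB N (σ t) α) (ofBits ((u.drop N).take N))) (bayesAct σ 2 α)

theorem avg_pickFin {N : ℕ} {p : stdSimplex ℝ (Fin k)} {P : Fin k → ℕ}
    (h : ∀ a, p.1 a = P a / 2 ^ N) (F : Fin k → ℝ) :
    avg N (fun u => F (pickFin hk P (ofBits u))) = ∑ a, p.1 a * F a := by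
  have h1 := sum_pickFin hk P F
  rw [sum_num h] at h1
  rw [avg_ofBits N fun r => F (pickFin hk P r), h1, Finset.sum_div]
  refine Finset.sum_congr rfl fun a _ => ?_
  rw [h]
  ring

/-- N coins serve each of the first two players; the third one plays deterministically. -/
theorem avg_nextJoint {N : ℕ} {σ : Fin T → (game M hk hkc).Profile} {t : Fin T}
    (hd : Dyadic N (σ t)) {α : List (Joint k)} (hα : α.length < 2 ^ c) (G : Joint k → ℝ) :
    avg (N + N) (fun u => G (nextJoint N σ t α u)) = ∑ a, devDist σ 2 t α a * G a := by
  have e : avg (N + N) (fun u => G (nextJoint N σ t α u)) =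
      avg N fun u => avg N fun v => G (joint (pickFin hk (numA N (σ t) α) (ofBits u))
        (pickFin hk (numB N (σ t) α) (ofBits v)) (bayesAct σ 2 α)) := by
    rw [avg_add]
    refine avg_congr fun u hu => avg_congr fun v hv => ?_
    rw [nextJoint, ← hu]
    simp only [List.take_left, List.drop_left]
    rw [hu, ← hv, List.take_length]
  refine e.trans ?_
  rw [sum_joint]
  obtain ⟨z, hz⟩ : ∃ z : Fin (2 * k), bayesAct σ 2 α = z := ⟨_, rfl⟩
  simp only [hz]
  have e1 : ∀ x : Fin k, avg N (fun v => G (joint x (pickFin hk (numB N (σ t) α) (ofBits v)) z)) =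
      ∑ y, (mixB (σ t) α).1 y * G (joint x y z) := fun x =>
    avg_pickFin (hk := hk) (hd.B α hα) fun y => G (joint x y z)
  refine ((avg_congr fun u _ => e1 _).trans (avg_pickFin (hk := hk) (hd.A α hα)
    fun x => ∑ y, (mixB (σ t) α).1 y * G (joint x y z))).trans ?_
  refine Finset.sum_congr rfl fun x _ => ?_
  rw [Finset.mul_sum]
  refine Finset.sum_congr rfl fun y _ => ?_
  symm
  calc _ = ∑ z' : Fin (2 * k), if z' = z then
        (mixA (σ t) α).1 x * (mixB (σ t) α).1 y * G (joint x y z') else 0 := by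
        refine Finset.sum_congr rfl fun z' _ => ?_
        rw [devDist, opp_two, hz]
        change (if z' = z then (1 : ℝ) else 0) * ((mixA (σ t) α).1 x * (mixB (σ t) α).1 y) *
          G (joint x y z') = _
        split_ifs <;> simp
    _ = _ := (Finset.sum_ite_eq' Finset.univ z (fun z' : Fin (2 * k) =>
        (mixA (σ t) α).1 x * (mixB (σ t) α).1 y * G (joint x y z'))).trans
          (if_pos (Finset.mem_univ _))
    _ = _ := mul_assoc _ _ _

/-- The simulated history after `h` steps from the history `α`. -/
noncomputable def simHist (N : ℕ) (σ : Fin T → (game M hk hkc).Profile) (t : Fin T)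
    (α : List (Joint k)) (u : List Bool) : ℕ → List (Joint k)
  | 0 => α
  | h + 1 => nextJoint N σ t (simHist N σ t α u h) ((u.drop (h * (N + N))).take (N + N)) ::
      simHist N σ t α u h

theorem simHist_length (N : ℕ) (σ : Fin T → (game M hk hkc).Profile) (t : Fin T)
    (α : List (Joint k)) (u : List Bool) (h : ℕ) :
    (simHist N σ t α u h).length = α.length + h := by
  induction h with
  | zero => rfl
  | succ h ih => simp [simHist, ih]; omega

/-- The simulation is defined by splitting off the last step, `ES` and `avg` by splitting off the
first one; this passes between the two. -/
theorem simHist_append (N : ℕ) (σ : Fin T → (game M hk hkc).Profile) (t : Fin T)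
    (α : List (Joint k)) {u : List Bool} (v : List Bool) (hu : u.length = N + N) (h : ℕ) :
    simHist N σ t α (u ++ v) (h + 1) = simHist N σ t (nextJoint N σ t α u :: α) v h := by
  induction h with
  | zero => simp [simHist, ← hu]
  | succ h ih =>
    rw [simHist, ih, simHist]
    rw [show (h + 1) * (N + N) = u.length + h * (N + N) by rw [hu]; ring, List.drop_append,
      List.drop_eq_nil_of_le (by omega), Nat.add_sub_cancel_left, List.nil_append]

/-- Different steps use disjoint blocks of coins. The bound on the length keeps each history within
the horizon, the only range where the probabilities are known to be dyadic. -/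
theorem avg_simHist {N : ℕ} {σ : Fin T → (game M hk hkc).Profile} {t : Fin T}
    (hd : Dyadic N (σ t)) (g : List (Joint k) → ℝ) (n : ℕ) (α : List (Joint k))
    (hα : α.length + n ≤ 2 ^ c) :
    avg (n * (N + N)) (fun u => ∑ h ∈ Finset.range n, g (simHist N σ t α u h)) =
      ES (devDist σ 2 t) g n α := by
  induction n generalizing α with
  | zero => simp [avg, ES]
  | succ n ih =>
    rw [show (n + 1) * (N + N) = (N + N) + n * (N + N) by ring, avg_add, ES]
    have h1 : ∀ u : List Bool, u.length = N + N → avg (n * (N + N)) (fun v =>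
        ∑ h ∈ Finset.range (n + 1), g (simHist N σ t α (u ++ v) h)) =
        g α + ES (devDist σ 2 t) g n (nextJoint N σ t α u :: α) := by
      intro u hu
      rw [← ih (nextJoint N σ t α u :: α) (by simp; omega)]
      conv_rhs => rw [← avg_const (n * (N + N)) (g α), ← avg_add_fun]
      refine avg_congr fun v _ => ?_
      rw [Finset.sum_range_succ', add_comm]
      simp only [simHist_append N σ t α v hu]
      rfl
    rw [avg_congr h1, avg_add_fun, avg_const]
    congr 1
    exact avg_nextJoint hd (by omega) fun a => ES (devDist σ 2 t) g n (a :: α)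

/-- Some step of the simulation of a trial leads to an approximate Nash equilibrium. -/
def Success (N : ℕ) (σ : Fin T → (game M hk hkc).Profile) (r : ℝ) (u : List Bool) : Prop :=
  ∃ t, ∃ h < 2 ^ c, topUtil (σ t) 2 (simHist N σ t [] u h) ≤ r

open Classical in
-- Markov's inequality: in a failed trial all T·H gaps exceed r, while their expected sum is at most
-- 11ε·T·H. Within a trial the same coins are used for every profile, which is harmless because only
-- expectations are added.
theorem avg_fail_le (hM : ∀ i a, HasBits k (M.M i a)) (hT : 0 < T) {N : ℕ}
    {σ : Fin T → (game M hk hkc).Profile} (hd : ∀ t, Dyadic N (σ t)) {ε r : ℝ} (hε : 0 < ε)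
    (hε1 : ε ≤ 1) (hcce : (game M hk hkc).IsMixCCE ε σ)
    (hlog : Real.log T ≤ ε ^ 2 / 8 * 2 ^ c) (hsmall : 3 / 2 ^ (k + 1) ≤ ε / 4)
    (hr : 49 * ε ≤ r) :
    avg (2 ^ c * (N + N)) (fun u => if Success N σ r u then 0 else 1) ≤ 11 / 49 := by
  have hrpos : 0 < r := by linarith
  have hTH : (0 : ℝ) < T * 2 ^ c := by
    have : (0 : ℝ) < T := by exact_mod_cast hT
    positivity
  have h1 : avg (2 ^ c * (N + N)) (fun u => ∑ t, ∑ h ∈ Finset.range (2 ^ c),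
      topUtil (σ t) 2 (simHist N σ t [] u h)) ≤ T * 2 ^ c * (11 * ε) := by
    rw [avg_sum]
    refine le_trans (le_of_eq ?_) (sum_topUtil_le hM hT σ hε hε1 hcce hlog hsmall)
    exact Finset.sum_congr rfl fun t _ => avg_simHist (hd t) (topUtil (σ t) 2) _ [] (by simp)
  have h2 : avg (2 ^ c * (N + N)) (fun u => T * 2 ^ c * r * (if Success N σ r u then 0 else 1)) ≤
      avg (2 ^ c * (N + N)) (fun u => ∑ t, ∑ h ∈ Finset.range (2 ^ c),
      topUtil (σ t) 2 (simHist N σ t [] u h)) := by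
    refine avg_mono fun u _ => ?_
    split_ifs with hs
    · rw [mul_zero]
      exact Finset.sum_nonneg fun t _ => Finset.sum_nonneg fun h _ => topUtil_two_nonneg _ _
    · have : ∀ t, ∀ h ∈ Finset.range (2 ^ c), r ≤ topUtil (σ t) 2 (simHist N σ t [] u h) := by
        intro t h hh
        by_contra hlt
        exact hs ⟨t, h, Finset.mem_range.1 hh, (not_le.1 hlt).le⟩
      calc T * 2 ^ c * r * 1 = ∑ t : Fin T, ∑ h ∈ Finset.range (2 ^ c), r := by
            simp; ring
        _ ≤ _ := Finset.sum_le_sum fun t _ => Finset.sum_le_sum (this t)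
  rw [avg_mul_left] at h2
  have h3 := h2.trans h1
  rw [mul_assoc] at h3
  have h4 := le_of_mul_le_mul_left h3 hTH
  set p := avg (2 ^ c * (N + N)) (fun u => if Success N σ r u then (0 : ℝ) else 1)
  have hp0 : 0 ≤ p := by
    have := avg_mono (K := 2 ^ c * (N + N)) (F := fun _ => (0 : ℝ))
      (G := fun u => if Success N σ r u then (0 : ℝ) else 1) fun u _ => by split_ifs <;> norm_num
    rwa [avg_const] at this
  have h5 : 49 * ε * p ≤ 11 * ε := (mul_le_mul_of_nonneg_right hr hp0).trans h4
  nlinarith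

open Classical in
/-- All trials of `l` independent ones fail with probability at most `exp (-l)`. -/
theorem avg_all_fail_le (hM : ∀ i a, HasBits k (M.M i a)) (hT : 0 < T) {N : ℕ}
    {σ : Fin T → (game M hk hkc).Profile} (hd : ∀ t, Dyadic N (σ t)) {ε r : ℝ} (hε : 0 < ε)
    (hε1 : ε ≤ 1) (hcce : (game M hk hkc).IsMixCCE ε σ)
    (hlog : Real.log T ≤ ε ^ 2 / 8 * 2 ^ c) (hsmall : 3 / 2 ^ (k + 1) ≤ ε / 4)
    (hr : 49 * ε ≤ r) (l : ℕ) :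
    avg (l * (2 ^ c * (N + N))) (fun w => if ∃ i < l, Success N σ r
      ((w.drop (i * (2 ^ c * (N + N)))).take (2 ^ c * (N + N))) then 0 else 1) ≤
      Real.exp (-l) := by
  have h1 := avg_prod (2 ^ c * (N + N)) l fun u => if Success N σ r u then (0 : ℝ) else 1
  have h2 : avg (l * (2 ^ c * (N + N))) (fun w => if ∃ i < l, Success N σ r
      ((w.drop (i * (2 ^ c * (N + N)))).take (2 ^ c * (N + N))) then (0 : ℝ) else 1) =
      avg (l * (2 ^ c * (N + N))) (fun w => ∏ i ∈ Finset.range l, if Success N σ r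
        ((w.drop (i * (2 ^ c * (N + N)))).take (2 ^ c * (N + N))) then (0 : ℝ) else 1) := by
    refine avg_congr fun w _ => ?_
    split_ifs with h
    · obtain ⟨i, hi, hs⟩ := h
      exact (Finset.prod_eq_zero (Finset.mem_range.2 hi) (by rw [if_pos hs])).symm
    · refine (Finset.prod_eq_one fun i hi => ?_).symm
      rw [if_neg fun hs => h ⟨i, Finset.mem_range.1 hi, hs⟩]
  rw [h2, h1, show (-l : ℝ) = l * (-1) by ring, Real.exp_nat_mul]
  refine pow_le_pow_left₀ ?_ ?_ l
  · have := avg_mono (K := 2 ^ c * (N + N)) (F := fun _ => (0 : ℝ))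
      (G := fun u => if Success N σ r u then (0 : ℝ) else 1) fun u _ => by split_ifs <;> norm_num
    rwa [avg_const] at this
  · refine (avg_fail_le hM hT hd hε hε1 hcce hlog hsmall hr).trans ?_
    -- It suffices that e ≤ 49/11.
    rw [Real.exp_neg, le_inv_comm₀ (by norm_num) (Real.exp_pos 1)]
    have := Real.exp_one_lt_d9
    norm_num
    linarith

end


/-! ## The reduction as a polynomial-time computation -/

theorem sum_fin_indicator (n m : ℕ) (h : m ≤ n) : ∑ j : Fin n, (if (j : ℕ) < m then 1 else 0) = m := by
  rw [Fin.sum_univ_eq_sum_range (fun j => if j < m then 1 else 0) n, ← Finset.sum_filter,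
    Finset.sum_const, smul_eq_mul, mul_one]
  have : (Finset.range n).filter (· < m) = Finset.range m := by
    ext j; simp; omega
  rw [this, Finset.card_range]

/-- The logarithm counts powers of two, and counting is a sum of indicators, for which there is
already a program. -/
theorem log_eq_sum (n : ℕ) : Nat.log 2 n = ∑ j : Fin n, if 2 ^ ((j : ℕ) + 1) < n + 1 then 1 else 0 := by
  rw [← sum_fin_indicator n (Nat.log 2 n) (Nat.log_le_self 2 n)]
  refine Finset.sum_congr rfl fun j _ => if_congr ?_ rfl rfl
  rw [Nat.lt_succ_iff, ← Nat.le_log_iff_pow_le one_lt_two (by have := j.2; omega)]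
  rfl

theorem clog_eq_sum (n : ℕ) : Nat.clog 2 n = ∑ j : Fin n, if 2 ^ (j : ℕ) < n then 1 else 0 := by
  rw [← sum_fin_indicator n (Nat.clog 2 n) (Nat.clog_le_of_le_pow Nat.lt_two_pow_self.le)]
  exact Finset.sum_congr rfl fun j _ => if_congr (Nat.lt_clog_iff_pow_lt one_lt_two) rfl rfl

section

variable {X Y : Type} {s : X → ℕ} {f : X → Val}

theorem Comp.single {g : X → Val} (h : Comp s f g) : Comp s f fun x => .ofList [g x] :=
  h.pair (.const 0)

theorem CompN.log {u : X → ℕ} (hu : CompN s f u) (bu : PolyBdd s u) :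
    CompN s f fun x => Nat.log 2 (u x) := by
  refine (CompN.sum hu bu fun f' hj W => ?_).congr fun x => (log_eq_sum (u x)).symm
  exact .ite_lt (.two_pow (hj.add (.const 1))
    (((bu.reindex Sigma.fst).add (.const 1)).mono fun y => by have := y.2.2; omega))
    ((W.z hu).add (.const 1)) (.const 1) (.const 0)

theorem CompN.clog {u : X → ℕ} (hu : CompN s f u) (bu : PolyBdd s u) :
    CompN s f fun x => Nat.clog 2 (u x) := by
  refine (CompN.sum hu bu fun f' hj W => ?_).congr fun x => (clog_eq_sum (u x)).symm
  exact .ite_lt (.two_pow hj ((bu.reindex Sigma.fst).mono fun y => y.2.2.le))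
    (W.z hu) (.const 1) (.const 0)

theorem ofBits_take (l : List Bool) (m : ℕ) :
    ofBits (l.take m) = ∑ j : Fin m, (l.getD j false).toNat * 2 ^ (j : ℕ) := by
  induction m generalizing l with
  | zero => simp [ofBits]
  | succ m ih =>
    cases l with
    | nil => simp [ofBits]
    | cons b l =>
      rw [List.take_succ_cons, ofBits, ih, Fin.sum_univ_succ, Finset.mul_sum]
      simp [pow_succ, mul_comm, mul_assoc]

/-- The number in a window of a list of bits. -/
theorem CompN.window {l : X → List Bool} {i m : X → ℕ} (hl : Comp s f fun x => bitsVal (l x))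
    (hi : CompN s f i) (bi : PolyBdd s i) (hm : CompN s f m) (bm : PolyBdd s m) :
    CompN s f fun x => ofBits (((l x).drop (i x)).take (m x)) := by
  refine (CompN.sum hm bm (a := fun x j => ((l x).getD (i x + j) false).toNat * 2 ^ (j : ℕ))
    fun f' hj W => ?_).congr fun x => ?_
  · have bj : PolyBdd (fun y : Σ x, Fin (m x) => s y.1) fun y => (y.2 : ℕ) :=
      (bm.reindex Sigma.fst).mono fun y => y.2.2.le
    exact (CompN.bit (W.comp hl) ((W.z hi).add hj) ((bi.reindex Sigma.fst).add bj)).mul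
      (.two_pow hj bj)
  · rw [ofBits_take]
    refine Finset.sum_congr rfl fun j _ => ?_
    simp [List.getD_eq_getElem?_getD, List.getElem?_drop]

theorem CompZ.natAbs {u : X → ℤ} (hu : CompZ s f u) : CompN s f fun x => (u x).natAbs :=
  (CompZ.ite_lt hu (.const 0) (CompZ.sub (.const 0) hu) hu).congr fun x => by
    dsimp only
    split_ifs <;> omega

theorem Comp.natBits {u m : X → ℕ} (hu : CompN s f u) (hm : CompN s f m) (bm : PolyBdd s m) :
    Comp s f fun x => bitsVal (GenCCE.natBits (m x) (u x)) := by
  refine (Comp.table hm bm (a := fun x j => .ofNat (u x / 2 ^ (j : ℕ) % 2)) fun f' hj W => ?_).congr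
    fun x => ?_
  · exact ((CompN.div (W.z hu) (CompN.two_pow hj ((bm.reindex Sigma.fst).mono fun y => y.2.2.le))).mod
      (.const 2)).comp
  · simp only [Val.table, bitsVal, GenCCE.natBits, List.map_ofFn, bitVal, Function.comp_def,
      Nat.toNat_testBit]

end

/-- An input of the reduction: the parameters and a game in normal form. -/
structure Inst where
  n : ℕ
  T : ℕ
  N : ℕ
  E : ℕ
  l : ℕ
  k : ℕ
  c : ℕ
  M : NormalFormGame 2 k
  hM : ∀ i a, HasBits k (M.M i a)
  hk2 : 2 ≤ k
  E_pos : 0 < E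
  hkn : k = n / 2
  hcn : c = Nat.log 2 n

namespace Inst

variable (I : Inst)

theorem hk : 0 < I.k := by have := I.hk2; omega

theorem n_pos : 0 < I.n := by have := I.hk2; have := I.hkn; omega

theorem two_pow_le : 2 ^ I.c ≤ I.n := by
  rw [I.hcn]; exact Nat.pow_log_le_self 2 I.n_pos.ne'

theorem hkc : I.k < 2 ^ I.c := by
  have h := Nat.lt_pow_succ_log_self one_lt_two I.n
  rw [← I.hcn, pow_succ] at h
  have := I.hkn
  omega

theorem k_le : I.k ≤ I.n := by have := I.hkn; omega

theorem c_le : I.c ≤ I.n := by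
  rw [I.hcn]; exact Nat.log_le_self 2 I.n

/-- The repeated game. -/
noncomputable abbrev G : MarkovGame 3 := game I.M I.hk I.hkc

def size : ℕ := I.n + I.T + I.N + I.E + I.l

noncomputable def input : Val :=
  .pair (.ofList [.ofNat I.n, .ofNat I.T, .ofNat I.N, .ofNat I.E, .ofNat I.l]) I.M.encode

end Inst

/-- The context contains the input `I`. -/
structure Knows {X : Type} (s : X → ℕ) (f : X → Val) (I : X → Inst) : Prop where
  bdd : PolyBdd s fun x => (I x).size
  input : Comp s f fun x => (I x).input

namespace Knows

variable {X Y : Type} {s : X → ℕ} {f : X → Val} {I : X → Inst}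

theorem weak (K : Knows s f I) {π : Y → X} {f' : Y → Val} (W : Weak s f π f') :
    Knows (fun y => s (π y)) f' fun y => I (π y) :=
  ⟨K.bdd.reindex π, W.comp K.input⟩

theorem b_n (K : Knows s f I) : PolyBdd s fun x => (I x).n :=
  K.bdd.mono fun x => by simp only [Inst.size]; omega

theorem b_T (K : Knows s f I) : PolyBdd s fun x => (I x).T :=
  K.bdd.mono fun x => by simp only [Inst.size]; omega

theorem b_N (K : Knows s f I) : PolyBdd s fun x => (I x).N :=
  K.bdd.mono fun x => by simp only [Inst.size]; omega

theorem b_E (K : Knows s f I) : PolyBdd s fun x => (I x).E :=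
  K.bdd.mono fun x => by simp only [Inst.size]; omega

theorem b_l (K : Knows s f I) : PolyBdd s fun x => (I x).l :=
  K.bdd.mono fun x => by simp only [Inst.size]; omega

theorem b_k (K : Knows s f I) : PolyBdd s fun x => (I x).k := K.b_n.mono fun x => (I x).k_le

theorem b_c (K : Knows s f I) : PolyBdd s fun x => (I x).c := K.b_n.mono fun x => (I x).c_le

theorem b_H (K : Knows s f I) : PolyBdd s fun x => 2 ^ (I x).c :=
  K.b_n.mono fun x => (I x).two_pow_le

theorem n (K : Knows s f I) : CompN s f fun x => (I x).n := .of_comp K.input.fst.fst K.b_n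

theorem T (K : Knows s f I) : CompN s f fun x => (I x).T := .of_comp K.input.fst.snd.fst K.b_T

theorem N (K : Knows s f I) : CompN s f fun x => (I x).N := .of_comp K.input.fst.snd.snd.fst K.b_N

theorem E (K : Knows s f I) : CompN s f fun x => (I x).E :=
  .of_comp K.input.fst.snd.snd.snd.fst K.b_E

theorem l (K : Knows s f I) : CompN s f fun x => (I x).l :=
  .of_comp K.input.fst.snd.snd.snd.snd.fst K.b_l

theorem k (K : Knows s f I) : CompN s f fun x => (I x).k :=
  .of_comp K.input.snd.fst K.b_k

theorem c (K : Knows s f I) : CompN s f fun x => (I x).c :=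
  (CompN.log K.n K.b_n).congr fun x => (I x).hcn.symm

theorem H (K : Knows s f I) : CompN s f fun x => 2 ^ (I x).c := .two_pow K.c K.b_c

theorem b_fin (K : Knows s f I) (x : ∀ a, Fin (I a).k) : PolyBdd s fun a => (x a : ℕ) :=
  K.b_k.mono fun a => (x a).2.le

variable {x y : ∀ a, Fin (I a).k} {z : ∀ a, Fin (2 * (I a).k)} {i : X → Fin 3}

theorem payZ (K : Knows s f I) (i : Fin 2) (hx : CompN s f fun a => (x a : ℕ))
    (hy : CompN s f fun a => (y a : ℕ)) : CompZ s f fun a => payZ (I a).M i (x a) (y a) := by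
  refine ⟨?_, (K.b_k.add (.const 1)).mono fun a => ?_⟩
  · have hT : Comp s f fun a => .table fun j : Fin ((I a).k ^ 2) =>
        .int (GenCCE.payZ (I a).M i ⟨j % (I a).k, Nat.mod_lt _ (I a).hk⟩
          ⟨j / (I a).k, Nat.div_lt_of_lt_mul (by rw [← sq]; exact j.2)⟩) := by
      have h := K.input.snd.congr fun a => show (I a).input.snd = _ from encode_eq (hk := (I a).hk) (I a).hk2
      have h' := Comp.get (i := fun _ => i) h.snd (.const i) (.const i)
      exact h'
    have hlt : ∀ a, (x a : ℕ) + y a * (I a).k < (I a).k ^ 2 := fun a => by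
      have h1 := (x a).2
      have h2 := (y a).2
      calc (x a : ℕ) + y a * (I a).k < (I a).k + y a * (I a).k := by omega
        _ = (y a + 1) * (I a).k := by ring
        _ ≤ (I a).k * (I a).k := Nat.mul_le_mul_right _ h2
        _ = _ := (sq _).symm
    refine (Comp.get (i := fun a => ⟨(x a : ℕ) + y a * (I a).k, hlt a⟩) hT (hx.add (hy.mul K.k))
      ((K.b_fin x).add ((K.b_fin y).mul K.b_k))).congr fun a => ?_
    have h1 : ((x a : ℕ) + y a * (I a).k) % (I a).k = x a := by
      rw [Nat.add_mul_mod_self_right, Nat.mod_eq_of_lt (x a).2]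
    have h2 : ((x a : ℕ) + y a * (I a).k) / (I a).k = y a := by
      rw [Nat.add_mul_div_right _ _ (I a).hk, Nat.div_eq_of_lt (x a).2, zero_add]
    simp only [h1, h2, Fin.eta]
  · have h := (I a).M.M_mem i ![x a, y a]
    have h0 : 0 ≤ GenCCE.payZ (I a).M i (x a) (y a) :=
      Int.floor_nonneg.2 (mul_nonneg h.1 (by positivity))
    have h1 : (GenCCE.payZ (I a).M i (x a) (y a) : ℝ) ≤ 2 ^ (I a).k :=
      (Int.floor_le _).trans (mul_le_of_le_one_left (by positivity) h.2)
    have h2 : (GenCCE.payZ (I a).M i (x a) (y a)).natAbs ≤ 2 ^ (I a).k := by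
      have : GenCCE.payZ (I a).M i (x a) (y a) ≤ 2 ^ (I a).k := by exact_mod_cast h1
      zify
      rwa [abs_of_nonneg h0]
    exact Nat.size_le.2 (h2.trans_lt (Nat.pow_lt_pow_right one_lt_two (Nat.lt_succ_self _)))

theorem devZ (K : Knows s f I) (hx : CompN s f fun a => (x a : ℕ))
    (hy : CompN s f fun a => (y a : ℕ)) (hz : CompN s f fun a => (z a : ℕ)) :
    CompZ s f fun a => devZ (I a).M (x a) (y a) (z a) := by
  have hm : CompN s f fun a => ((z a).modNat : ℕ) := (hz.mod K.k).congr fun a => rfl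
  refine (CompZ.ite_lt hz K.k (CompZ.sub (K.payZ 0 hm hy) (K.payZ 0 hx hy))
    (CompZ.sub (K.payZ 1 hx hm) (K.payZ 1 hx hy))).congr fun a => ?_
  simp only [GenCCE.devZ, Nat.cast_lt]

theorem stageZ (K : Knows s f I) (hi : CompN s f fun a => (i a : ℕ))
    (hx : CompN s f fun a => (x a : ℕ)) (hy : CompN s f fun a => (y a : ℕ))
    (hz : CompN s f fun a => (z a : ℕ)) :
    CompZ s f fun a => stageZ (I a).M (i a) (x a) (y a) (z a) := by
  have hd := K.devZ hx hy hz
  have hq := hz.div K.k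
  refine (CompZ.ite_lt hi (.const 2) (CompZ.ite_lt hq hi (.const 0) (CompZ.ite_lt hi hq (.const 0)
    (CompZ.sub (.const 0) hd))) hd).congr fun a => ?_
  simp only [GenCCE.stageZ, ← Nat.cast_ofNat (R := ℤ) (n := 2), Nat.cast_lt]

theorem rewZ (K : Knows s f I) (hi : CompN s f fun a => (i a : ℕ))
    (hx : CompN s f fun a => (x a : ℕ)) (hy : CompN s f fun a => (y a : ℕ))
    (hz : CompN s f fun a => (z a : ℕ)) :
    CompZ s f fun a => rewZ (I a).M (I a).c (i a) (joint (x a) (y a) (z a)) := by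
  have h2 : CompN s f fun a => 2 ^ (3 * (I a).c + 1) :=
    .two_pow (((CompN.const 3).mul K.c).add (.const 1))
      (((PolyBdd.const 3).mul K.b_c).add (.const 1))
  refine (CompZ.add (CompZ.mul (K.stageZ hi hx hy hz) h2)
    ((hx.add (hy.mul K.k)).add (hz.mul (K.k.mul K.k)))).congr fun a => ?_
  rw [rewZ_joint (I a).hM]
  push_cast
  rfl

theorem rewZ_ofCode (K : Knows s f I) (hi : CompN s f fun a => (i a : ℕ))
    {j : ∀ a, Fin ((I a).k * (I a).k * (2 * (I a).k))} (hj : CompN s f fun a => (j a : ℕ)) :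
    CompZ s f fun a => GenCCE.rewZ (I a).M (I a).c (i a) (ofCode (j a)) :=
  K.rewZ (i := i) (x := fun a => ⟨j a % (I a).k, Nat.mod_lt _ (I a).hk⟩)
    (y := fun a => ⟨j a / (I a).k % (I a).k, Nat.mod_lt _ (I a).hk⟩)
    (z := fun a => ⟨j a / ((I a).k * (I a).k), Nat.div_lt_of_lt_mul (j a).2⟩) hi
    (hj.mod K.k) ((hj.div K.k).mod K.k) (hj.div (K.k.mul K.k))

theorem encode (K : Knows s f I) : Comp s f fun a => (I a).G.encode := by
  have hp : CompN s f fun a => (I a).k + 4 * (I a).c + 2 :=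
    (K.k.add ((CompN.const 4).mul K.c)).add (.const 2)
  have bp : PolyBdd s fun a => (I a).k + 4 * (I a).c + 2 :=
    (K.b_k.add ((PolyBdd.const 4).mul K.b_c)).add (.const 2)
  have h1 : Comp s f fun a => Val.int (2 ^ ((I a).k + 4 * (I a).c + 2)) :=
    (CompN.two_pow hp bp).comp.congr fun a => by push_cast; rfl
  have hJ : CompN s f fun a => (I a).k * (I a).k * (2 * (I a).k) :=
    (K.k.mul K.k).mul ((CompN.const 2).mul K.k)
  have bJ : PolyBdd s fun a => (I a).k * (I a).k * (2 * (I a).k) :=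
    (K.b_k.mul K.b_k).mul ((PolyBdd.const 2).mul K.b_k)
  have nil : Comp s f fun _ => Val.ofList [] := .const 0
  have tP : Comp s f fun a => Val.table fun _ : Fin (2 ^ (I a).c) => .ofList
      [.table fun _ : Fin ((I a).k * (I a).k * (2 * (I a).k)) =>
        .ofList [.int (2 ^ ((I a).k + 4 * (I a).c + 2))]] :=
    Comp.table K.H K.b_H fun f' _ W => W.comp (Comp.single (Comp.table hJ bJ
      (a := fun a _ => .ofList [.int (2 ^ ((I a).k + 4 * (I a).c + 2))])
      fun f' _ W => W.comp (Comp.single h1)))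
  have tR : Comp s f fun a => Val.table fun i : Fin 3 => .table fun _ : Fin (2 ^ (I a).c) => .ofList
      [.table fun j : Fin ((I a).k * (I a).k * (2 * (I a).k)) =>
        .int (GenCCE.rewZ (I a).M (I a).c i (ofCode j))] := by
    refine Comp.table (m := fun _ => 3) (.const 3) (.const 3) fun f' hi W => ?_
    refine Comp.table (W.z K.H) (K.b_H.reindex Sigma.fst) fun f'' _ W' => Comp.single ?_
    refine Comp.table (W'.z (W.z hJ)) ((bJ.reindex Sigma.fst).reindex Sigma.fst)
      fun f₃ hj W₃ => ?_
    have K₃ := ((K.weak W).weak W').weak W₃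
    exact (K₃.rewZ_ofCode (W₃.z (W'.z hi)) hj).comp
  refine Comp.congr (Comp.pair (.const 1) (K.H.comp.pair ((K.k.comp.pair (K.k.comp.pair
    (((CompN.const 2).mul K.k).comp.pair nil))).pair (hp.comp.pair ((h1.pair nil).pair
      (tP.pair (tR.pair nil))))))) fun a => ?_
  rw [Inst.G, game_encode (I a).hM (I a).hk2]
  rfl

end Knows


/-! ### Dyadic probabilities read off from circuits -/

theorem floor_dyadic {m L N : ℕ} (h : L ≤ N) : ⌊((m : ℝ) / 2 ^ L) * 2 ^ N⌋₊ = m * 2 ^ (N - L) := by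
  obtain ⟨d, rfl⟩ := Nat.exists_eq_add_of_le h
  have : ((m : ℝ) / 2 ^ L) * 2 ^ (L + d) = ((m * 2 ^ d : ℕ) : ℝ) := by
    push_cast; rw [pow_add]; field_simp
  rw [this, Nat.floor_natCast, Nat.add_sub_cancel_left]

theorem eq_floor_dyadic {m L N : ℕ} (h : L ≤ N) :
    (m : ℝ) / 2 ^ L = ⌊((m : ℝ) / 2 ^ L) * 2 ^ N⌋₊ / 2 ^ N := by
  rw [floor_dyadic h]
  obtain ⟨d, rfl⟩ := Nat.exists_eq_add_of_le h
  rw [Nat.add_sub_cancel_left, pow_add]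
  push_cast
  field_simp

/-- There are k(L + 1) distinct output vertices. Consequently 2 ^ N is a common denominator of all
probabilities, although each circuit chooses its own L. -/
theorem digits_le {c : Circuit} {k L N : ℕ} (hwf : c.WellFormed) (hsize : c.size ≤ N) (hk : 0 < k)
    (hout : c.outputs.length = k * (L + 1)) : L + 1 ≤ N := by
  have h1 := hwf.outputs_length_le
  have h2 : L + 1 ≤ k * (L + 1) := Nat.le_mul_of_pos_left _ hk
  omega

section

variable {X Y : Type} {s : X → ℕ} {f : X → Val}

/-- Probabilities that are computed by circuits. -/
theorem CompN.prob {c : X → Circuit} {l : X → List Bool} {N k L : X → ℕ} {a : ∀ x, Fin (k x)}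
    {p : X → ℝ} (hc : Comp s f fun x => (c x).encode) (hl : Comp s f fun x => bitsVal (l x))
    (hN : CompN s f N) (bN : PolyBdd s N) (hk : CompN s f k) (hsize : ∀ x, (c x).size ≤ N x)
    (hwf : ∀ x, (c x).WellFormed) (hlen : ∀ x, (l x).length = (c x).inputs)
    (hout : ∀ x, (c x).outputs.length = k x * (L x + 1)) (ha : CompN s f fun x => (a x : ℕ))
    (hp : ∀ x, p x = (ofBits ((((c x).eval (l x)).drop (a x * (L x + 1))).take (L x + 1)) : ℝ) /
      2 ^ L x) :
    CompN s f fun x => ⌊p x * 2 ^ N x⌋₊ := by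
  have hk0 : ∀ x, 0 < k x := fun x => (a x).pos
  have hL := fun x => digits_le (hwf x) (hsize x) (hk0 x) (hout x)
  have hv := Comp.circuitEval hc hl hN bN hsize hwf hlen
  have hn : CompN s f fun x => ((c x).eval (l x)).length :=
    (CompN.length hv hN bN fun x => by
      simpa [Circuit.eval] using (hwf x).outputs_length_le.trans (hsize x)).congr fun x => by simp
  -- The number of digits is not part of the description of a circuit; it is recovered by dividing
  -- the number of outputs by the number of actions.
  have hL1 : CompN s f fun x => L x + 1 := (hn.div hk).congr fun x => by
    rw [Circuit.eval, List.length_map, hout, Nat.mul_div_cancel_left _ (hk0 x)]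
  have bL1 := bN.mono hL
  have bo : PolyBdd s fun x => (a x : ℕ) * (L x + 1) := bN.mono fun x => by
    have h1 := (hwf x).outputs_length_le
    have h2 := hsize x
    have h3 := Nat.mul_le_mul_right (L x + 1) (a x).2.le
    rw [hout] at h1
    omega
  have hw := CompN.window hv (ha.mul hL1) bo hL1 bL1
  have hs : CompN s f fun x => N x + 1 - (L x + 1) :=
    CompN.sub (hN.add (.const 1)) hL1 fun x => (hL x).trans (Nat.le_succ _)
  refine (hw.mul (.two_pow hs ((bN.add (.const 1)).mono fun x => Nat.sub_le _ _))).congr fun x => ?_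
  rw [hp, floor_dyadic (by have := hL x; omega), Nat.add_sub_add_right]

theorem CompN.pickFin {k : X → ℕ} (hk : CompN s f k) (bk : PolyBdd s k) (h0 : ∀ x, 0 < k x)
    {P : ∀ x, Fin (k x) → ℕ} {r : X → ℕ} (hr : CompN s f r)
    (body : ∀ f' : (Σ x, Fin (k x)) → Val, CompN (fun y => s y.1) f' (fun y => y.2) →
      Weak s f Sigma.fst f' → CompN (fun y => s y.1) f' fun y => P y.1 y.2) :
    CompN s f fun x => (GenCCE.pickFin (h0 x) (P x) (r x) : ℕ) := by
  have hid : Comp (fun y : Σ x, Fin (k x) => s y.1)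
    (fun y => Val.pair (.ofNat y.2) (f y.1)) (fun y => Val.pair (.ofNat y.2) (f y.1)) := .id
  have bP := (body (fun y => .pair (.ofNat y.2) (f y.1)) (.of_comp hid.fst
    ((bk.reindex Sigma.fst).mono fun y => y.2.2.le)) (.of_snd hid.snd)).bdd
  have hT : Comp s f fun x => .table fun j => .ofNat (P x j) :=
    Comp.table hk bk fun f' hj W => (body f' hj W).comp
  refine .of_comp ?_ (bk.mono fun x => (GenCCE.pickFin (h0 x) (P x) (r x)).2.le)
  have hm : CompN s f fun x => k x - 1 := CompN.sub hk (.const 1) h0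
  have bm : PolyBdd s fun x => k x - 1 := bk.mono fun x => Nat.sub_le _ _
  refine Comp.forLoop (acc := fun x j => .ofNat (pick (extend (P x)) j (r x))) hm bm (.const 0) ?_
  intro f' hj ha W
  have bj : PolyBdd (fun y : Σ x, Fin (k x - 1) => s y.1) fun y => (y.2 : ℕ) + 1 :=
    (bk.reindex Sigma.fst).mono fun y => by have := y.2.2; have := h0 y.1; omega
  have hsum : CompN (fun y : Σ x, Fin (k x - 1) => s y.1) f'
      fun y => ∑ i : Fin (y.2 + 1), extend (P y.1) i := by
    refine CompN.sum (hj.add (.const 1)) bj fun f'' hi W' => ?_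
    have hlt : ∀ z : Σ y : (Σ x, Fin (k x - 1)), Fin (y.2 + 1), (z.2 : ℕ) < k z.1.1 := fun z => by
      have := z.2.2; have := z.1.2.2; have := h0 z.1.1; omega
    refine CompN.congr (u := fun z => P z.1.1 ⟨z.2, hlt z⟩) ⟨?_, ?_⟩ fun z => ?_
    · exact Comp.get (a := fun z : (Σ y : (Σ x, Fin (k x - 1)), Fin (y.2 + 1)) =>
        fun j => .ofNat (P z.1.1 j)) (i := fun z => ⟨z.2, hlt z⟩) (W'.comp (W.comp hT)) hi
        ((bj.reindex Sigma.fst).mono fun z => z.2.2.le)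
    · exact bP.reindex fun z : (Σ y : (Σ x, Fin (k x - 1)), Fin (y.2 + 1)) =>
        (⟨z.1.1, ⟨z.2, hlt z⟩⟩ : Σ x, Fin (k x))
    · simp [extend, hlt z]
  have hsum' := hsum.congr (u' := fun y => ∑ i ∈ Finset.range (y.2 + 1), extend (P y.1) i)
    fun y => (Finset.sum_range _).symm
  refine (Comp.ite_lt (W.z hr) hsum' ha (hj.add (.const 1)).comp).congr fun y => ?_
  simp only [pick, Nat.cast_lt]
  split_ifs <;> rfl

end

/-! ### Histories as inputs of circuits -/

namespace Inst

variable (I : Inst)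

/-- The input of the circuits of player `i` after the history `α`. -/
noncomputable def hbits (i : Fin 3) (α : List (Joint I.k)) : List Bool :=
  I.G.inputBits i (hist I.M I.hk I.hkc i α) (0 : Fin 1)

/-- The part of `hbits` that is due to one step. -/
noncomputable def block (i : Fin 3) (a : Joint I.k) : List Bool :=
  natBits (Nat.clog 2 (acts I.k i)) (a i) ++ (decide (rewZ I.M I.c i a < 0) ::
    natBits (I.k + 4 * I.c + 2 + 1) (rewZ I.M I.c i a).natAbs)

/-- A single state is written with no bits at all, so each step contributes one block and a new step
appends a block at the end. -/
theorem hbits_eq (i : Fin 3) (α : List (Joint I.k)) : I.hbits i α = α.reverse.flatMap (I.block i) := by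
  have h0 : ∀ v, natBits (Nat.clog 2 I.G.S) v = [] := fun v => by
    have : Nat.clog 2 I.G.S = 0 := Nat.clog_one_right 2
    rw [this]; rfl
  unfold hbits MarkovGame.inputBits
  rw [h0, List.append_nil, hist, MarkovGame.view, traj, List.map_map,
    List.flatMap_map]
  congr 1
  funext a
  simp only [Function.comp_apply, h0, List.nil_append, game_prec I.hM I.hk2]
  show natBits (Nat.clog 2 (acts I.k i)) (a i) ++ (decide (numer _ (rew I.M I.c i a) < 0) ::
    natBits _ (numer _ (rew I.M I.c i a)).natAbs) = _
  rw [numer_rew I.hM, block]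

theorem hbits_nil (i : Fin 3) : I.hbits i [] = [] := by rw [hbits_eq]; rfl

theorem hbits_cons (i : Fin 3) (a : Joint I.k) (α : List (Joint I.k)) :
    I.hbits i (a :: α) = I.hbits i α ++ I.block i a := by
  simp [hbits_eq]

end Inst

/-! ### The answer of the subroutine in exact integer arithmetic -/

/-- An input of the reduction together with the answer of the subroutine and coin tosses. -/
structure Sol extends Inst where
  σ : Fin T → toInst.G.Profile
  C : Fin T → Fin 3 → Fin (2 ^ c) → Circuit
  hC : ∀ t, toInst.G.ComputedBy N (C t) (σ t)
  w : List Bool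

namespace Sol

variable (J : Sol)

/-- Circuits have to be right only on histories of the proper length whose rewards have the proper
range and precision; histories of actual play are of this kind. -/
theorem prob (t : Fin J.T) (i : Fin 3) {α : List (Joint J.k)} (hα : α.length < 2 ^ J.c) :
    ∃ L, (J.C t i ⟨α.length, hα⟩).outputs.length = acts J.k i * (L + 1) ∧
      (J.hbits i α).length = (J.C t i ⟨α.length, hα⟩).inputs ∧
      ∀ a, (mixed (J.σ t) i α).1 a = (ofBits ((((J.C t i ⟨α.length, hα⟩).eval
        (J.hbits i α)).drop (a * (L + 1))).take (L + 1)) : ℝ) / 2 ^ L := by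
  obtain ⟨_, _, L, hL, h⟩ := J.hC t i ⟨α.length, hα⟩
  have h1 := h (hist J.M J.hk J.hkc i α) (0 : Fin 1)
    (by simp [hist, MarkovGame.view, traj]) (fun x hx => by
      simp only [hist, MarkovGame.view, traj, List.map_map, List.mem_map] at hx
      obtain ⟨a, _, rfl⟩ := hx
      refine ⟨(game J.M J.hk J.hkc).R_bound i ⟨0, Nat.two_pow_pos _⟩ (0 : Fin 1) a, ?_⟩
      rw [game_prec J.hM J.hk2]
      exact ⟨_, rew_eq J.hM J.c i a⟩)
  exact ⟨L, hL, h1.1, h1.2⟩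

theorem wf (t : Fin J.T) (i : Fin 3) (h : Fin (2 ^ J.c)) : (J.C t i h).WellFormed := (J.hC t i h).1

theorem csize (t : Fin J.T) (i : Fin 3) (h : Fin (2 ^ J.c)) : (J.C t i h).size ≤ J.N :=
  (J.hC t i h).2.1

theorem dyadic (t : Fin J.T) : Dyadic J.N (J.σ t) := by
  constructor
  · intro α hα a
    obtain ⟨L, h1, _, h3⟩ := J.prob t 0 hα
    have hL := digits_le (J.wf t 0 _) (J.csize t 0 _) (acts_pos J.hk 0) h1
    have := h3 a
    rw [numA, mixA, this]
    exact eq_floor_dyadic (by omega)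
  · intro α hα a
    obtain ⟨L, h1, _, h3⟩ := J.prob t 1 hα
    have hL := digits_le (J.wf t 1 _) (J.csize t 1 _) (acts_pos J.hk 1) h1
    have := h3 a
    rw [numB, mixB, this]
    exact eq_floor_dyadic (by omega)

noncomputable def answer : Val :=
  .table fun t => .table fun i => .table fun h => (J.C t i h).encode

noncomputable def input : Val :=
  .pair J.toInst.input (.pair (bitsVal J.w) J.answer)

/-- The numerator of the likelihood of the history against profile `t`. -/
noncomputable def wt (t : Fin J.T) : List (Joint J.k) → ℕ
  | [] => 1
  | a :: α => wt t α * (numA J.N (J.σ t) α (a 0) * numB J.N (J.σ t) α (a 1))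

/-- The numerator of the utility of the third player's action `z` against profile `t`. -/
noncomputable def utilZ (t : Fin J.T) (α : List (Joint J.k)) (z : Fin (2 * J.k)) : ℤ :=
  ∑ x, ∑ y, (numA J.N (J.σ t) α x : ℤ) * numB J.N (J.σ t) α y * devZ J.M x y z

theorem like_eq (t : Fin J.T) {α : List (Joint J.k)} (hα : α.length ≤ 2 ^ J.c) :
    like (opp (J.σ t) 2) α = J.wt t α / 2 ^ (α.length * (J.N + J.N)) := by
  induction α with
  | nil => simp [like, wt]
  | cons a α ih =>
    rw [List.length_cons] at hα
    obtain ⟨x, y, z, rfl⟩ : ∃ x y z, a = joint x y z := ⟨_, _, _, (joint_eta a).symm⟩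
    have e : J.wt t (joint x y z :: α) =
        J.wt t α * (numA J.N (J.σ t) α x * numB J.N (J.σ t) α y) := rfl
    rw [like, ih (by omega), opp_two, (J.dyadic t).A α (by omega), (J.dyadic t).B α (by omega), e,
      List.length_cons]
    push_cast
    rw [show (α.length + 1) * (J.N + J.N) = α.length * (J.N + J.N) + J.N + J.N by ring,
      pow_add, pow_add]
    field_simp

theorem util_eq (t : Fin J.T) {α : List (Joint J.k)} (hα : α.length < 2 ^ J.c)
    (z : Fin (2 * J.k)) : util (J.σ t) 2 α z = J.utilZ t α z / 2 ^ (J.N + J.N + J.k) := by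
  refine (util_two (J.σ t) α z).trans ?_
  rw [utilZ]
  push_cast
  rw [Finset.sum_div]
  refine Finset.sum_congr rfl fun x _ => ?_
  rw [Finset.sum_div]
  refine Finset.sum_congr rfl fun y _ => ?_
  rw [(J.dyadic t).A α hα, (J.dyadic t).B α hα, dev_eq J.hM, pow_add, pow_add]
  field_simp

theorem two_k_pos : 0 < 2 * J.k := Nat.mul_pos two_pos J.hk

/-- The denominators depend neither on the profile nor on the action, so that integers decide all
comparisons. -/
theorem bayesAct_eq {α : List (Joint J.k)} (hα : α.length < 2 ^ J.c) :
    bayesAct J.σ 2 α = best J.two_k_pos fun z => ∑ t, (J.wt t α : ℤ) * J.utilZ t α z := by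
  refine best_congr (m := 2 * J.k) J.two_k_pos fun z z' => ?_
  have h : ∀ z : Fin (2 * J.k), ∑ t, like (opp (J.σ t) 2) α * util (J.σ t) 2 α z =
      ((∑ t, (J.wt t α : ℤ) * J.utilZ t α z : ℤ) : ℝ) /
        (2 ^ (α.length * (J.N + J.N)) * 2 ^ (J.N + J.N + J.k)) := fun z => by
    push_cast
    rw [Finset.sum_div]
    refine Finset.sum_congr rfl fun t _ => ?_
    rw [J.like_eq t hα.le, J.util_eq t hα]
    field_simp
  have h1 := h z
  have h2 := h z'
  refine (iff_of_eq (congrArg₂ (· < ·) h1 h2)).trans ?_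
  rw [div_lt_div_iff_of_pos_right (by positivity), Int.cast_lt]

theorem topUtil_eq (t : Fin J.T) {α : List (Joint J.k)} (hα : α.length < 2 ^ J.c) :
    topUtil (J.σ t) 2 α =
      J.utilZ t α (best J.two_k_pos (J.utilZ t α)) / 2 ^ (J.N + J.N + J.k) := by
  have h : best (acts_pos J.hk 2) (util (J.σ t) 2 α) = best J.two_k_pos (J.utilZ t α) := by
    refine best_congr (m := 2 * J.k) J.two_k_pos fun z z' => ?_
    refine (iff_of_eq (congrArg₂ (· < ·) (J.util_eq t hα z) (J.util_eq t hα z'))).trans ?_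
    rw [div_lt_div_iff_of_pos_right (by positivity), Int.cast_lt]
  rw [topUtil, h]
  exact J.util_eq t hα _

theorem num_le {N k : ℕ} {p : stdSimplex ℝ (Fin k)} (a : Fin k) : ⌊p.1 a * 2 ^ N⌋₊ ≤ 2 ^ N := by
  have h1 : p.1 a ≤ 1 := by
    rw [← p.2.2]; exact Finset.single_le_sum (fun i _ => p.2.1 i) (Finset.mem_univ a)
  refine Nat.floor_le_of_le ?_
  push_cast
  exact mul_le_of_le_one_left (by positivity) h1

theorem wt_le (t : Fin J.T) (α : List (Joint J.k)) : J.wt t α ≤ 2 ^ (α.length * (J.N + J.N)) := by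
  induction α with
  | nil => simp [wt]
  | cons a α ih =>
    rw [wt, List.length_cons, add_mul, pow_add, one_mul, pow_add 2 J.N]
    exact Nat.mul_le_mul ih (Nat.mul_le_mul (num_le _) (num_le _))

/-- What the simulation keeps of a history. -/
noncomputable def state (α : List (Joint J.k)) : Val :=
  .pair (bitsVal (J.hbits 0 α)) (.pair (bitsVal (J.hbits 1 α)) (.table fun t => .ofNat (J.wt t α)))

/-- The product distribution of the first two players as an output. -/
noncomputable def cand (t : Fin J.T) (α : List (Joint J.k)) : Val :=
  .ofList [.pair (.ofNat (2 ^ J.N)) (.table fun a => .ofNat (numA J.N (J.σ t) α a)),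
    .pair (.ofNat (2 ^ J.N)) (.table fun a => .ofNat (numB J.N (J.σ t) α a))]

open Classical in
/-- Replace the output found so far if the present pair of mixed actions passes the test. -/
noncomputable def upd (t : Fin J.T) (α : List (Joint J.k)) (v : Val) : Val :=
  if topUtil (J.σ t) 2 α ≤ 50 / J.E then J.cand t α else v

end Sol


/-- The context contains the input `J`. -/
structure Has {X : Type} (s : X → ℕ) (f : X → Val) (J : X → Sol) : Prop where
  bdd : PolyBdd s fun x => (J x).toInst.size
  input : Comp s f fun x => (J x).input

namespace Has

variable {X Y : Type} {s : X → ℕ} {f : X → Val} {J : X → Sol}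

theorem weak (K : Has s f J) {π : Y → X} {f' : Y → Val} (W : Weak s f π f') :
    Has (fun y => s (π y)) f' fun y => J (π y) :=
  ⟨K.bdd.reindex π, W.comp K.input⟩

theorem knows (K : Has s f J) : Knows s f fun x => (J x).toInst :=
  ⟨K.bdd, K.input.fst⟩

theorem circuit (K : Has s f J) {t : ∀ x, Fin (J x).T} {h : ∀ x, Fin (2 ^ (J x).c)}
    (ht : CompN s f fun x => (t x : ℕ)) (i : Fin 3) (hh : CompN s f fun x => (h x : ℕ)) :
    Comp s f fun x => ((J x).C (t x) i (h x)).encode := by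
  have h1 : Comp s f fun x => .table fun t => .table fun i => .table fun h =>
      ((J x).C t i h).encode := K.input.snd.snd
  have h2 := Comp.get (i := t) h1 ht (K.knows.b_T.mono fun x => (t x).2.le)
  have h3 := Comp.get (i := fun _ => i) h2 (.const i) (.const i)
  exact Comp.get (i := h) h3 hh (K.knows.b_H.mono fun x => (h x).2.le)

theorem window (K : Has s f J) {i m : X → ℕ} (hi : CompN s f i) (bi : PolyBdd s i)
    (hm : CompN s f m) (bm : PolyBdd s m) :
    CompN s f fun x => ofBits (((J x).w.drop (i x)).take (m x)) :=
  .window K.input.snd.fst hi bi hm bm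

end Has

/-- The context contains the input `J` and the state of the simulation after the history `α`. -/
structure At {X : Type} (s : X → ℕ) (f : X → Val) (J : X → Sol)
    (α : ∀ x, List (Joint (J x).k)) : Prop where
  has : Has s f J
  len : CompN s f fun x => (α x).length
  lt : ∀ x, (α x).length < 2 ^ (J x).c
  state : Comp s f fun x => (J x).state (α x)

namespace At

variable {X Y : Type} {s : X → ℕ} {f : X → Val} {J : X → Sol} {α : ∀ x, List (Joint (J x).k)}
  {t : ∀ x, Fin (J x).T} {I : X → Inst}

theorem weak (K : At s f J α) {π : Y → X} {f' : Y → Val} (W : Weak s f π f') :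
    At (fun y => s (π y)) f' (fun y => J (π y)) fun y => α (π y) :=
  ⟨K.has.weak W, W.z K.len, fun y => K.lt (π y), W.comp K.state⟩

theorem numA (K : At s f J α) (ht : CompN s f fun x => (t x : ℕ)) {a : ∀ x, Fin (J x).k}
    (ha : CompN s f fun x => (a x : ℕ)) :
    CompN s f fun x => numA (J x).N ((J x).σ (t x)) (α x) (a x) := by
  choose L h1 h2 h3 using fun x => (J x).prob (t x) 0 (K.lt x)
  have KI := K.has.knows
  exact CompN.prob (c := fun x => (J x).C (t x) 0 ⟨(α x).length, K.lt x⟩)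
    (l := fun x => (J x).hbits 0 (α x)) (a := a) (L := L)
    (K.has.circuit ht 0 (h := fun x => ⟨_, K.lt x⟩) K.len) K.state.fst KI.N KI.b_N KI.k
    (fun x => (J x).csize _ _ _) (fun x => (J x).wf _ _ _) h2 h1 ha fun x => h3 x (a x)

theorem numB (K : At s f J α) (ht : CompN s f fun x => (t x : ℕ)) {a : ∀ x, Fin (J x).k}
    (ha : CompN s f fun x => (a x : ℕ)) :
    CompN s f fun x => numB (J x).N ((J x).σ (t x)) (α x) (a x) := by
  choose L h1 h2 h3 using fun x => (J x).prob (t x) 1 (K.lt x)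
  have KI := K.has.knows
  exact CompN.prob (c := fun x => (J x).C (t x) 1 ⟨(α x).length, K.lt x⟩)
    (l := fun x => (J x).hbits 1 (α x)) (a := a) (L := L)
    (K.has.circuit ht 1 (h := fun x => ⟨_, K.lt x⟩) K.len) K.state.snd.fst KI.N KI.b_N KI.k
    (fun x => (J x).csize _ _ _) (fun x => (J x).wf _ _ _) h2 h1 ha fun x => h3 x (a x)

theorem b_len (K : At s f J α) : PolyBdd s fun x => (α x).length :=
  K.has.knows.b_H.mono fun x => (K.lt x).le

theorem wt (K : At s f J α) (ht : CompN s f fun x => (t x : ℕ)) :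
    CompN s f fun x => (J x).wt (t x) (α x) := by
  have KI := K.has.knows
  refine ⟨Comp.get (a := fun x t => .ofNat ((J x).wt t (α x))) K.state.snd.snd ht
    (KI.b_T.mono fun x => (t x).2.le),
    ((K.b_len.mul (KI.b_N.add KI.b_N)).add (.const 1)).mono fun x => ?_⟩
  rw [Int.natAbs_natCast]
  exact Nat.size_le.2 (((J x).wt_le _ _).trans_lt
    (Nat.pow_lt_pow_right one_lt_two (Nat.lt_succ_self _)))

theorem utilZ (K : At s f J α) (ht : CompN s f fun x => (t x : ℕ)) {z : ∀ x, Fin (2 * (J x).k)}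
    (hz : CompN s f fun x => (z x : ℕ)) :
    CompZ s f fun x => (J x).utilZ (t x) (α x) (z x) := by
  have KI := K.has.knows
  refine CompZ.sum KI.k KI.b_k fun f₁ hx W₁ => ?_
  have KI₁ := KI.weak W₁
  refine CompZ.sum KI₁.k KI₁.b_k fun f₂ hy W₂ => ?_
  have K₂ := (K.weak W₁).weak W₂
  have hx' := W₂.z hx
  have ht' := W₂.z (W₁.z ht)
  exact CompZ.mul (CompZ.mul (K₂.numA ht' hx') (K₂.numB ht' hy))
    (K₂.has.knows.devZ hx' hy (W₂.z (W₁.z hz)))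

theorem bayesAct (K : At s f J α) :
    CompN s f fun x => ((bayesAct (J x).σ 2 (α x) : Fin (2 * (J x).k)) : ℕ) := by
  have KI := K.has.knows
  refine (CompN.best (m := fun x => 2 * (J x).k) ((CompN.const 2).mul KI.k)
    ((PolyBdd.const 2).mul KI.b_k) (fun x => (J x).two_k_pos)
    (a := fun x z => ∑ t, ((J x).wt t (α x) : ℤ) * (J x).utilZ t (α x) z)
    fun f₁ hz W₁ => ?_).congr fun x => ?_
  · have KI₁ := KI.weak W₁
    refine CompZ.sum KI₁.T KI₁.b_T fun f₂ ht W₂ => ?_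
    have K₂ := (K.weak W₁).weak W₂
    exact CompZ.mul (K₂.wt ht) (K₂.utilZ ht (W₂.z hz))
  · rw [(J x).bayesAct_eq (K.lt x)]

theorem cand (K : At s f J α) (ht : CompN s f fun x => (t x : ℕ)) :
    Comp s f fun x => (J x).cand (t x) (α x) := by
  have KI := K.has.knows
  have hD : CompN s f fun x => 2 ^ (J x).N := .two_pow KI.N KI.b_N
  refine (Comp.pair (hD.comp.pair ?_) (.single (hD.comp.pair ?_)))
  · exact Comp.table KI.k KI.b_k fun f' ha W => ((K.weak W).numA (W.z ht) ha).comp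
  · exact Comp.table KI.k KI.b_k fun f' ha W => ((K.weak W).numB (W.z ht) ha).comp

theorem upd (K : At s f J α) (ht : CompN s f fun x => (t x : ℕ))
    {v : X → Val} (hv : Comp s f v) : Comp s f fun x => (J x).upd (t x) (α x) (v x) := by
  have KI := K.has.knows
  have hb := CompN.best (m := fun x => 2 * (J x).k) ((CompN.const 2).mul KI.k)
    ((PolyBdd.const 2).mul KI.b_k) (fun x => (J x).two_k_pos)
    (a := fun x z => (J x).utilZ (t x) (α x) z)
    fun f₁ hz W₁ => (K.weak W₁).utilZ (W₁.z ht) hz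
  have hu := K.utilZ ht hb
  have hD : CompN s f fun x => 2 ^ ((J x).N + (J x).N + (J x).k) :=
    .two_pow ((KI.N.add KI.N).add KI.k) ((KI.b_N.add KI.b_N).add KI.b_k)
  -- The test gap ≤ 50/E, cleared of denominators; the branches are exchanged because the machine
  -- tests a strict inequality.
  refine (Comp.ite_lt ((CompN.const 50).mul hD) (CompZ.mul hu KI.E) hv (K.cand ht)).congr
    fun x => ?_
  have h : topUtil ((J x).σ (t x)) 2 (α x) ≤ 50 / (J x).E ↔
      ¬ ((50 * 2 ^ ((J x).N + (J x).N + (J x).k) : ℕ) : ℤ) <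
        (J x).utilZ (t x) (α x) (best (J x).two_k_pos ((J x).utilZ (t x) (α x))) * (J x).E := by
    have hE' : (0 : ℝ) < (J x).E := by exact_mod_cast (J x).E_pos
    rw [(J x).topUtil_eq _ (K.lt x), div_le_div_iff₀ (by positivity) hE', not_lt,
      ← Int.cast_le (R := ℝ)]
    push_cast
    rfl
  rw [Sol.upd]
  simp only [h, ite_not]

/-- These bits are the input vertices of a circuit with at most N vertices. -/
theorem hbits_length_le (J : Sol) (t : Fin J.T) (i : Fin 3) {α : List (Joint J.k)}
    (hα : α.length < 2 ^ J.c) : (J.hbits i α).length ≤ J.N := by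
  obtain ⟨_, _, h, _⟩ := J.prob t i hα
  rw [h]
  exact (Nat.le_add_right _ _).trans (J.csize t i ⟨_, hα⟩)

theorem bits_append {l l' : X → List Bool} {N : X → ℕ} (hl : Comp s f fun x => bitsVal (l x))
    (hl' : Comp s f fun x => bitsVal (l' x)) (hN : CompN s f N) (bN : PolyBdd s N)
    (h : ∀ x, (l x).length ≤ N x) : Comp s f fun x => bitsVal (l x ++ l' x) :=
  (Comp.append hl hl' (CompN.length hl hN bN (by simpa using h))
    (bN.mono (by simpa using h))).congr fun x => by rw [bitsVal, List.map_append]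

/-- Only the first two players are covered by `hi`: the third one deviates, and its circuits are
never evaluated. -/
theorem block (K : Knows s f I) {i : Fin 3} (hi : ∀ k, acts k i = k)
    {x : ∀ a, Fin (I a).k} {y : ∀ a, Fin (I a).k} {z : ∀ a, Fin (2 * (I a).k)}
    (hx : CompN s f fun a => (x a : ℕ))
    (hy : CompN s f fun a => (y a : ℕ)) (hz : CompN s f fun a => (z a : ℕ))
    (ha : CompN s f fun a => (joint (x a) (y a) (z a) i : ℕ)) :
    Comp s f fun a => bitsVal ((I a).block i (joint (x a) (y a) (z a))) := by
  have hr := K.rewZ (i := fun _ => i) (.const i) hx hy hz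
  have hc : CompN s f fun a => Nat.clog 2 (acts (I a).k i) :=
    (CompN.clog K.k K.b_k).congr fun a => by rw [hi]
  have bc : PolyBdd s fun a => Nat.clog 2 (acts (I a).k i) :=
    K.b_k.mono fun a => by rw [hi]; exact Nat.clog_le_of_le_pow Nat.lt_two_pow_self.le
  have hp : CompN s f fun a => (I a).k + 4 * (I a).c + 2 + 1 :=
    ((K.k.add ((CompN.const 4).mul K.c)).add (.const 2)).add (.const 1)
  have bp : PolyBdd s fun a => (I a).k + 4 * (I a).c + 2 + 1 :=
    ((K.b_k.add ((PolyBdd.const 4).mul K.b_c)).add (.const 2)).add (.const 1)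
  refine bits_append (Comp.natBits ha hc bc) ?_ hc bc fun a => by simp [natBits]
  refine ((CompZ.ite_lt hr (.const 0) (.const 1) (.const 0)).comp.pair
    (Comp.natBits hr.natAbs hp bp)).congr fun a => ?_
  rw [bitsVal, bitsVal, List.map_cons, Val.ofList]
  congr 1
  by_cases h : GenCCE.rewZ (I a).M (I a).c i (joint (x a) (y a) (z a)) < 0 <;>
    simp [h, bitVal, Val.ofNat]

/-- The profiles `t` enter only through circuits whose input sizes bound the bits of the history. -/
theorem cons (K : At s f J α) (t : ∀ x, Fin (J x).T)
    {x : ∀ a, Fin (J a).k} {y : ∀ a, Fin (J a).k} {z : ∀ a, Fin (2 * (J a).k)}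
    (hx : CompN s f fun a => (x a : ℕ))
    (hy : CompN s f fun a => (y a : ℕ)) (hz : CompN s f fun a => (z a : ℕ)) :
    Comp s f fun a => (J a).state (joint (x a) (y a) (z a) :: α a) := by
  have KI := K.has.knows
  have hb : ∀ i, (∀ k, acts k i = k) → CompN s f (fun a => (joint (x a) (y a) (z a) i : ℕ)) →
      Comp s f (fun a => bitsVal ((J a).hbits i (α a))) →
      Comp s f fun a => bitsVal ((J a).hbits i (joint (x a) (y a) (z a) :: α a)) :=
    fun i hi ha h => (bits_append h (block KI hi hx hy hz ha) KI.N KI.b_N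
      fun a => hbits_length_le (J a) (t a) i (K.lt a)).congr fun a => by rw [(J a).hbits_cons]
  refine (hb 0 (fun _ => rfl) hx K.state.fst).pair ((hb 1 (fun _ => rfl) hy K.state.snd.fst).pair ?_)
  refine Comp.table KI.T KI.b_T fun f' hj W => ?_
  have K' := K.weak W
  exact ((K'.wt hj).mul ((K'.numA hj (W.z hx)).mul (K'.numB hj (W.z hy)))).comp

theorem next (K : At s f J α) (ht : CompN s f fun x => (t x : ℕ)) {r r' : X → ℕ}
    (hr : CompN s f r) (hr' : CompN s f r') :
    Comp s f fun a => (J a).state (joint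
      (pickFin (J a).hk (GenCCE.numA (J a).N ((J a).σ (t a)) (α a)) (r a))
      (pickFin (J a).hk (GenCCE.numB (J a).N ((J a).σ (t a)) (α a)) (r' a))
      (GenCCE.bayesAct (J a).σ 2 (α a)) :: α a) := by
  have KI := K.has.knows
  refine K.cons t (CompN.pickFin KI.k KI.b_k (fun a => (J a).hk) hr fun f' hj W => ?_)
    (CompN.pickFin KI.k KI.b_k (fun a => (J a).hk) hr' fun f' hj W => ?_) K.bayesAct
  · exact (K.weak W).numA (W.z ht) hj
  · exact (K.weak W).numB (W.z ht) hj

end At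

/-! ### Scanning trials, profiles and steps -/

namespace Sol

variable (J : Sol)

/-- The number of coin tosses of a trial. -/
def coins : ℕ := 2 ^ J.c * (J.N + J.N)

/-- The history after `h` steps of the simulation of profile `t` in trial `i`. -/
noncomputable def sim (i : ℕ) (t : Fin J.T) (h : ℕ) : List (Joint J.k) :=
  simHist J.N J.σ t [] ((J.w.drop (i * J.coins)).take J.coins) h

theorem sim_length (i : ℕ) (t : Fin J.T) (h : ℕ) : (J.sim i t h).length = h := by
  simp [sim, simHist_length]

/-- Translates nested windows into offsets in the whole coin sequence, which is how the program
reads coins. -/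
theorem sim_succ (i : ℕ) (t : Fin J.T) {h : ℕ} (hh : h < 2 ^ J.c) : J.sim i t (h + 1) =
    joint (pickFin J.hk (numA J.N (J.σ t) (J.sim i t h))
        (ofBits ((J.w.drop (i * J.coins + h * (J.N + J.N))).take J.N)))
      (pickFin J.hk (numB J.N (J.σ t) (J.sim i t h))
        (ofBits ((J.w.drop (i * J.coins + h * (J.N + J.N) + J.N)).take J.N)))
      (bayesAct J.σ 2 (J.sim i t h)) :: J.sim i t h := by
  have h1 : h * (J.N + J.N) + (J.N + J.N) ≤ J.coins := by
    rw [← Nat.succ_mul]; exact Nat.mul_le_mul_right _ hh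
  rw [sim, simHist, nextJoint]
  have hA : ((((J.w.drop (i * J.coins)).take J.coins).drop (h * (J.N + J.N))).take
      (J.N + J.N)).take J.N = (J.w.drop (i * J.coins + h * (J.N + J.N))).take J.N := by
    rw [List.drop_take, List.drop_drop, List.take_take, List.take_take]
    congr 1
    omega
  have hB : (((((J.w.drop (i * J.coins)).take J.coins).drop (h * (J.N + J.N))).take
      (J.N + J.N)).drop J.N).take J.N =
      (J.w.drop (i * J.coins + h * (J.N + J.N) + J.N)).take J.N := by
    rw [List.drop_take, List.drop_drop, List.take_take, List.drop_take, List.drop_drop,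
      List.take_take, add_assoc]
    congr 1
    omega
  rw [hA, hB]
  rfl

/-- The output after the first `h` steps of the simulation of profile `t` in trial `i`. -/
noncomputable def scanH (i : ℕ) (t : Fin J.T) (v : Val) : ℕ → Val
  | 0 => v
  | h + 1 => J.upd t (J.sim i t h) (scanH i t v h)

/-- The output after the simulation of the first `t` profiles in trial `i`. -/
noncomputable def scanT (i : ℕ) (v : Val) : ℕ → Val
  | 0 => v
  | t + 1 => if h : t < J.T then J.scanH i ⟨t, h⟩ (scanT i v t) (2 ^ J.c) else scanT i v t

end Sol

/-- A pure action for each player as an output. -/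
def pureOutput (k : ℕ) : Val :=
  .table fun _ : Fin 2 => .pair (.ofNat 1) (.table fun a : Fin k => .ofNat (if (a : ℕ) < 1 then 1 else 0))

/-- The output after the first `i` trials. -/
noncomputable def Sol.scan (J : Sol) : ℕ → Val
  | 0 => pureOutput J.k
  | i + 1 => J.scanT i (J.scan i) J.T

theorem Knows.pureOutput {X : Type} {s : X → ℕ} {f : X → Val} {I : X → Inst} (K : Knows s f I) :
    Comp s f fun x => GenCCE.pureOutput (I x).k := by
  refine Comp.table (m := fun _ => 2) (.const 2) (.const 2)
    fun f' _ W => W.comp (g := fun x => .pair (.ofNat 1)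
      (.table fun a : Fin (I x).k => .ofNat (if (a : ℕ) < 1 then 1 else 0))) ?_
  refine Comp.pair (.const 1) (Comp.table K.k K.b_k fun f' hj W => ?_)
  exact (CompN.ite_lt hj (.const 1) (.const 1) (.const 0)).comp

namespace Has

variable {X Y : Type} {s : X → ℕ} {f : X → Val} {J : X → Sol}

theorem coins (K : Has s f J) : CompN s f fun x => (J x).coins :=
  K.knows.H.mul (K.knows.N.add K.knows.N)

theorem b_coins (K : Has s f J) : PolyBdd s fun x => (J x).coins :=
  K.knows.b_H.mul (K.knows.b_N.add K.knows.b_N)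

theorem scanH (K : Has s f J) {i : X → ℕ} (hi : CompN s f i)
    (bi : PolyBdd s i) {t : ∀ x, Fin (J x).T} (ht : CompN s f fun x => (t x : ℕ)) {v : X → Val}
    (hv : Comp s f v) : Comp s f fun x => (J x).scanH (i x) (t x) (v x) (2 ^ (J x).c) := by
  have KI := K.knows
  have h0 : Comp s f fun x => (J x).state [] := by
    refine Comp.congr (Comp.pair (.const 0) (Comp.pair (.const 0) (Comp.table KI.T KI.b_T
      (a := fun _ _ => .ofNat 1) fun f' _ W => .const 1))) fun x => ?_
    rw [Sol.state, Inst.hbits_nil, Inst.hbits_nil]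
    rfl
  have key := Comp.forLoop (acc := fun x h => .pair ((J x).state ((J x).sim (i x) (t x) h))
    ((J x).scanH (i x) (t x) (v x) h)) KI.H KI.b_H (h0.pair hv) ?_
  · exact key.snd
  · intro f' hh ha W
    have K' : At (fun y : Σ x, Fin (2 ^ (J x).c) => s y.1) f' (fun y => J y.1)
        fun y => (J y.1).sim (i y.1) (t y.1) y.2 :=
      ⟨K.weak W, hh.congr fun y => ((J y.1).sim_length _ _ _).symm,
        fun y => by rw [Sol.sim_length]; exact y.2.2, ha.fst⟩
    have KI' := K'.has.knows
    have ho := ((W.z hi).mul K'.has.coins).add (hh.mul (KI'.N.add KI'.N))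
    have bo : PolyBdd (fun y : Σ x, Fin (2 ^ (J x).c) => s y.1)
        fun y => i y.1 * (J y.1).coins + y.2 * ((J y.1).N + (J y.1).N) :=
      ((bi.reindex Sigma.fst).mul K'.has.b_coins).add
        ((KI'.b_H.mono fun y => y.2.2.le).mul (KI'.b_N.add KI'.b_N))
    refine ((K'.next (W.z ht) (K'.has.window ho bo KI'.N KI'.b_N)
      (K'.has.window (ho.add KI'.N) (bo.add KI'.b_N) KI'.N KI'.b_N)).congr fun y => ?_).pair
      (K'.upd (W.z ht) ha.snd)
    rw [(J y.1).sim_succ (i y.1) (t y.1) y.2.2]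

theorem scanT (K : Has s f J) {i : X → ℕ} (hi : CompN s f i)
    (bi : PolyBdd s i) {v : X → Val} (hv : Comp s f v) :
    Comp s f fun x => (J x).scanT (i x) (v x) (J x).T := by
  refine Comp.forLoop (acc := fun x j => (J x).scanT (i x) (v x) j) K.knows.T K.knows.b_T hv ?_
  intro f' hj ha W
  refine ((K.weak W).scanH (W.z hi) (bi.reindex Sigma.fst) hj ha).congr
    fun y => ?_
  rw [Sol.scanT, dif_pos y.2.2]

theorem scan (K : Has s f J) :
    Comp s f fun x => (J x).scan (J x).l := by
  refine Comp.forLoop (acc := fun x j => (J x).scan j) K.knows.l K.knows.b_l K.knows.pureOutput ?_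
  intro f' hj ha W
  exact (K.weak W).scanT hj ((K.knows.b_l.reindex Sigma.fst).mono
    fun y => y.2.2.le) ha

end Has

/-! ### Correctness of the output -/

section

variable {k c : ℕ} {M : NormalFormGame 2 k}

theorem isNashOutput_pair {ε : ℝ} {p q : stdSimplex ℝ (Fin k)} (h : M.IsNash ε (twoProfile p q))
    {D : ℕ} (hD : 0 < D) {P Q : Fin k → ℕ} (hP : ∀ a, p.1 a = P a / D) (hQ : ∀ a, q.1 a = Q a / D) :
    M.IsNashOutput ε (.ofList [.pair (.ofNat D) (.table fun a => .ofNat (P a)),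
      .pair (.ofNat D) (.table fun a => .ofNat (Q a))]) := by
  refine ⟨_, fun _ => D, ![P, Q], h, fun _ => hD, fun j => ?_, ?_⟩
  · fin_cases j
    · exact hP
    · exact hQ
  · simp [Val.table]

theorem isNashOutput_pure (hk : 0 < k) {ε : ℝ} (hε : 1 ≤ ε) : M.IsNashOutput ε (pureOutput k) := by
  let p : stdSimplex ℝ (Fin k) := ⟨fun a => (if (a : ℕ) < 1 then 1 else 0 : ℕ), fun a => by positivity, by
    rw [Finset.sum_eq_single ⟨0, hk⟩] <;> simp [Fin.ext_iff]⟩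
  have := isNashOutput_pair (M := M) (isNash_of_one_le hε (twoProfile p p)) one_pos
    (P := fun a => if (a : ℕ) < 1 then 1 else 0) (Q := fun a => if (a : ℕ) < 1 then 1 else 0)
    (fun a => by simp [p]) fun a => by simp [p]
  simpa [pureOutput, Val.table] using this

theorem NormalFormGame.IsNash.mono {m n : ℕ} {G : NormalFormGame m n} {ε ε' : ℝ}
    {p : Fin m → stdSimplex ℝ (Fin n)} (h : G.IsNash ε p) (he : ε ≤ ε') : G.IsNash ε' p :=
  fun i a => (h i a).trans he

theorem NormalFormGame.IsNashOutput.mono {m n : ℕ} {G : NormalFormGame m n} {ε ε' : ℝ} {u : Val}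
    (h : G.IsNashOutput ε u) (he : ε ≤ ε') : G.IsNashOutput ε' u := by
  obtain ⟨p, D, k, h1, h2⟩ := h
  exact ⟨p, D, k, h1.mono he, h2⟩

end

namespace Sol

variable (J : Sol)

theorem isNashOutput_cand {ε : ℝ} (t : Fin J.T) {α : List (Joint J.k)} (hα : α.length < 2 ^ J.c)
    (h : topUtil (J.σ t) 2 α ≤ ε) : J.M.IsNashOutput ε (J.cand t α) := by
  refine isNashOutput_pair (isNash_of_topUtil h) (by positivity) (fun a => ?_) fun a => ?_
  · rw [(J.dyadic t).A α hα]; push_cast; rfl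
  · rw [(J.dyadic t).B α hα]; push_cast; rfl

/-- The test is exact: only a genuine equilibrium ever replaces the current output, so a good output
is never spoiled by later steps. -/
theorem good_upd {t : Fin J.T} {α : List (Joint J.k)} (hα : α.length < 2 ^ J.c) {v : Val}
    (h : topUtil (J.σ t) 2 α ≤ 50 / J.E ∨ J.M.IsNashOutput (50 / J.E) v) :
    J.M.IsNashOutput (50 / J.E) (J.upd t α v) := by
  rw [upd]
  split_ifs with h'
  · exact J.isNashOutput_cand t hα h'
  · exact h.resolve_left h'

theorem good_scanH {i : ℕ} {t : Fin J.T} {v : Val} {m : ℕ} (hm : m ≤ 2 ^ J.c)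
    (h : (∃ h < m, topUtil (J.σ t) 2 (J.sim i t h) ≤ 50 / J.E) ∨ J.M.IsNashOutput (50 / J.E) v) :
    J.M.IsNashOutput (50 / J.E) (J.scanH i t v m) := by
  induction m with
  | zero => exact h.resolve_left fun ⟨_, h, _⟩ => absurd h (Nat.not_lt_zero _)
  | succ m ih =>
    refine J.good_upd (by rw [sim_length]; omega) ?_
    rcases h with ⟨h, hlt, hp⟩ | h
    · rcases Nat.lt_succ_iff_lt_or_eq.1 hlt with h1 | rfl
      · exact .inr (ih (by omega) (.inl ⟨h, h1, hp⟩))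
      · exact .inl hp
    · exact .inr (ih (by omega) (.inr h))

theorem good_scanT {i : ℕ} {v : Val} {m : ℕ} (h : (∃ t : Fin J.T, (t : ℕ) < m ∧ ∃ h < 2 ^ J.c,
      topUtil (J.σ t) 2 (J.sim i t h) ≤ 50 / J.E) ∨ J.M.IsNashOutput (50 / J.E) v) :
    J.M.IsNashOutput (50 / J.E) (J.scanT i v m) := by
  induction m with
  | zero => exact h.resolve_left fun ⟨_, h, _⟩ => absurd h (Nat.not_lt_zero _)
  | succ m ih =>
    rw [scanT]
    split_ifs with hm
    · refine J.good_scanH le_rfl ?_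
      rcases h with ⟨t, hlt, hp⟩ | h
      · rcases Nat.lt_succ_iff_lt_or_eq.1 hlt with h1 | h1
        · exact .inr (ih (.inl ⟨t, h1, hp⟩))
        · obtain rfl : t = ⟨m, hm⟩ := Fin.ext h1
          exact .inl hp
      · exact .inr (ih (.inr h))
    · refine ih (h.imp_left fun ⟨t, _, hp⟩ => ⟨t, ?_, hp⟩)
      have := t.2
      omega

theorem good_scan {m : ℕ} (h : ∃ i < m, Success J.N J.σ (50 / J.E)
      ((J.w.drop (i * J.coins)).take J.coins)) :
    J.M.IsNashOutput (50 / J.E) (J.scan m) := by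
  induction m with
  | zero => obtain ⟨_, h, _⟩ := h; exact absurd h (Nat.not_lt_zero _)
  | succ m ih =>
    refine J.good_scanT ?_
    obtain ⟨i, hlt, t, hp⟩ := h
    rcases Nat.lt_succ_iff_lt_or_eq.1 hlt with h1 | rfl
    · exact .inr (ih ⟨i, h1, t, hp⟩)
    · exact .inl ⟨t, t.2, hp⟩

end Sol


/-! ## The program of the reduction -/

theorem Run.one_le {sub : Val → Val → ℕ → Prop} {c : Program} {s s' : Store} {w w' : List Bool}
    {t : ℕ} (h : Run sub c s w s' w' t) : 1 ≤ t := by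
  induction h <;> omega

/-- Turns the input into a stack with one entry and finally takes the entry off again. -/
def wrapProg (c : Program) : Program :=
  .seq (.seq (.const 1 0) (.pair 0 0 1)) (.seq c (.fst 0 0))

theorem Triple.outputs {sub : Val → Val → ℕ → Prop} {c : Program} {κ : List Bool} {v u : Val}
    {t : ℕ} (h : Triple sub c κ v u t) (w : List Bool) :
    ∃ t' ≤ t + 3, Outputs sub (wrapProg c) (κ ++ w) v u t' := by
  obtain ⟨st, t', h1, h2, h3⟩ := h (Function.update (Function.update
    (Function.update (fun _ => Val.int 0) 0 v) 1 (.int 0)) 0 (.pair v (.int 0))) w (.int 0) (by simp)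
  refine ⟨_, ?_, _, _, Run.then (Run.then (Run.const _ _ _ _) (Run.pair _ _ _ _ _))
    (Run.then (s₁ := st) (w₁ := w) (t₁ := t') ?_ (Run.fst _ _ _ _)), ?_⟩
  · simp; omega
  · simpa using h1
  · simp [h2, Val.fst]

theorem Triple.toss {sub : Val → Val → ℕ → Prop} (b : Bool) (v : Val) :
    Triple sub (Triple.onTop (.seq (.coin 3) (.pair 1 3 1))) [b] v (.pair (bitVal b) v) 5 := by
  refine Triple.of_onTop (t := 2) fun st w h => ⟨_, _, Run.then (Run.coin _ _ _ _)
    (Run.pair _ _ _ _ _), ?_, by simp, le_rfl⟩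
  cases b <;> simp [h, bitVal, Val.ofNat]

theorem flatMap_getD (u : List Bool) :
    (List.range u.length).flatMap (fun j => [u.getD j false]) = u := by
  rw [← List.map_eq_flatMap]
  refine List.ext_getElem (by simp) fun i h₁ h₂ => ?_
  simp only [List.getElem_map, List.getElem_range]
  exact List.getD_eq_getElem _ _ h₂

/-- Tossing coins and storing them in a list. -/
theorem Triple.tossLoop : ∃ (c : Program) (C : ℕ), ∀ (sub : Val → Val → ℕ → Prop) (u : List Bool)
    (r : Val), Triple sub c u (.pair (.int u.length) (.pair (.int 0) r))
      (.pair (.int 0) (.pair (bitsVal u.reverse) r))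
      (u.length * ((u.length + 2) ^ C + 8) + 3) := by
  let f : Bool × ℕ × Val × Val → Val := fun x =>
    .pair (bitVal x.1) (.pair (.int x.2.1) (.pair x.2.2.1 x.2.2.2))
  have hid : Comp (fun x : Bool × ℕ × Val × Val => x.2.1) f f := .id
  have hm : CompN (fun x : Bool × ℕ × Val × Val => x.2.1) f fun x => x.2.1 :=
    .of_comp hid.snd.fst .self
  -- `Comp` describes coin-free programs, so a pass consists of a toss followed by this
  -- rearrangement, which decreases the counter and pushes the bit.
  obtain ⟨c, b, ⟨C, hC⟩, hc⟩ := (CompZ.sub hm (.const 1)).comp.pair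
    ((hid.fst.pair hid.snd.snd.fst).pair hid.snd.snd.snd)
  refine ⟨Triple.whileProg (.seq (Triple.onTop (.seq (.coin 3) (.pair 1 3 1))) c), C,
    fun sub u r => ?_⟩
  have key := Triple.loop (sub := sub) (m := u.length) (t := (u.length + 2) ^ C + 5)
    (S := fun j => .pair (.int ((u.length : ℤ) - (j : ℕ))) (.pair (bitsVal (u.take j).reverse) r))
    (κ := fun j => [u.getD j false])
    (c := .seq (Triple.onTop (.seq (.coin 3) (.pair 1 3 1))) c) (fun j hj => by
      simpa [Val.fst, Val.test] using hj) (by simp [Val.fst, Val.test]) fun j hj => ?_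
  · rw [flatMap_getD] at key
    simpa [bitsVal, Val.ofList] using key
  · have h1 := Triple.toss (sub := sub) (u.getD j false)
      (.pair (.int ((u.length : ℤ) - (j : ℕ))) (.pair (bitsVal (u.take j).reverse) r))
    have h2 := hc sub (u.getD j false, u.length - j, bitsVal (u.take j).reverse, r)
    have h3 := h1.seq (d := c) (κ' := []) (z := .pair (.int ((u.length : ℤ) - ((j + 1 : ℕ) : ℕ)))
      (.pair (bitsVal (u.take (j + 1)).reverse) r)) (t' := b _) (by
        convert h2 using 1
        · simp only [f]
          rw [Nat.cast_sub hj.le]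
        · rw [List.take_succ_eq_append_getElem hj, List.reverse_append]
          have e : u.getD j false = u[j] := List.getD_eq_getElem _ _ hj
          simp only [f, e, List.reverse_singleton, List.singleton_append, bitsVal, List.map_cons,
            Val.ofList, Val.fst, Val.snd]
          rw [Nat.cast_sub hj.le, Nat.cast_succ, sub_add_eq_sub_sub])
    refine h3.mono ?_
    have h4 := (hC (u.getD j false, u.length - j, bitsVal (u.take j).reverse, r)).trans
      (Nat.pow_le_pow_left (Nat.add_le_add_right (Nat.sub_le u.length j) 2) C)
    omega

/-- The program of the reduction. For small precision it outputs a pure action, otherwise it calls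
the subroutine on the repeated game, tosses coins and simulates. -/
theorem exists_reduction : ∃ (B : Program) (C : ℕ), ∀ sub : Val → Val → ℕ → Prop,
    (∀ I : Inst, I.E ≤ 50 → ∀ w, ∃ t ≤ (I.size + 2) ^ C,
      Outputs sub B w I.input (pureOutput I.k) t) ∧
    ∀ (J : Sol) (U t₀ : ℕ), 50 < J.E → sub J.G.encode J.answer t₀ → t₀ ≤ U →
      J.w.length = J.l * J.coins → J.w.length ≤ (J.size + U + 2) ^ C ∧
        ∀ w, ∃ t ≤ (J.size + U + 2) ^ C,
          Outputs sub B (J.w.reverse ++ w) J.toInst.input (J.scan J.l) t := by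
  have K₀ : Knows Inst.size Inst.input id := ⟨.self, .id⟩
  obtain ⟨c₀, b₀, ⟨C₀, h₀⟩, H₀⟩ := (CompZ.sub K₀.E (.const 50)).comp
  obtain ⟨c₁, b₁, ⟨C₁, h₁⟩, H₁⟩ := K₀.pureOutput
  obtain ⟨c₂, b₂, ⟨C₂, h₂⟩, H₂⟩ := K₀.encode.pair .id
  let f₃ : Sol → Val := fun J => .pair J.answer J.toInst.input
  have hid₃ : Comp (fun J : Sol => J.toInst.size) f₃ f₃ := .id
  have K₃ : Knows (fun J : Sol => J.toInst.size) f₃ Sol.toInst := ⟨.self, hid₃.snd⟩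
  obtain ⟨c₃, b₃, ⟨C₃, h₃⟩, H₃⟩ := (K₃.l.mul (K₃.H.mul (K₃.N.add K₃.N))).comp.pair
    ((Comp.const 0).pair hid₃)
  obtain ⟨c₄, C₄, H₄⟩ := Triple.tossLoop
  let f₅ : Sol → Val := fun J => .pair (.int 0) (.pair (bitsVal J.w) (f₃ J))
  have hid₅ : Comp (fun J : Sol => J.toInst.size) f₅ f₅ := .id
  have K₅ : Has (fun J : Sol => J.toInst.size) f₅ id :=
    ⟨.self, hid₅.snd.snd.snd.pair (hid₅.snd.fst.pair hid₅.snd.snd.fst)⟩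
  obtain ⟨c₅, b₅, ⟨C₅, h₅⟩, H₅⟩ := K₅.scan
  -- An upper bound in terms of the size for the number l · H · 2N of coins.
  let Kb : ℕ → ℕ := fun s => s * (s * (s + s))
  have hp : ∀ k : ℕ, PolyBdd (fun s : ℕ => s) fun s => (s + 2) ^ k := fun k => ⟨k, fun s => le_rfl⟩
  have hKb : PolyBdd (fun s : ℕ => s) Kb := PolyBdd.self.mul (PolyBdd.self.mul (.add .self .self))
  obtain ⟨C, hC⟩ : PolyBdd (fun s : ℕ => s) fun s => ((s + 2) ^ C₀ + (s + 2) ^ C₁ +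
      ((s + 2) ^ C₂ + (s + 7) + (s + 2) ^ C₃ + (Kb s * ((Kb s + 2) ^ C₄ + 8) + 3) +
        (s + 2) ^ C₅)) + 8 :=
    (((hp C₀).add (hp C₁)).add (((((hp C₂).add (PolyBdd.self.add (.const 7))).add (hp C₃)).add
      ((hKb.mul (((hKb.add (.const 2)).pow C₄).add (.const 8))).add (.const 3))).add
        (hp C₅))).add (.const 8)
  refine ⟨wrapProg (Triple.condProg c₀ (.seq c₂ (.seq (Triple.onTop (.seq (.fst 3 1)
    (.seq (.snd 4 1) (.seq (.call 3 3) (.pair 1 3 4))))) (.seq c₃ (.seq c₄ c₅)))) c₁), C,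
    fun sub => ⟨fun I hI w => ?_, fun J U t₀ hE hs ht hw => ?_⟩⟩
  · have h := Triple.cond (c := .seq c₂ (.seq (Triple.onTop (.seq (.fst 3 1)
      (.seq (.snd 4 1) (.seq (.call 3 3) (.pair 1 3 4))))) (.seq c₃ (.seq c₄ c₅))))
      (H₀ sub I) (κ := []) (u := pureOutput I.k) (t' := b₁ I)
      (fun h => by simp [Val.test] at h; omega) fun _ => H₁ sub I
    obtain ⟨t, h1, h2⟩ := h.outputs w
    refine ⟨t, h1.trans (le_trans ?_ (hC I.size)), h2⟩
    have := h₀ I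
    have := h₁ I
    dsimp only
    omega
  · set s := J.toInst.size + U with hsd
    have hs0 : J.toInst.size ≤ s := Nat.le_add_right _ _
    have hsU : U ≤ s := Nat.le_add_left _ _
    have hlen : J.w.length ≤ Kb s := by
      rw [hw]
      have e : J.toInst.size = J.n + J.T + J.N + J.E + J.l := rfl
      have := J.two_pow_le
      exact Nat.mul_le_mul (by omega) (Nat.mul_le_mul (by omega) (by omega))
    have hpow : ∀ k : ℕ, (J.toInst.size + 2) ^ k ≤ (s + 2) ^ k := fun k =>
      Nat.pow_le_pow_left (by omega) k
    have e2 := (h₂ J.toInst).trans (hpow C₂)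
    have e0 := (h₀ J.toInst).trans (hpow C₀)
    have e3 := (h₃ J).trans (hpow C₃)
    have e5 := (h₅ J).trans (hpow C₅)
    have eK : J.w.length * ((J.w.length + 2) ^ C₄ + 8) ≤ Kb s * ((Kb s + 2) ^ C₄ + 8) :=
      Nat.mul_le_mul hlen (Nat.add_le_add_right (Nat.pow_le_pow_left (by omega) _) _)
    have hT := hC s
    have h4 := H₄ sub J.w.reverse (f₃ J)
    rw [List.length_reverse, List.reverse_reverse] at h4
    have h3 := H₃ sub J
    have hmid : Val.int ((J.l * (2 ^ J.c * (J.N + J.N)) : ℕ) : ℤ) = Val.int J.w.length := by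
      rw [hw]; rfl
    simp only [hmid] at h3
    have h := (H₂ sub J.toInst).seq ((Triple.call (b := J.toInst.input) hs).seq
      (h3.seq (h4.seq (H₅ sub J))))
    simp only [List.nil_append, List.append_nil] at h
    have h' := Triple.cond (d := c₁) (H₀ sub J.toInst) (fun _ => h)
      (fun h => by simp [Val.test] at h; omega)
    refine ⟨?_, fun w => ?_⟩
    · refine le_trans ?_ hT
      have : J.w.length ≤ J.w.length * ((J.w.length + 2) ^ C₄ + 8) :=
        Nat.le_mul_of_pos_right _ (by omega)
      dsimp only
      omega
    · obtain ⟨t, h1, h2⟩ := h'.outputs w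
      refine ⟨t, h1.trans (le_trans ?_ hT), h2⟩
      dsimp only
      omega

/-! ## Counting coin tosses -/

/-- Success depends on the first K coins alone, and the remaining ones average out. The reversal
accounts for the order in which coins are stored. -/
theorem card_ge {m K : ℕ} (hK : K ≤ m) {S : List Bool → Prop} [DecidablePred S] {δ : ℝ}
    (h : avg K (fun u => if S u then 0 else 1) ≤ δ) {P : (Fin m → Bool) → Prop}
    (hP : ∀ w, S ((List.ofFn w).take K).reverse → P w) :
    (1 - δ) * 2 ^ m ≤ (Nat.card {w // P w} : ℝ) := by
  classical
  have h1 : avg m (fun u => if S (u.take K).reverse then (0 : ℝ) else 1) =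
      avg K fun u => if S u then 0 else 1 := by
    obtain ⟨d, rfl⟩ := Nat.exists_eq_add_of_le hK
    rw [avg_add, ← avg_reverse K fun u => if S u then (0 : ℝ) else 1]
    refine avg_congr fun u hu => ?_
    rw [← avg_const d (if S u.reverse then (0 : ℝ) else 1)]
    refine avg_congr fun v _ => ?_
    rw [← hu, List.take_left]
  rw [← h1, avg_eq_sum, div_le_iff₀ (by positivity)] at h
  have h2 : (Nat.card {w // P w} : ℝ) = ∑ w : Fin m → Bool, if P w then (1 : ℝ) else 0 := by
    rw [Nat.card_eq_fintype_card, Fintype.card_subtype, Finset.sum_boole]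
  have h3 : ∑ w : Fin m → Bool, (1 - if S ((List.ofFn w).take K).reverse then (0 : ℝ) else 1) ≤
      ∑ w : Fin m → Bool, if P w then (1 : ℝ) else 0 := by
    refine Finset.sum_le_sum fun w _ => ?_
    by_cases hs : S ((List.ofFn w).take K).reverse
    · rw [if_pos hs, if_pos (hP w hs)]; norm_num
    · rw [if_neg hs]; split_ifs <;> norm_num
  rw [Finset.sum_sub_distrib] at h3
  simp only [Finset.sum_const, Finset.card_univ, Fintype.card_fun, Fintype.card_bool,
    Fintype.card_fin, nsmul_eq_mul, mul_one] at h3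
  push_cast at h3
  rw [h2]
  linarith


/-! ## Parameters -/

/-- The one-shot game with one action for each player. -/
noncomputable def oneGame : MarkovGame 3 where
  S := 1
  H := 1
  A _ := 1
  S_pos := one_pos
  H_pos := one_pos
  A_pos _ := one_pos
  P _ _ _ := ⟨fun _ => 1, by simp [stdSimplex]⟩
  R _ _ _ _ := 0
  R_bound _ _ _ _ := by simp
  μ := ⟨fun _ => 1, by simp [stdSimplex]⟩

theorem oneGame_size {n : ℕ} (hn : 1 ≤ n) : oneGame.size ≤ (n : ℕ∞) := by
  have h0 : oneGame.beta ≤ ((0 : ℕ) : ℕ∞) :=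
    iInf₂_le 0 ⟨fun _ _ _ _ => ⟨0, by simp [oneGame]⟩, fun _ _ _ _ => hasBits_one _,
      fun _ => hasBits_one _⟩
  have h1 : ((1 : ℕ) : ℕ∞) ≤ n := by exact_mod_cast hn
  exact max_le (max_le h1 (iSup_le fun _ => h1)) (max_le h1 (h0.trans (by simp)))

/-- On a trivial game the subroutine must return a circuit with an output vertex, and every run
takes a step. Otherwise the promised time, a product, could be zero. -/
theorem SolvesGenCCE.pos {n T N U : ℕ} {ε : ℝ} {A : Program} (h : SolvesGenCCE 3 n T ε N U A)
    (hn : 1 ≤ n) (hT : 0 < T) : 1 ≤ N ∧ 1 ≤ U := by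
  obtain ⟨u, t, ⟨s', w', hr, _⟩, ht, σ, c, _, hc, _⟩ := h oneGame (oneGame_size hn)
  refine ⟨?_, hr.one_le.trans ht⟩
  obtain ⟨hwf, hs, L, hL, _⟩ := hc ⟨0, hT⟩ 0 (⟨0, one_pos⟩ : Fin 1)
  have := digits_le (k := 1) hwf hs one_pos hL
  omega

section

variable {n T : ℕ} {ε : ℝ}

/-- From T ≥ 2 and 16 log 2 > 11. All later lower bounds on n come from here. -/
theorem lt_n_of_lt_exp (hT : 1 < T) (hTn : (T : ℝ) < Real.exp (ε ^ 2 * n / 16)) :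
    11 < ε ^ 2 * n := by
  have h2 : (2 : ℝ) ≤ T := by exact_mod_cast hT
  have h3 : Real.log 2 < ε ^ 2 * n / 16 :=
    (Real.log_lt_iff_lt_exp two_pos).2 (h2.trans_lt hTn)
  have := Real.log_two_gt_d9
  linarith

theorem twelve_le (hε : 0 < ε) (hε1 : ε ≤ 1) (h : 11 < ε ^ 2 * n) : 12 ≤ n := by
  have h1 : ε ^ 2 * n ≤ n := mul_le_of_le_one_left (by positivity) (by nlinarith)
  have : (11 : ℝ) < n := by linarith
  exact_mod_cast this

/-- Each summand is dominated by the product b, and the sum by b². The factor log(1/δ) may be less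
than 1, so it is always absorbed by n or T. -/
theorem ceil_bound {N U : ℕ} {δ : ℝ} (hε : 0 < ε) (hε1 : ε ≤ 1) (hn : 12 ≤ n) (hT : 1 < T)
    (hN : 1 ≤ N) (hU : 1 ≤ U) (hδ : 0 < δ) (hδ2 : δ ≤ 1 / 2) :
    ((n + T + N + ⌈1 / ε⌉₊ + ⌈Real.log (1 / δ)⌉₊ + U + 2 : ℕ) : ℝ) ≤
      ((n : ℝ) * T * N * U * Real.log (1 / δ) / ε) ^ 2 := by
  have hl : 0.69 ≤ Real.log (1 / δ) := by
    have h2 : (2 : ℝ) ≤ 1 / δ := by rw [le_div_iff₀ hδ]; linarith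
    have := Real.log_le_log two_pos h2
    have := Real.log_two_gt_d9
    linarith
  set l := Real.log (1 / δ)
  set e := 1 / ε with he
  have he1 : 1 ≤ e := by rw [he, le_div_iff₀ hε]; linarith
  have hE : (⌈e⌉₊ : ℝ) < e + 1 := Nat.ceil_lt_add_one (by linarith)
  have hL : (⌈l⌉₊ : ℝ) < l + 1 := Nat.ceil_lt_add_one (by linarith)
  rw [show (n : ℝ) * T * N * U * l / ε = n * T * N * U * l * e by rw [he]; ring]
  push_cast
  have hn' : (12 : ℝ) ≤ n := by exact_mod_cast hn
  have hT' : (2 : ℝ) ≤ T := by exact_mod_cast hT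
  have hN' : (1 : ℝ) ≤ N := by exact_mod_cast hN
  have hU' : (1 : ℝ) ≤ U := by exact_mod_cast hU
  have a1 : 1 ≤ (T : ℝ) * l := by nlinarith
  have a2 : 1 ≤ (n : ℝ) * l := by nlinarith
  have a3 : 24 ≤ (n : ℝ) * T := by nlinarith
  have a4 : 16 ≤ (n : ℝ) * T * l := by nlinarith
  have a5 : 1 ≤ (N : ℝ) * U := one_le_mul_of_one_le_of_one_le hN' hU'
  have a6 : 1 ≤ (N : ℝ) * U * e := one_le_mul_of_one_le_of_one_le a5 he1
  have a7 : 1 ≤ (U : ℝ) * e := one_le_mul_of_one_le_of_one_le hU' he1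
  have a8 : 1 ≤ (N : ℝ) * e := one_le_mul_of_one_le_of_one_le hN' he1
  set b := (n : ℝ) * T * N * U * l * e with hb
  have b1 : (n : ℝ) ≤ b := by
    calc (n : ℝ) ≤ n * (T * l * (N * U * e)) :=
          le_mul_of_one_le_right (by positivity) (one_le_mul_of_one_le_of_one_le a1 a6)
      _ = b := by rw [hb]; ring
  have b2 : (T : ℝ) ≤ b := by
    calc (T : ℝ) ≤ T * (n * l * (N * U * e)) :=
          le_mul_of_one_le_right (by positivity) (one_le_mul_of_one_le_of_one_le a2 a6)
      _ = b := by rw [hb]; ring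
  have b3 : (N : ℝ) ≤ b := by
    calc (N : ℝ) ≤ N * (n * T * l * (U * e)) := le_mul_of_one_le_right (by positivity)
          (one_le_mul_of_one_le_of_one_le (by linarith) a7)
      _ = b := by rw [hb]; ring
  have b4 : (U : ℝ) ≤ b := by
    calc (U : ℝ) ≤ U * (n * T * l * (N * e)) := le_mul_of_one_le_right (by positivity)
          (one_le_mul_of_one_le_of_one_le (by linarith) a8)
      _ = b := by rw [hb]; ring
  have b5 : 16 * e ≤ b := by
    calc 16 * e ≤ n * T * l * e * (N * U) := by
          refine (mul_le_mul_of_nonneg_right a4 (by linarith)).trans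
            (le_mul_of_one_le_right (by positivity) a5)
      _ = b := by rw [hb]; ring
  have b6 : 24 * l ≤ b := by
    calc 24 * l ≤ n * T * l * (N * U * e) := by
          refine (mul_le_mul_of_nonneg_right a3 (by linarith)).trans
            (le_mul_of_one_le_right (by positivity) a6)
      _ = b := by rw [hb]; ring
  nlinarith

/-- Rounding n down to a power of two loses less than a factor 2, which turns 1/16 into 1/8. -/
theorem log_le (hT : 1 < T) (hTn : (T : ℝ) < Real.exp (ε ^ 2 * n / 16)) :
    Real.log T ≤ ε ^ 2 / 8 * 2 ^ Nat.log 2 n := by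
  have h1 : Real.log T < ε ^ 2 * n / 16 :=
    (Real.log_lt_iff_lt_exp (by positivity)).2 hTn
  have h2 : (n : ℝ) ≤ 2 ^ (Nat.log 2 n + 1) := by
    exact_mod_cast (Nat.lt_pow_succ_log_self one_lt_two n).le
  rw [pow_succ] at h2
  have h3 := mul_le_mul_of_nonneg_left h2 (sq_nonneg ε)
  linarith

/-- The crude bound 2 ^ (n/2 + 1) ≥ n/2 suffices, since ε²n > 11 makes εn at least 550. -/
theorem small_le (hε : 0 < ε) (hε1 : ε ≤ 1 / 50) (h : 11 < ε ^ 2 * n) :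
    3 / 2 ^ (n / 2 + 1) ≤ ε / 4 := by
  have h1 : (n : ℝ) ≤ 2 * 2 ^ (n / 2 + 1) := by
    have h2 : n / 2 + 1 < 2 ^ (n / 2 + 1) := Nat.lt_two_pow_self
    exact_mod_cast (by omega : n ≤ 2 * 2 ^ (n / 2 + 1))
  rw [div_le_div_iff₀ (by positivity) (by norm_num)]
  have h2 : ε ^ 2 * n ≤ ε ^ 2 * (2 * 2 ^ (n / 2 + 1)) := mul_le_mul_of_nonneg_left h1 (sq_nonneg ε)
  have h3 : ε * (ε * (2 * 2 ^ (n / 2 + 1))) ≤ 1 / 50 * (ε * (2 * 2 ^ (n / 2 + 1))) :=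
    mul_le_mul_of_nonneg_right hε1 (by positivity)
  nlinarith

theorem n_ge (hε : 0 < ε) (hε1 : ε ≤ 1 / 50) (h : 11 < ε ^ 2 * n) : 64 ≤ n := by
  have h1 : ε ^ 2 * n ≤ (1 / 50) ^ 2 * n := by gcongr
  have : (64 : ℝ) ≤ n := by linarith
  exact_mod_cast this

theorem eight_mul_le {c : ℕ} (hc : 6 ≤ c) : 8 * c + 4 ≤ 2 ^ c := by
  induction c, hc using Nat.le_induction with
  | base => norm_num
  | succ c _ ih => rw [pow_succ]; omega

theorem prec_le (hn : 64 ≤ n) : n / 2 + 4 * Nat.log 2 n + 2 ≤ n := by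
  have h1 : 6 ≤ Nat.log 2 n := Nat.le_log_of_pow_le one_lt_two (by norm_num; exact hn)
  have h2 := eight_mul_le h1
  have h3 := Nat.pow_log_le_self 2 (show n ≠ 0 by omega)
  omega

end

end GenCCE

/-! ### Choice of parameters and conclusion -/

theorem theorem6 :
    ∃ (C₀ : ℕ) (B : GenCCE.Program), 0 < C₀ ∧
      ∀ (n T N U : ℕ) (ε : ℝ), 0 < ε → ε ≤ 1 →
        1 < T → (T : ℝ) < Real.exp (ε ^ 2 * (n : ℝ) / 16) →
        ∀ A : GenCCE.Program, GenCCE.SolvesGenCCE 3 n T ε N U A →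
        ∀ δ : ℝ, 0 < δ → δ ≤ 1 / 2 →
          GenCCE.SolvesNash 2 (n / 2) (50 * ε) δ
            (((n : ℝ) * T * N * U * Real.log (1 / δ) / ε) ^ C₀)
            (.ofList [.ofNat n, .ofNat T, .ofNat N, .ofNat ⌈1 / ε⌉₊, .ofNat ⌈Real.log (1 / δ)⌉₊])
            B A := by
  obtain ⟨B, C, hB⟩ := GenCCE.exists_reduction
  -- The factor 2 is the square in `ceil_bound`; C + 1 in place of C makes the exponent positive.
  refine ⟨2 * (C + 1), B, by omega, ?_⟩
  intro n T N U ε hε hε1 hT hTn A hA δ hδ hδ2 M hM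
  have h11 := GenCCE.lt_n_of_lt_exp hT hTn
  have hn := GenCCE.twelve_le hε hε1 h11
  obtain ⟨hN, hU⟩ := hA.pos (by omega) (by omega)
  have hbase := GenCCE.ceil_bound hε hε1 hn hT hN hU hδ hδ2
  set b : ℝ := (n : ℝ) * T * N * U * Real.log (1 / δ) / ε with hb
  have hM' : ∀ i a, GenCCE.HasBits (n / 2) (M.M i a) := fun i a => by
    have h := hM i a
    rwa [max_eq_left (by omega : 2 ≤ n / 2)] at h
  have hinv : 1 / ε ≤ ⌈1 / ε⌉₊ := Nat.le_ceil _
  have hinv0 : 0 < 1 / ε := by positivity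
  have hEpos : 0 < ⌈1 / ε⌉₊ := Nat.ceil_pos.2 hinv0
  let I : GenCCE.Inst :=
    { n := n, T := T, N := N, E := ⌈1 / ε⌉₊, l := ⌈Real.log (1 / δ)⌉₊, k := n / 2,
      c := Nat.log 2 n, M := M, hM := hM', hk2 := by omega, E_pos := hEpos, hkn := rfl, hcn := rfl }
  have hI : I.input = .pair (.ofList [.ofNat n, .ofNat T, .ofNat N, .ofNat ⌈1 / ε⌉₊,
      .ofNat ⌈Real.log (1 / δ)⌉₊]) M.encode := rfl
  have htime : ∀ t : ℕ, t ≤ (I.size + U + 2) ^ C → (t : ℝ) ≤ b ^ (2 * (C + 1)) := by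
    intro t ht
    have h1 : (t : ℝ) ≤ ((I.size + U + 2 : ℕ) : ℝ) ^ (C + 1) := by
      have := ht.trans (Nat.pow_le_pow_right (by omega : 0 < I.size + U + 2) (Nat.le_succ C))
      exact_mod_cast this
    rw [pow_mul]
    exact h1.trans (pow_le_pow_left₀ (by positivity) hbase _)
  rw [← hI]
  -- The case distinction is on the integer that the program receives. In the first case 50ε ≥ 1 and
  -- pure actions suffice.
  rcases le_or_gt ⌈1 / ε⌉₊ 50 with hE | hE
  · have h50 : 1 ≤ 50 * ε := by
      have h1 : (⌈1 / ε⌉₊ : ℝ) ≤ 50 := by exact_mod_cast hE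
      have := hinv.trans h1
      rwa [div_le_iff₀ hε] at this
    have hout := (hB (GenCCE.Computes A)).1 I hE
    have key : ∀ w, ∃ (u : GenCCE.Val) (t : ℕ), (GenCCE.RandComputes B A w I.input u t ∧
        (t : ℝ) ≤ b ^ (2 * (C + 1))) ∧ M.IsNashOutput (50 * ε) u := fun w => by
      obtain ⟨t, ht, h⟩ := hout w
      exact ⟨_, t, ⟨h, htime t (ht.trans (Nat.pow_le_pow_left (by omega) C))⟩,
        GenCCE.isNashOutput_pure (by omega) h50⟩
    refine ⟨fun w => (key _).imp fun u hu => hu.imp fun t h => h.1, ?_⟩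
    -- No coins are used, and the failure probability is zero.
    refine GenCCE.card_ge (K := 0) (Nat.zero_le _) (S := fun _ => True)
      (by simp [GenCCE.avg]; exact hδ.le) fun w _ => ?_
    obtain ⟨u, t, h⟩ := key (List.ofFn w)
    exact ⟨u, t, h.1.1, h.2⟩
  · have h50 : ε ≤ 1 / 50 := by
      have h1 : (50 : ℝ) < 1 / ε := by
        exact_mod_cast (Nat.lt_ceil.1 hE)
      rw [lt_div_iff₀ hε] at h1
      linarith
    have hn64 := GenCCE.n_ge hε h50 h11
    have hsize : I.G.size ≤ (n : ℕ∞) := GenCCE.game_size hM' I.hk2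
      (Nat.mul_div_le n 2) I.two_pow_le (GenCCE.prec_le hn64)
    obtain ⟨u, t₀, hcomp, ht₀, σ, c, ⟨_, hcce⟩, hc, rfl⟩ := hA I.G hsize
    -- One answer of the subroutine, combined with arbitrary coins: the subroutine is deterministic
    -- and is called before any coin is tossed.
    let J : List Bool → GenCCE.Sol := fun w => { I with σ := σ, C := c, hC := hc, w := w }
    have hred := fun w => (hB (GenCCE.Computes A)).2 (J w) U t₀ hE hcomp ht₀
    let K := I.l * (2 ^ I.c * (I.N + I.N))
    have hK : K ≤ ⌊b ^ (2 * (C + 1))⌋₊ := by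
      refine Nat.le_floor (htime K ?_)
      have h := (hred (List.replicate K false) (List.length_replicate ..)).1
      exact (List.length_replicate (n := K) (a := false)).symm.trans_le h
    have key : ∀ w : Fin ⌊b ^ (2 * (C + 1))⌋₊ → Bool, ∃ t : ℕ,
        GenCCE.RandComputes B A (List.ofFn w) I.input
          ((J ((List.ofFn w).take K).reverse).scan I.l) t ∧ (t : ℝ) ≤ b ^ (2 * (C + 1)) := by
      intro w
      obtain ⟨t, ht, h⟩ := (hred ((List.ofFn w).take K).reverse (by
        show ((List.ofFn w).take K).reverse.length = K
        simpa using hK)).2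
        ((List.ofFn w).drop K)
      refine ⟨t, ?_, htime t ht⟩
      have e : (J ((List.ofFn w).take K).reverse).w.reverse ++ (List.ofFn w).drop K =
          List.ofFn w := by
        show ((List.ofFn w).take K).reverse.reverse ++ (List.ofFn w).drop K = _
        rw [List.reverse_reverse, List.take_append_drop]
      rw [e] at h
      exact h
    refine ⟨fun w => ⟨_, key w⟩, ?_⟩
    have hE' : (⌈1 / ε⌉₊ : ℝ) < 1 / ε + 1 := Nat.ceil_lt_add_one hinv0.le
    have hEr : (0 : ℝ) < ⌈1 / ε⌉₊ := by exact_mod_cast hEpos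
    -- Since ⌈1/ε⌉ < 1/ε + 1, the threshold exceeds 50ε/(1 + ε), and ε ≤ 1/50. This gap between 49
    -- and 50 pays for rounding 1/ε.
    have hr : 49 * ε ≤ 50 / (⌈1 / ε⌉₊ : ℝ) := by
      rw [le_div_iff₀ hEr]
      have h1 : ε * ⌈1 / ε⌉₊ ≤ ε * (1 / ε + 1) := mul_le_mul_of_nonneg_left hE'.le hε.le
      have h2 : ε * (1 / ε + 1) = 1 + ε := by field_simp
      linarith
    have hfail := GenCCE.avg_all_fail_le hM' (by omega : 0 < T) (fun t => (J []).dyadic t) hε hε1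
      hcce (GenCCE.log_le hT hTn) (GenCCE.small_le hε h50 h11) hr ⌈Real.log (1 / δ)⌉₊
    have hexp : Real.exp (-(⌈Real.log (1 / δ)⌉₊ : ℝ)) ≤ δ := by
      have h1 := Nat.le_ceil (Real.log (1 / δ))
      rw [one_div, Real.log_inv] at h1 ⊢
      calc Real.exp (-(⌈-Real.log δ⌉₊ : ℝ)) ≤ Real.exp (Real.log δ) :=
            Real.exp_le_exp.2 (by linarith)
        _ = δ := Real.exp_log hδ
    classical
    refine GenCCE.card_ge (K := K) hK (hfail.trans hexp) fun w hw => ?_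
    obtain ⟨t, ht, _⟩ := key w
    refine ⟨_, t, ht, ((J ((List.ofFn w).take K).reverse).good_scan hw).mono ?_⟩
    -- The other side of the rounding: passing the test guarantees a gap of at most 50ε.
    show 50 / (⌈1 / ε⌉₊ : ℝ) ≤ 50 * ε
    rw [div_le_iff₀ hEr]
    rw [div_le_iff₀ hε] at hinv
    linarith
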